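/- **Theorem (asymptotic normality of the cross-fitted estimator).** *Setting.* A trajectory is $O=(X_1,A_1,Y_2,\dots,X_T,A_T,Y_{T+1})$ with $A_t\in\{0,1\}$, $Y_{t+1}\in\mathbb R$, and $X_t$ containing an availability indicator $I_t\in\{0,1\}$; $H_t=(X_1,A_1,Y_2,\dots,X_{t-1},A_{t-1},Y_t,X_t)$ is the history and $S_t$ is a given function of $H_t$. If $I_t=0$ then $A_t=0$; $p_t=p_t(H_t)=P(A_t=1\mid H_t)$ is known, and for some $\tau>0$ one has $\tau<p_t<1-\tau$ almost surely on $\{I_t=1\}$. Let $g$ be the identity or the logarithm, let $\gamma_t(s;\beta)$ be a given function, measurable in $s$ and twice continuously differentiable in $\beta\in\mathbb R^p$ with $\gamma_t,\partial_\beta\gamma_t,\partial_\beta^2\gamma_t$ bounded on bounded sets of $(s,\beta)$, let $\Theta\subset\mathbb R^p$, and suppose that $\beta^\star\in\Theta$ satisfies, for $t=1,\dots,T$ and almost surely on $\{I_t=1\}$, $$g[\mathbb E\{\mathbb E(Y_{t+1}\mid H_t,A_t=1)\mid S_t,I_t=1\}]-g[\mathbb E\{\mathbb E(Y_{t+1}\mid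 H_t,A_t=0)\mid S_t,I_t=1\}]=\gamma_t(S_t;\beta^\star)$$ (the two inner means being positive if $g=\log$). For a function $\mu_t(h_t,a_t)$ put $$\phi_t(\beta,\mu_t)=\tfrac{A_t-p_t}{p_t(1-p_t)}I_t\,R_t\,\partial_\beta\gamma_t(S_t;\beta),$$ where $R_t=Y_{t+1}-(A_t+p_t-1)\gamma_t(S_t;\beta)-(1-p_t)\mu_t(H_t,1)-p_t\mu_t(H_t,0)$ if $g$ is the identity and $R_t=e^{-A_t\gamma_t(S_t;\beta)}Y_{t+1}-(1-p_t)e^{-\gamma_t(S_t;\beta)}\mu_t(H_t,1)-p_t\mu_t(H_t,0)$ if $g=\log$. $\mathbb P$ denotes expectation over a new trajectory with the fitted functions held fixed, $\|\cdot\|$ is the norm of $L_2(P)$ (Frobenius norm for matrices), and $v^{\otimes2}=vv^T$. *Estimator.* Fix $K\ge2$. Let $O_1,O_2,\dots$ be i.i.d. copies of $O$, let $n=KN$, and let $(B_k)_{k=1}^K$ be a random partition of $\{1,\dots,n\}$ into sets of size $N$, independent of the data. For each $k$, using only the observations with index outside $B_k$: let $\hat\mu_{kt}$ be any fit of $\mathbb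 E(Y_{t+1}\mid H_t,A_t,I_t=1)$; let $\hat\beta^{\rm init}_k\in\Theta$ solve $\sum_{i\notin B_k}\sum_t\phi_t(\beta,\hat\mu_{kt})(O_i)=0$; and, with any fits $\hat G_{kt}(s;\mu_t,\beta)$ of $\mathbb E\{\partial_\beta\phi_t(\beta,\mu_t)\mid S_t=s\}$ and $\hat M_{kt}(s;\mu_t,\beta)$ of $\mathbb E\{\phi_t(\beta,\mu_t)^{\otimes2}\mid S_t=s\}$, let $\hat d_{kt}(s;\mu_t,\beta)=\hat G_{kt}\hat M_{kt}^{+}$ ($^+$ is the Moore–Penrose inverse). Let $\check\beta\in\Theta$ solve $K^{-1}\sum_k\mathbb P_{n,k}\sum_t\hat d_{kt}(S_t;\hat\mu_{kt},\hat\beta_k^{\rm init})\phi_t(\beta,\hat\mu_{kt})=0$, where $\mathbb P_{n,k}$ is the empirical average over $B_k$. (Both equations need to be solved only with probability tending to one.) *Assumptions.* (a) For each $t$ there is a function $\mu_t'(h_t,a_t)$ with $\|\hat\mu_{kt}-\mu_t'\|=o_P(1)$ for all $k$. (b) For each $t$ there is a function $d_t'(s_t)$ in $L_2(P)$ to which the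 fitted weights converge: for all $t$ and $k$, $\|\hat d_{kt}(\cdot;\hat\mu_{kt},\hat\beta^{\rm init}_k)-d_t'\|=o_P(1)$; or, alternatively, for all $t$ and $k$, $\|\hat d_{kt}(\cdot;\mu_t',\beta^\star)-d_t'\|=o_P(1)$, $\hat\beta_k^{\rm init}\to\beta^\star$ in probability, and $(\mu_t,\beta)\mapsto\hat d_{kt}(\cdot;\mu_t,\beta)\in L_2(P)$, for $\beta\in\Theta$ and $\mu_t$ bounded by the constant $C$ of (d), is stochastically equicontinuous at $(\mu_t',\beta^\star)$: for all $\varepsilon,\eta>0$ there is $\delta>0$ such that, for all large $n$, with probability at least $1-\eta$ one has $\|\hat d_{kt}(\cdot;\mu_t,\beta)-\hat d_{kt}(\cdot;\mu_t',\beta^\star)\|<\varepsilon$ whenever $\|\mu_t-\mu'_t\|\le\delta$ and $|\beta-\beta^\star|\le\delta$. (c) $\mathbb P\sum_td_t'(S_t)\phi_t(\beta,\mu_t')=0$ has a unique solution $\beta\in\Theta$. (d) $\Theta$ is compact, the support of $O$ (and of $S_t$) is bounded, $|\hat\mu_{kt}|$ and $|\mu_t'|$ are bounded by a constant $C$ that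 does not depend on $n$, and $\mathbb P\{\sum_td_t'(S_t)\partial_\beta\phi_t(\beta^\star,\mu_t')\}$ is invertible. *Conclusion.* As $n\to\infty$, $\sqrt n(\check\beta-\beta^\star)\stackrel d\to N(0,V)$ with $$V=\mathbb P\Big\{\sum_td_t'(S_t)\partial_\beta\phi_t(\beta^\star,\mu_t')\Big\}^{-1}\,\mathbb P\Big[\Big\{\sum_td_t'(S_t)\phi_t(\beta^\star,\mu_t')\Big\}^{\otimes2}\Big]\,\mathbb P\Big\{\sum_td_t'(S_t)\partial_\beta\phi_t(\beta^\star,\mu_t')\Big\}^{-1,T},$$ and, with $\hat d_{kt}=\hat d_{kt}(S_t;\hat\mu_{kt},\hat\beta^{\rm init}_k)$, the matrix $$\Big[\tfrac1K\sum_k\mathbb P_{n,k}\Big\{\sum_t\hat d_{kt}\,\partial_\beta\phi_t(\check\beta,\hat\mu_{kt})\Big\}\Big]^{-1}\Big(\tfrac1K\sum_k\mathbb P_{n,k}\Big[\Big\{\sum_t\hat d_{kt}\,\phi_t(\check\beta,\hat\mu_{kt})\Big\}^{\otimes2}\Big]\Big)\Big[\tfrac1K\sum_k\mathbb P_{n,k}\Big\{\sum_t\hat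 d_{kt}\,\partial_\beta\phi_t(\check\beta,\hat\mu_{kt})\Big\}\Big]^{-1,T}$$ converges to $V$ in probability. No Donsker condition is imposed. -/

import Mathlib

open MeasureTheory ProbabilityTheory Filter Topology
open scoped ENNReal Matrix

namespace MRT

noncomputable section

/-! ### Data of a micro-randomized trial -/

/-- `ℝ^d` with the Euclidean norm. -/
abbrev Vec (d : ℕ) : Type := EuclideanSpace ℝ (Fin d)

/-- The covariates `X_t`: the availability indicator `I_t` together with a vector in `ℝ^q`. -/
abbrev Cov (q : ℕ) : Type := Bool × Vec q

/-- `(X_t, A_t, Y_{t+1})`. -/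
abbrev Step (q : ℕ) : Type := Cov q × Bool × ℝ

/-- A trajectory `O = (X_1, A_1, Y_2, …, X_T, A_T, Y_{T+1})`. -/
abbrev Traj (T q : ℕ) : Type := Fin T → Step q

/-- Values of the history `H_t = (X_1, A_1, Y_2, …, X_{t-1}, A_{t-1}, Y_t, X_t)`,
where `t` is the number of decision points before the current one. -/
abbrev Hist (q t : ℕ) : Type := (Fin t → Step q) × Cov q

variable {T q r p : ℕ}

/-- `I_t`. -/
def avail (t : Fin T) (o : Traj T q) : Bool := (o t).1.1

/-- The vector part of `X_t`. -/
def covar (t : Fin T) (o : Traj T q) : Vec q := (o t).1.2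

/-- `A_t`. -/
def trt (t : Fin T) (o : Traj T q) : Bool := (o t).2.1

/-- `Y_{t+1}`. -/
def outc (t : Fin T) (o : Traj T q) : ℝ := (o t).2.2

/-- `H_t`. -/
def hist (t : Fin T) (o : Traj T q) : Hist q t :=
  (fun u => o (Fin.castLE t.isLt.le u), (o t).1)

/-- A binary variable as a real number. -/
def bit (b : Bool) : ℝ := if b then 1 else 0

/-- The two link functions. -/
inductive Link where
  | identity
  | log

/-- The link function `g`. -/
def Link.fn : Link → ℝ → ℝ
  | .identity => fun x => x
  | .log => Real.log

/-- What the analyst specifies: the link `g`, the moderators `S_t` (a function of `H_t`), the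
randomization probabilities `p_t(H_t)` and the model `γ_t(s; β)` of the causal excursion effect,
which is twice continuously differentiable in `β`, with derivatives up to order two that are
bounded on bounded sets. -/
structure Spec (T q r p : ℕ) where
  link : Link
  modr : ∀ t : Fin T, Hist q t → Vec r
  modr_meas : ∀ t, Measurable (modr t)
  prob : ∀ t : Fin T, Hist q t → ℝ
  prob_meas : ∀ t, Measurable (prob t)
  gam : Fin T → Vec r → Vec p → ℝ
  gam_meas : ∀ t b, Measurable fun s => gam t s b
  gam_contDiff : ∀ t s, ContDiff ℝ 2 (gam t s)
  gam_bdd : ∀ (t : Fin T) (R : ℝ), ∃ C : ℝ, ∀ (s : Vec r) (b : Vec p), ‖s‖ ≤ R → ‖b‖ ≤ R →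
    |gam t s b| ≤ C ∧ ‖fderiv ℝ (gam t s) b‖ ≤ C ∧ ‖fderiv ℝ (fderiv ℝ (gam t s)) b‖ ≤ C

namespace Spec

variable (M : Spec T q r p)

/-- The moderators `S_t` of a trajectory. -/
def S (t : Fin T) (o : Traj T q) : Vec r := M.modr t (hist t o)

/-- The design of the trial under the law `P` of a trajectory: no treatment when unavailable,
`p_t(H_t)` is the conditional probability of treatment given `H_t`, and positivity. -/
structure Design (P : Measure (Traj T q)) : Prop where
  unavailable : ∀ t, ∀ᵐ o ∂P, avail t o = false → trt t o = false
  randomized : ∀ t,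
    condExp (MeasurableSpace.comap (hist t) inferInstance) P (fun o => bit (trt t o))
      =ᵐ[P] fun o => M.prob t (hist t o)
  positivity : ∃ τ : ℝ, 0 < τ ∧ ∀ t, ∀ᵐ o ∂P, avail t o = true →
    τ < M.prob t (hist t o) ∧ M.prob t (hist t o) < 1 - τ

/-- `E(Y_{t+1} | H_t, A_t = a)`: conditional expectation given `H_t` under `P(· | A_t = a)`. -/
def meanGivenHist (P : Measure (Traj T q)) (t : Fin T) (a : Bool) : Traj T q → ℝ :=
  condExp (MeasurableSpace.comap (hist t) inferInstance)
    (ProbabilityTheory.cond P {o | trt t o = a}) (outc t)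

/-- `E{E(Y_{t+1} | H_t, A_t = a) | S_t, I_t = 1}`: conditional expectation given `S_t` under
`P(· | I_t = 1)`. -/
def meanGivenMod (P : Measure (Traj T q)) (t : Fin T) (a : Bool) : Traj T q → ℝ :=
  condExp (MeasurableSpace.comap (M.S t) inferInstance)
    (ProbabilityTheory.cond P {o | avail t o = true}) (meanGivenHist P t a)

/-- The model for the causal excursion effect holds with the parameter value `b`. For the log link
the two means have to be positive, so that their logarithms make sense. -/
def EffectModel (P : Measure (Traj T q)) (b : Vec p) : Prop :=
  ∀ t, ∀ᵐ o ∂(ProbabilityTheory.cond P {o | avail t o = true}),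
    (M.link = Link.log → 0 < M.meanGivenMod P t true o ∧ 0 < M.meanGivenMod P t false o) ∧
    M.link.fn (M.meanGivenMod P t true o) - M.link.fn (M.meanGivenMod P t false o)
      = M.gam t (M.S t o) b

/-- The observations are bounded. The clause on `S_t` follows from the other two when `S_t` is a
sub-vector of `H_t`. -/
def BoundedSupport (P : Measure (Traj T q)) : Prop :=
  ∃ R : ℝ, ∀ t, ∀ᵐ o ∂P, ‖covar t o‖ ≤ R ∧ |outc t o| ≤ R ∧ ‖M.S t o‖ ≤ R

/-! ### The estimating function -/

/-- The factor in braces in `φ_t(β, μ_t)`. -/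
def resid (t : Fin T) (b : Vec p) (mu : Hist q t → Bool → ℝ) (o : Traj T q) : ℝ :=
  let h := hist t o
  let a := bit (trt t o)
  let g := M.gam t (M.S t o) b
  let π := M.prob t h
  match M.link with
  | .identity => outc t o - (a + π - 1) * g - (1 - π) * mu h true - π * mu h false
  | .log => Real.exp (-a * g) * outc t o - (1 - π) * Real.exp (-g) * mu h true - π * mu h false

/-- `φ_t(β, μ_t)`. -/
def phi (t : Fin T) (b : Vec p) (mu : Hist q t → Bool → ℝ) (o : Traj T q) : Vec p :=
  ((bit (trt t o) - M.prob t (hist t o)) /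
      (M.prob t (hist t o) * (1 - M.prob t (hist t o))) * bit (avail t o) * M.resid t b mu o) •
    gradient (M.gam t (M.S t o)) b

/-- The Jacobian matrix `∂_β φ_t(β, μ_t)`. -/
def dphi (t : Fin T) (b : Vec p) (mu : Hist q t → Bool → ℝ) (o : Traj T q) :
    Matrix (Fin p) (Fin p) ℝ :=
  Matrix.of fun i j => fderiv ℝ (fun b' => M.phi t b' mu o) b (EuclideanSpace.single j 1) i

/-- `∑_t d_t(S_t) φ_t(β, μ_t)`. -/
def psi (d : Fin T → Vec r → Matrix (Fin p) (Fin p) ℝ) (mu : ∀ t : Fin T, Hist q t → Bool → ℝ)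
    (b : Vec p) (o : Traj T q) : Vec p :=
  ∑ t, WithLp.toLp 2 (d t (M.S t o) *ᵥ WithLp.ofLp (M.phi t b (mu t) o))

/-- `∑_t d_t(S_t) ∂_β φ_t(β, μ_t)`. -/
def dpsi (d : Fin T → Vec r → Matrix (Fin p) (Fin p) ℝ) (mu : ∀ t : Fin T, Hist q t → Bool → ℝ)
    (b : Vec p) (o : Traj T q) : Matrix (Fin p) (Fin p) ℝ :=
  ∑ t, d t (M.S t o) * M.dphi t b (mu t) o

/-- The population matrix `P{∑_t d_t(S_t) ∂_β φ_t(β, μ_t)}`. -/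
def bread (P : Measure (Traj T q)) (d : Fin T → Vec r → Matrix (Fin p) (Fin p) ℝ)
    (mu : ∀ t : Fin T, Hist q t → Bool → ℝ) (b : Vec p) : Matrix (Fin p) (Fin p) ℝ :=
  Matrix.of fun i j => ∫ o, M.dpsi d mu b o i j ∂P

/-- The population matrix `P[{∑_t d_t(S_t) φ_t(β, μ_t)}^{⊗2}]`. -/
def meat (P : Measure (Traj T q)) (d : Fin T → Vec r → Matrix (Fin p) (Fin p) ℝ)
    (mu : ∀ t : Fin T, Hist q t → Bool → ℝ) (b : Vec p) : Matrix (Fin p) (Fin p) ℝ :=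
  Matrix.of fun i j => ∫ o, M.psi d mu b o i * M.psi d mu b o j ∂P

/-- The asymptotic variance `V`. -/
def asympVar (P : Measure (Traj T q)) (d : Fin T → Vec r → Matrix (Fin p) (Fin p) ℝ)
    (mu : ∀ t : Fin T, Hist q t → Bool → ℝ) (b : Vec p) : Matrix (Fin p) (Fin p) ℝ :=
  (M.bread P d mu b)⁻¹ * M.meat P d mu b * ((M.bread P d mu b)⁻¹)ᵀ

/-- `P ∑_t d_t(S_t) φ_t(β, μ_t) = 0` has exactly one solution `β` in `Θ`. -/
def UniqueZero (P : Measure (Traj T q)) (Θ : Set (Vec p))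
    (d : Fin T → Vec r → Matrix (Fin p) (Fin p) ℝ)
    (mu : ∀ t : Fin T, Hist q t → Bool → ℝ) : Prop :=
  ∃! b, b ∈ Θ ∧ ∫ o, M.psi d mu b o ∂P = 0

/-- `‖d₁ - d₂‖²` in `L₂(P)` (Frobenius norm) for matrix functions of `S_t`. -/
def sqDistD (P : Measure (Traj T q)) (t : Fin T) (d₁ d₂ : Vec r → Matrix (Fin p) (Fin p) ℝ) :
    ℝ≥0∞ :=
  ∫⁻ o, ENNReal.ofReal (∑ i, ∑ j, (d₁ (M.S t o) i j - d₂ (M.S t o) i j) ^ 2) ∂P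

end Spec

/-- `‖μ₁ - μ₂‖²` in `L₂(P)` for functions of `(H_t, A_t)`. -/
def sqDistMu (P : Measure (Traj T q)) (t : Fin T) (mu₁ mu₂ : Hist q t → Bool → ℝ) : ℝ≥0∞ :=
  ∫⁻ o, ENNReal.ofReal ((mu₁ (hist t o) (trt t o) - mu₂ (hist t o) (trt t o)) ^ 2) ∂P

/-- `|μ(H_t, A_t)| ≤ C` almost surely. -/
def BoundedMu (P : Measure (Traj T q)) (C : ℝ) (t : Fin T) (mu : Hist q t → Bool → ℝ) : Prop :=
  ∀ᵐ o ∂P, |mu (hist t o) (trt t o)| ≤ C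

/-- `X_N = o_P(1)` for nonnegative random quantities. -/
def LittleOP {Ω : Type*} [MeasurableSpace Ω] (Pr : Measure Ω) (X : ℕ → Ω → ℝ≥0∞) : Prop :=
  ∀ ε : ℝ≥0∞, 0 < ε → Tendsto (fun N => Pr {ω | ε ≤ X N ω}) atTop (𝓝 0)

/-- An event holds with probability tending to one. -/
def Whp {Ω : Type*} [MeasurableSpace Ω] (Pr : Measure Ω) (E : ℕ → Ω → Prop) : Prop :=
  Tendsto (fun N => Pr {ω | ¬ E N ω}) atTop (𝓝 0)

/-! ### The Moore–Penrose inverse -/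

/-- The four Penrose equations. -/
structure IsPenrose (A X : Matrix (Fin p) (Fin p) ℝ) : Prop where
  left : A * X * A = A
  right : X * A * X = X
  symm_left : (A * X)ᵀ = A * X
  symm_right : (X * A)ᵀ = X * A

theorem IsPenrose.unique {A X Y : Matrix (Fin p) (Fin p) ℝ} (hX : IsPenrose A X)
    (hY : IsPenrose A Y) : X = Y := by
  have h1 : A * X = A * Y := by
    calc A * X = (A * X)ᵀ := hX.symm_left.symm
      _ = (A * Y * A * X)ᵀ := by rw [hY.left]
      _ = (A * X)ᵀ * (A * Y)ᵀ := by rw [← Matrix.transpose_mul, Matrix.mul_assoc (A * Y)]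
      _ = A * X * (A * Y) := by rw [hX.symm_left, hY.symm_left]
      _ = A * X * A * Y := by simp only [Matrix.mul_assoc]
      _ = A * Y := by rw [hX.left]
  have h2 : X * A = Y * A := by
    calc X * A = (X * A)ᵀ := hX.symm_right.symm
      _ = (X * (A * Y * A))ᵀ := by rw [hY.left]
      _ = (Y * A)ᵀ * (X * A)ᵀ := by
        rw [← Matrix.transpose_mul]; simp only [Matrix.mul_assoc]
      _ = Y * A * (X * A) := by rw [hX.symm_right, hY.symm_right]
      _ = Y * (A * X * A) := by simp only [Matrix.mul_assoc]
      _ = Y * A := by rw [hX.left]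
  calc X = X * A * X := hX.right.symm
    _ = Y * (A * X) := by rw [h2, Matrix.mul_assoc]
    _ = Y * A * Y := by rw [h1, Matrix.mul_assoc]
    _ = Y := hY.right

theorem exists_isPenrose (A : Matrix (Fin p) (Fin p) ℝ) : ∃ X, IsPenrose A X := by
  have hB : (Aᴴ * A).IsHermitian := Matrix.isHermitian_conjTranspose_mul_self A
  let U : Matrix (Fin p) (Fin p) ℝ := hB.eigenvectorUnitary
  let D : Matrix (Fin p) (Fin p) ℝ := Matrix.diagonal hB.eigenvalues
  let E : Matrix (Fin p) (Fin p) ℝ := Matrix.diagonal fun i => (hB.eigenvalues i)⁻¹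
  have hU : Uᴴ * U = 1 := Unitary.coe_star_mul_self hB.eigenvectorUnitary
  have hspec : Aᴴ * A = U * D * Uᴴ := by
    have h := hB.spectral_theorem
    simpa [U, D, Unitary.conjStarAlgAut_apply, Matrix.star_eq_conjTranspose,
      Function.comp_def] using h
  have hDE : D * E * D = D := by
    simp only [D, E, Matrix.diagonal_mul_diagonal]
    congr 1; funext i; exact mul_inv_mul_cancel _
  have hED : E * D * E = E := by
    simp only [D, E, Matrix.diagonal_mul_diagonal]
    congr 1; funext i; simpa using mul_inv_mul_cancel (hB.eigenvalues i)⁻¹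
  have hDt : Dᴴ = D := by simp [D]
  have hEt : Eᴴ = E := by simp [E]
  have hcomm : E * D = D * E := by
    simp only [D, E, Matrix.diagonal_mul_diagonal, mul_comm]
  have hU' : ∀ Z : Matrix (Fin p) (Fin p) ℝ, Uᴴ * (U * Z) = Z := fun Z => by
    rw [← Matrix.mul_assoc, hU, Matrix.one_mul]
  let G : Matrix (Fin p) (Fin p) ℝ := U * E * Uᴴ
  have hGt : Gᴴ = G := by
    simp only [G, Matrix.conjTranspose_mul, Matrix.conjTranspose_conjTranspose, hEt,
      Matrix.mul_assoc]
  have hGB : G * (Aᴴ * A) = U * (E * D) * Uᴴ := by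
    rw [hspec]; simp only [G, Matrix.mul_assoc, hU']
  have hBGB : Aᴴ * A * (G * (Aᴴ * A)) = Aᴴ * A := by
    rw [hGB, hspec]
    calc U * D * Uᴴ * (U * (E * D) * Uᴴ) = U * (D * E * D) * Uᴴ := by
          simp only [Matrix.mul_assoc, hU']
      _ = U * D * Uᴴ := by rw [hDE]
  have hGBG : G * (Aᴴ * A) * G = G := by
    rw [hGB]
    calc U * (E * D) * Uᴴ * G = U * (E * D * E) * Uᴴ := by
          simp only [G, Matrix.mul_assoc, hU']
      _ = G := by rw [hED]
  refine ⟨G * Aᴴ, ?_, ?_, ?_, ?_⟩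
  · have h0 : Aᴴ * A * (G * (Aᴴ * A) - 1) = 0 := by
      rw [Matrix.mul_sub, hBGB, Matrix.mul_one, sub_self]
    have h1 : A * (G * (Aᴴ * A) - 1) = 0 := (Matrix.conjTranspose_mul_self_mul_eq_zero A _).1 h0
    rw [Matrix.mul_sub, Matrix.mul_one, sub_eq_zero] at h1
    simpa only [Matrix.mul_assoc] using h1
  · calc G * Aᴴ * A * (G * Aᴴ) = G * (Aᴴ * A) * G * Aᴴ := by simp only [Matrix.mul_assoc]
      _ = G * Aᴴ := by rw [hGBG]
  · rw [← Matrix.conjTranspose_eq_transpose_of_trivial]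
    simp only [Matrix.conjTranspose_mul, Matrix.conjTranspose_conjTranspose, hGt,
      Matrix.mul_assoc]
  · rw [← Matrix.conjTranspose_eq_transpose_of_trivial, Matrix.mul_assoc, hGB]
    have hEDt : (E * D)ᴴ = E * D := by rw [Matrix.conjTranspose_mul, hDt, hEt, hcomm]
    rw [Matrix.conjTranspose_mul, Matrix.conjTranspose_mul, hEDt,
      Matrix.conjTranspose_conjTranspose, ← Matrix.mul_assoc]

/-- The Moore–Penrose inverse `A⁺`. -/
def pinv (A : Matrix (Fin p) (Fin p) ℝ) : Matrix (Fin p) (Fin p) ℝ :=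
  (exists_isPenrose A).choose

/-! ### Cross-fitting -/

/-- A sample of size `n = K * N`, restricted to the complement of the `k`-th fold of the
partition `π`. -/
abbrev Train (T q K N : ℕ) (π : Fin (K * N) → Fin K) (k : Fin K) : Type :=
  {i : Fin (K * N) // π i ≠ k} → Traj T q

/-- The empirical average over a finite index set. -/
def avg {ι E : Type*} [AddCommGroup E] [Module ℝ E] (s : Finset ι) (f : ι → E) : E :=
  (s.card : ℝ)⁻¹ • ∑ i ∈ s, f i

/-- `K⁻¹ ∑_k P_{n,k} F_k`, where `P_{n,k}` is the empirical average over the `k`-th fold. -/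
def foldAvg {K N : ℕ} {E : Type*} [AddCommGroup E] [Module ℝ E] (π : Fin (K * N) → Fin K)
    (F : Fin K → Fin (K * N) → E) : E :=
  (K : ℝ)⁻¹ • ∑ k, avg (Finset.univ.filter fun i => π i = k) (F k)

/-- Arbitrary fitting procedures, using only the observations outside the `k`-th fold.
`muHat` is the fitted `E(Y_{t+1} | H_t, A_t, I_t = 1)`, `betaInit` the preliminary estimator,
`gradHat` the fitted `E{∂_β φ_t(β, μ_t) | S_t = s}` and `meatHat` the fitted
`E{φ_t(β, μ_t)^{⊗2} | S_t = s}`, the last two for arbitrary `μ_t` and `β`. -/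
structure Learner (T q r p K : ℕ) where
  muHat : ∀ (N : ℕ) (π : Fin (K * N) → Fin K) (k : Fin K), Train T q K N π k →
    ∀ t : Fin T, Hist q t → Bool → ℝ
  betaInit : ∀ (N : ℕ) (π : Fin (K * N) → Fin K) (k : Fin K), Train T q K N π k → Vec p
  gradHat : ∀ (N : ℕ) (π : Fin (K * N) → Fin K) (k : Fin K), Train T q K N π k →
    ∀ t : Fin T, (Hist q t → Bool → ℝ) → Vec p → Vec r → Matrix (Fin p) (Fin p) ℝ
  meatHat : ∀ (N : ℕ) (π : Fin (K * N) → Fin K) (k : Fin K), Train T q K N π k →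
    ∀ t : Fin T, (Hist q t → Bool → ℝ) → Vec p → Vec r → Matrix (Fin p) (Fin p) ℝ

namespace Learner

variable {K : ℕ} (L : Learner T q r p K)

/-- The plug-in weight `d̂_{kt}(s; μ_t, β)`. -/
def dHat (N : ℕ) (π : Fin (K * N) → Fin K) (k : Fin K) (z : Train T q K N π k) (t : Fin T)
    (mu : Hist q t → Bool → ℝ) (b : Vec p) (s : Vec r) : Matrix (Fin p) (Fin p) ℝ :=
  L.gradHat N π k z t mu b s * pinv (L.meatHat N π k z t mu b s)

/-- The weight `d̂_{kt}(s; μ̂_{kt}, β̂_k^init)` that enters the final estimating equation. -/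
def wHat (N : ℕ) (π : Fin (K * N) → Fin K) (k : Fin K) (z : Train T q K N π k) (t : Fin T)
    (s : Vec r) : Matrix (Fin p) (Fin p) ℝ :=
  L.dHat N π k z t (L.muHat N π k z t) (L.betaInit N π k z) s

/-- All fitted objects are measurable. -/
structure Meas : Prop where
  muHat : ∀ N π k (t : Fin T), Measurable fun x : Train T q K N π k × Hist q t × Bool =>
    L.muHat N π k x.1 t x.2.1 x.2.2
  betaInit : ∀ N π k, Measurable (L.betaInit N π k)
  wHat : ∀ N π k t i j, Measurable fun x : Train T q K N π k × Vec r =>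
    L.wHat N π k x.1 t x.2 i j
  dHat : ∀ N π k (t : Fin T) (mu : Hist q t → Bool → ℝ) b i j,
    (Measurable fun y : Hist q t × Bool => mu y.1 y.2) →
      Measurable fun x : Train T q K N π k × Vec r => L.dHat N π k x.1 t mu b x.2 i j

end Learner

/-- A sampling scheme for cross-fitting: i.i.d. trajectories `O_1, O_2, …` with law `P` and, for
every `N`, a random partition of the first `n = K * N` indices into `K` folds of size `N` that is
independent of the trajectories. -/
structure Sampling {Ω : Type*} [MeasurableSpace Ω] (Pr : Measure Ω) (P : Measure (Traj T q))
    {K : ℕ} (O : ℕ → Ω → Traj T q) (fold : ∀ N : ℕ, Ω → Fin (K * N) → Fin K) : Prop where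
  meas : ∀ i, Measurable (O i)
  law : ∀ i, Measure.map (O i) Pr = P
  indep : iIndepFun O Pr
  fold_meas : ∀ N, Measurable (fold N)
  fold_size : ∀ N ω k, (Finset.univ.filter fun i => fold N ω i = k).card = N
  fold_indep : ∀ N, IndepFun (fold N) (fun ω i => O i ω) Pr

section estimator

variable {Ω : Type*} {K : ℕ} (O : ℕ → Ω → Traj T q) (fold : ∀ N : ℕ, Ω → Fin (K * N) → Fin K)

/-- The observations outside the `k`-th fold. -/
def train (N : ℕ) (k : Fin K) (ω : Ω) : Train T q K N (fold N ω) k := fun i => O i.1 ω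

variable (M : Spec T q r p) (L : Learner T q r p K)

/-- `μ̂_{kt}`. -/
def muFit (N : ℕ) (k : Fin K) (ω : Ω) (t : Fin T) : Hist q t → Bool → ℝ :=
  L.muHat N (fold N ω) k (train O fold N k ω) t

/-- `β̂_k^init`. -/
def initFit (N : ℕ) (k : Fin K) (ω : Ω) : Vec p :=
  L.betaInit N (fold N ω) k (train O fold N k ω)

/-- `d̂_{kt}(·; μ_t, β)`. -/
def dFit (N : ℕ) (k : Fin K) (ω : Ω) (t : Fin T) (mu : Hist q t → Bool → ℝ) (b : Vec p) :
    Vec r → Matrix (Fin p) (Fin p) ℝ :=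
  L.dHat N (fold N ω) k (train O fold N k ω) t mu b

/-- `d̂_{kt}(·; μ̂_{kt}, β̂_k^init)`. -/
def wFit (N : ℕ) (k : Fin K) (ω : Ω) (t : Fin T) : Vec r → Matrix (Fin p) (Fin p) ℝ :=
  L.wHat N (fold N ω) k (train O fold N k ω) t

/-- The preliminary equation: `b` solves `∑_t φ_t(b, μ̂_{kt}) = 0` on average over the observations
outside the `k`-th fold. -/
def InitEq (N : ℕ) (k : Fin K) (ω : Ω) (b : Vec p) : Prop :=
  avg (Finset.univ : Finset {i : Fin (K * N) // fold N ω i ≠ k})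
    (fun i => ∑ t, M.phi t b (muFit O fold L N k ω t) (O i.1 ω)) = 0

/-- The final, cross-fitted equation
`K⁻¹ ∑_k P_{n,k} ∑_t d̂_{kt}(S_t; μ̂_{kt}, β̂_k^init) φ_t(b, μ̂_{kt}) = 0`. -/
def FinalEq (N : ℕ) (ω : Ω) (b : Vec p) : Prop :=
  foldAvg (fold N ω) (fun k i =>
    M.psi (wFit O fold L N k ω) (muFit O fold L N k ω) b (O i ω)) = 0

/-- The cross-fitted sandwich estimator of the variance, evaluated at `b`. -/
def sandwich (N : ℕ) (ω : Ω) (b : Vec p) : Matrix (Fin p) (Fin p) ℝ :=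
  let B : Matrix (Fin p) (Fin p) ℝ := foldAvg (fold N ω) fun k i =>
    M.dpsi (wFit O fold L N k ω) (muFit O fold L N k ω) b (O i ω)
  let Q : Matrix (Fin p) (Fin p) ℝ := foldAvg (fold N ω) fun k i =>
    Matrix.vecMulVec
      (WithLp.ofLp (M.psi (wFit O fold L N k ω) (muFit O fold L N k ω) b (O i ω)))
      (WithLp.ofLp (M.psi (wFit O fold L N k ω) (muFit O fold L N k ω) b (O i ω)))
  B⁻¹ * Q * (B⁻¹)ᵀ

variable [MeasurableSpace Ω] (Pr : Measure Ω) (P : Measure (Traj T q))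

/-- The weights that are used converge in `L₂(P)`:
`‖d̂_{kt}(·; μ̂_{kt}, β̂_k^init) - d'_t‖ = o_P(1)`. -/
def UsedWeightsConverge (d' : Fin T → Vec r → Matrix (Fin p) (Fin p) ℝ) : Prop :=
  ∀ t k, LittleOP Pr fun N ω => M.sqDistD P t (wFit O fold L N k ω t) (d' t)

/-- The weights at the limits converge in `L₂(P)`: `‖d̂_{kt}(·; μ'_t, β⋆) - d'_t‖ = o_P(1)`. -/
def LimitWeightsConverge (d' : Fin T → Vec r → Matrix (Fin p) (Fin p) ℝ)
    (mu' : ∀ t : Fin T, Hist q t → Bool → ℝ) (b : Vec p) : Prop :=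
  ∀ t k, LittleOP Pr fun N ω => M.sqDistD P t (dFit O fold L N k ω t (mu' t) b) (d' t)

/-- `d̂_{kt}(·; μ_t, β)` is continuous in `(μ_t, β)` at `(μ'_t, β⋆)`, with a modulus that does not
degenerate as the sample grows (stochastic equicontinuity); `μ_t` ranges over the measurable
functions bounded by `C`, and `β` over `Θ`. -/
def WeightsEquicontinuous (Θ : Set (Vec p)) (C : ℝ) (mu' : ∀ t : Fin T, Hist q t → Bool → ℝ)
    (b : Vec p) : Prop :=
  ∀ (t : Fin T) (k : Fin K), ∀ ε : ℝ≥0∞, 0 < ε → ∀ η : ℝ≥0∞, 0 < η → ∃ δ : ℝ, 0 < δ ∧ ∀ᶠ N in atTop,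
    Pr {ω | ∃ (mu : Hist q t → Bool → ℝ) (b' : Vec p),
        Measurable (fun y : Hist q t × Bool => mu y.1 y.2) ∧ BoundedMu P C t mu ∧ b' ∈ Θ ∧
        sqDistMu P t mu (mu' t) ≤ ENNReal.ofReal δ ∧ ‖b' - b‖ ≤ δ ∧
        ε ≤ M.sqDistD P t (dFit O fold L N k ω t mu b') (dFit O fold L N k ω t (mu' t) b)} ≤ η

end estimator

end

end MRT

/-!
The estimating function is linear in *features*, products of an entry of the weights `d_t` with `1`
or a value of the outcome models, and its coefficients are known functions of the trajectory and of
`β`, smooth in `β`. Conditionally on the folds and the training data the fitted features are fixed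
functions, so a uniform law of large numbers for the known coefficients and Chebyshev's inequality
on each held-out fold replace a Donsker condition. They give uniform convergence of the averages,
hence the consistency of `β̌`.

Because the randomization probabilities are known, `E[d_t(S_t) φ_t(β⋆, μ_t)] = 0` for every weight
and every outcome model. So replacing the fitted features by their limits changes the average at
`β⋆` by a conditionally centred term of vanishing variance, which is `o_P(n^{-1/2})`. A mean value
expansion around `β⋆`, the central limit theorem and Slutsky's lemma then give the limit law, and
uniform convergence gives the sandwich estimator.
-/

namespace MRT

/-! ### Convergence in probability as convergence along a filter -/

section InProb

variable {Ω : Type*} [MeasurableSpace Ω] {Pr : Measure Ω}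

/-- The filter on `ℕ × Ω` of the events whose probability tends to one, so that `o_P` statements
become limits along a filter. Its elements need not be measurable: `Pr` acts as an outer measure. -/
def inProb (Pr : Measure Ω) : Filter (ℕ × Ω) :=
  Filter.comk (fun s => Tendsto (fun N => Pr {ω | (N, ω) ∈ s}) atTop (𝓝 0))
    (by simp)
    (fun _ ht _ hst => tendsto_of_tendsto_of_tendsto_of_le_of_le tendsto_const_nhds ht
      (fun _ => zero_le) fun _ => measure_mono fun _ hω => hst hω)
    (fun _ hs _ ht => tendsto_of_tendsto_of_tendsto_of_le_of_le tendsto_const_nhds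
      (by rw [← add_zero 0]; exact hs.add ht) (fun _ => zero_le) fun _ => measure_union_le _ _)

theorem eventually_inProb {E : ℕ × Ω → Prop} :
    (∀ᶠ x in inProb Pr, E x) ↔ Tendsto (fun N => Pr {ω | ¬ E (N, ω)}) atTop (𝓝 0) := Iff.rfl

theorem eventually_inProb_iff_le {E : ℕ × Ω → Prop} :
    (∀ᶠ x in inProb Pr, E x) ↔
      ∀ η : ℝ≥0∞, 0 < η → ∀ᶠ N in atTop, Pr {ω | ¬ E (N, ω)} ≤ η :=
  eventually_inProb.trans ENNReal.tendsto_nhds_zero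

theorem whp_iff {E : ℕ → Ω → Prop} : Whp Pr E ↔ ∀ᶠ x in inProb Pr, E x.1 x.2 := Iff.rfl

theorem littleOP_iff {X : ℕ → Ω → ℝ≥0∞} :
    LittleOP Pr X ↔ Tendsto (fun x : ℕ × Ω => X x.1 x.2) (inProb Pr) (𝓝 0) := by
  have event_iff : ∀ ε, (∀ᶠ x in inProb Pr, X x.1 x.2 < ε) ↔
      Tendsto (fun N => Pr {ω | ε ≤ X N ω}) atTop (𝓝 0) := fun ε => by
    simp only [eventually_inProb, not_lt]
  refine ⟨fun h => ENNReal.tendsto_nhds_zero.2 fun ε hε => ?_, fun h ε hε => ?_⟩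
  · exact ((event_iff ε).2 (h ε hε)).mono fun x hx => hx.le
  · exact (event_iff ε).1 (h.eventually_lt_const hε)

theorem tendstoInMeasure_iff_inProb {E : Type*} [PseudoMetricSpace E] {f : ℕ → Ω → E} {c : E} :
    TendstoInMeasure Pr f atTop (fun _ => c) ↔
      Tendsto (fun x : ℕ × Ω => f x.1 x.2) (inProb Pr) (𝓝 c) := by
  rw [tendstoInMeasure_iff_dist, Metric.tendsto_nhds]
  exact forall₂_congr fun ε _ => by simp only [eventually_inProb, not_lt]

theorem eventually_inProb_of_ae {E : ℕ → Ω → Prop} (h : ∀ N, ∀ᵐ ω ∂Pr, E N ω) :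
    ∀ᶠ x in inProb Pr, E x.1 x.2 :=
  eventually_inProb.2 (tendsto_const_nhds.congr fun N => (h N).symm)

instance [NeZero Pr] : NeBot (inProb Pr) := by
  refine ⟨fun hbot => NeZero.ne (Pr Set.univ) ?_⟩
  have h : ∀ᶠ _ in inProb Pr, False := by simp [hbot]
  simpa using eventually_inProb.1 h

/-- Boundedness in probability, `X_N = O_P(1)`. -/
def BddInProb (Pr : Measure Ω) (X : ℕ × Ω → ℝ) : Prop :=
  ∀ η : ℝ≥0∞, 0 < η → ∃ c : ℝ, ∀ᶠ N in atTop, Pr {ω | c ≤ |X (N, ω)|} ≤ η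

theorem BddInProb.tendsto_mul_zero {X e : ℕ × Ω → ℝ} (hX : BddInProb Pr X)
    (he : Tendsto e (inProb Pr) (𝓝 0)) :
    Tendsto (fun x => e x * X x) (inProb Pr) (𝓝 0) := by
  refine Metric.tendsto_nhds.2 fun ε hε => eventually_inProb_iff_le.2 fun η hη => ?_
  have hη2 : 0 < η / 2 := ENNReal.half_pos hη.ne'
  obtain ⟨c, hc⟩ := hX (η / 2) hη2
  have hc0 : 0 < max c 1 := lt_max_of_lt_right one_pos
  have he' := eventually_inProb_iff_le.1 (Metric.tendsto_nhds.1 he _ (div_pos hε hc0)) _ hη2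
  filter_upwards [hc, he'] with N hXN heN
  have hsub : {ω | ¬ dist (e (N, ω) * X (N, ω)) 0 < ε} ⊆
      {ω | c ≤ |X (N, ω)|} ∪ {ω | ¬ dist (e (N, ω)) 0 < ε / max c 1} := by
    intro ω
    simp only [Real.dist_0_eq_abs, Set.mem_union, Set.mem_ofPred_eq]
    contrapose!
    rintro ⟨hXω, heω⟩
    calc |e (N, ω) * X (N, ω)| = |e (N, ω)| * |X (N, ω)| := abs_mul _ _
      _ ≤ |e (N, ω)| * max c 1 := by gcongr; exact hXω.le.trans (le_max_left _ _)
      _ < ε / max c 1 * max c 1 := by gcongr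
      _ = ε := div_mul_cancel₀ _ hc0.ne'
  calc _ ≤ Pr ({ω | c ≤ |X (N, ω)|} ∪ {ω | ¬ dist (e (N, ω)) 0 < ε / max c 1}) :=
        measure_mono hsub
    _ ≤ η / 2 + η / 2 := (measure_union_le _ _).trans (add_le_add hXN heN)
    _ = η := ENNReal.add_halves η

theorem tendsto_measure_le_norm {E : Type*} [SeminormedAddCommGroup E] [MeasurableSpace E]
    [OpensMeasurableSpace E] (ν : Measure E) [IsFiniteMeasure ν] :
    Tendsto (fun n : ℕ => ν {x | (n : ℝ) ≤ ‖x‖}) atTop (𝓝 0) := by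
  have hempty : (⋂ n : ℕ, {x : E | (n : ℝ) ≤ ‖x‖}) = ∅ :=
    Set.eq_empty_of_forall_notMem fun x hx =>
      (exists_nat_gt ‖x‖).elim fun n hn => hn.not_ge (Set.mem_iInter.1 hx n : (n : ℝ) ≤ ‖x‖)
  rw [← measure_empty (μ := ν), ← hempty]
  refine tendsto_measure_iInter_atTop (fun n => ?_) (fun m n hmn x hx => ?_)
    ⟨0, measure_ne_top _ _⟩
  · exact (isClosed_le continuous_const continuous_norm).nullMeasurableSet
  · exact le_trans (Nat.cast_le.2 hmn) (show (n : ℝ) ≤ ‖x‖ from hx)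

theorem bddInProb_norm_of_tendstoInDistribution {E Ω' : Type*} [NormedAddCommGroup E]
    [MeasurableSpace E] [OpensMeasurableSpace E] [MeasurableSpace Ω'] {ν : Measure Ω'}
    [IsProbabilityMeasure Pr] [IsProbabilityMeasure ν] {X : ℕ → Ω → E} {Z : Ω' → E}
    (h : TendstoInDistribution X atTop Z (fun _ => Pr) ν) :
    BddInProb Pr fun x => ‖X x.1 x.2‖ := by
  intro η hη
  have := Measure.isProbabilityMeasure_map h.aemeasurable_limit (μ := ν)
  obtain ⟨n, hn⟩ := ((tendsto_measure_le_norm (ν.map Z)).eventually_lt_const hη).exists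
  have hclosed : IsClosed {x : E | (n : ℝ) ≤ ‖x‖} := isClosed_le continuous_const continuous_norm
  have hlimsup : limsup (fun N => (Pr.map (X N)) {x : E | (n : ℝ) ≤ ‖x‖}) atTop < η :=
    (ProbabilityMeasure.limsup_measure_closed_le_of_tendsto h.tendsto hclosed).trans_lt hn
  refine ⟨n, (eventually_lt_of_limsup_lt hlimsup).mono fun N hN => ?_⟩
  rw [Measure.map_apply_of_aemeasurable (h.forall_aemeasurable N) hclosed.measurableSet] at hN
  simp only [abs_norm]
  exact hN.le

end InProb

/-! ### A uniform law of large numbers -/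

theorem measurable_continuousMap {α Y : Type*} [MeasurableSpace α] [MetricSpace Y] [CompactSpace Y]
    [MeasurableSpace C(Y, ℝ)] [BorelSpace C(Y, ℝ)] {F : α → C(Y, ℝ)}
    (hF : ∀ y, Measurable fun a => F a y) : Measurable F := by
  obtain ⟨D, hDcount, hDdense⟩ := TopologicalSpace.exists_countable_dense Y
  have : Countable D := hDcount
  let restrict : C(Y, ℝ) → D → ℝ := fun g y => g y
  have hcont : Continuous restrict := continuous_pi fun y => continuous_eval_const y.1
  have hinj : Function.Injective restrict := fun g g' h => DFunLike.coe_injective <|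
    Continuous.ext_on hDdense g.continuous g'.continuous fun y hy => congrFun h ⟨y, hy⟩
  -- A continuous injection of Polish spaces is a measurable embedding (Lusin–Souslin).
  exact (hcont.measurableEmbedding hinj).measurable_comp_iff.1
    (measurable_pi_iff.2 fun y => hF y)

section UniformLaw

variable {Ω 𝒳 : Type*} [MeasurableSpace Ω] [MeasurableSpace 𝒳] {Pr : Measure Ω} {P : Measure 𝒳}
  {O : ℕ → Ω → 𝒳}

theorem ae_tendsto_average {E : Type*} [NormedAddCommGroup E] [NormedSpace ℝ E] [CompleteSpace E]
    [MeasurableSpace E] [BorelSpace E] [IsProbabilityMeasure Pr]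
    (hmeas : ∀ i, Measurable (O i)) (hlaw : ∀ i, Measure.map (O i) Pr = P) (hind : iIndepFun O Pr)
    {F : 𝒳 → E} (hF : Measurable F) (hint : Integrable F P) :
    ∀ᵐ ω ∂Pr, Tendsto (fun n : ℕ => (n : ℝ)⁻¹ • ∑ i ∈ Finset.range n, F (O i ω)) atTop
      (𝓝 (∫ x, F x ∂P)) := by
  have hmean : ∫ ω, F (O 0 ω) ∂Pr = ∫ x, F x ∂P := by
    rw [← hlaw 0] at hint ⊢
    rw [integral_map (hmeas 0).aemeasurable hint.aestronglyMeasurable]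
  have hident : ∀ i, IdentDistrib (O i) (O 0) Pr Pr := fun i =>
    ⟨(hmeas i).aemeasurable, (hmeas 0).aemeasurable, by rw [hlaw, hlaw]⟩
  rw [← hmean]
  refine strong_law_ae (μ := Pr) (fun i ω => F (O i ω)) ?_
    (fun i j hij => (hind.indepFun hij).comp hF hF) fun i => (hident i).comp hF
  rw [← hlaw 0] at hint
  exact hint.comp_measurable (hmeas 0)

theorem tendsto_average {E : Type*} [NormedAddCommGroup E] [NormedSpace ℝ E] [CompleteSpace E]
    [MeasurableSpace E] [BorelSpace E] [SecondCountableTopology E] [IsProbabilityMeasure Pr]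
    (hmeas : ∀ i, Measurable (O i)) (hlaw : ∀ i, Measure.map (O i) Pr = P) (hind : iIndepFun O Pr)
    {F : 𝒳 → E} (hF : Measurable F) (hint : Integrable F P) {u : ℕ → ℕ}
    (hu : Tendsto u atTop atTop) :
    Tendsto (fun x : ℕ × Ω => (u x.1 : ℝ)⁻¹ • ∑ i ∈ Finset.range (u x.1), F (O i x.2))
      (inProb Pr) (𝓝 (∫ x, F x ∂P)) := by
  have hsum : ∀ n, Measurable fun ω => ∑ i ∈ Finset.range n, F (O i ω) := fun n =>
    Finset.measurable_fun_sum _ fun i _ => hF.comp (hmeas i)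
  have hlim : TendstoInMeasure Pr
      (fun N ω => (u N : ℝ)⁻¹ • ∑ i ∈ Finset.range (u N), F (O i ω)) atTop
      fun _ => ∫ x, F x ∂P :=
    tendstoInMeasure_of_tendsto_ae
      (fun N => ((hsum (u N)).const_smul ((u N : ℝ)⁻¹)).aestronglyMeasurable)
      ((ae_tendsto_average hmeas hlaw hind hF hint).mono fun ω hω => hω.comp hu)
  rwa [tendstoInMeasure_iff_inProb] at hlim

theorem tendstoUniformlyOn_average {V : Type*} [MetricSpace V] [IsProbabilityMeasure Pr]
    (hmeas : ∀ i, Measurable (O i)) (hlaw : ∀ i, Measure.map (O i) Pr = P) (hind : iIndepFun O Pr)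
    {f : V → 𝒳 → ℝ} {B : Set V} (hB : IsCompact B) (hf : ∀ b, Measurable (f b))
    (hcont : ∀ x, Continuous fun b => f b x) {H : 𝒳 → ℝ} (hH : Integrable H P)
    (hbd : ∀ᵐ x ∂P, ∀ b ∈ B, |f b x| ≤ H x) {u : ℕ → ℕ} (hu : Tendsto u atTop atTop) :
    TendstoUniformlyOn (fun (x : ℕ × Ω) b => (u x.1 : ℝ)⁻¹ * ∑ i : Fin (u x.1), f b (O i x.2))
      (fun b => ∫ x, f b x ∂P) (inProb Pr) B := by
  have : CompactSpace B := isCompact_iff_compactSpace.1 hB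
  let : MeasurableSpace C(B, ℝ) := borel _
  have : BorelSpace C(B, ℝ) := ⟨rfl⟩
  -- The law of large numbers in the Banach space `C(B, ℝ)` is uniform over `B`.
  let F : 𝒳 → C(B, ℝ) := fun x => ⟨fun b => f b x, (hcont x).comp continuous_subtype_val⟩
  have hFmeas : Measurable F := measurable_continuousMap fun b => hf b
  have hFint : Integrable F P := ⟨hFmeas.aestronglyMeasurable,
    ContinuousMap.hasFiniteIntegral_of_bound F H hH.2 (hbd.mono fun x hx b => hx b b.2)⟩
  have hlim := tendsto_average hmeas hlaw hind hFmeas hFint hu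
  refine Metric.tendstoUniformlyOn_iff.2 fun ε hε => ?_
  filter_upwards [Metric.tendsto_nhds.1 hlim ε hε] with x hx b hb
  have hdist := (ContinuousMap.dist_apply_le_dist (⟨b, hb⟩ : B)).trans_lt hx
  rw [ContinuousMap.integral_apply hFint, dist_comm] at hdist
  have heval : ((u x.1 : ℝ)⁻¹ • ∑ i ∈ Finset.range (u x.1), F (O i x.2)) ⟨b, hb⟩ =
      (u x.1 : ℝ)⁻¹ * ∑ i : Fin (u x.1), f b (O i x.2) := by
    simp only [F, Finset.sum_range, ContinuousMap.smul_apply, ContinuousMap.sum_apply,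
      ContinuousMap.coe_mk, smul_eq_mul]
  rwa [heval] at hdist

end UniformLaw

/-! ### Conditioning on the training sample -/

section IidSample

variable {𝒳 ι : Type*} [MeasurableSpace 𝒳] [Fintype ι] {P : Measure 𝒳} [IsProbabilityMeasure P]

theorem lintegral_sum_eval {f : 𝒳 → ℝ≥0∞} (hf : Measurable f) :
    ∫⁻ y : ι → 𝒳, ∑ i, f (y i) ∂(Measure.pi fun _ => P) = Fintype.card ι * ∫⁻ x, f x ∂P := by
  rw [lintegral_finsetSum _ fun i _ => by fun_prop]
  have heval : ∀ i : ι, ∫⁻ y : ι → 𝒳, f (y i) ∂(Measure.pi fun _ => P) = ∫⁻ x, f x ∂P := fun i =>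
    (measurePreserving_eval (fun _ : ι => P) i).lintegral_comp hf
  simp only [heval, Finset.sum_const, Finset.card_univ, nsmul_eq_mul]

theorem evariance_sum_eval_le {f : 𝒳 → ℝ} (hf : MemLp f 2 P) :
    eVar[∑ i, fun y : ι → 𝒳 => f (y i); Measure.pi fun _ => P] ≤
      Fintype.card ι * ∫⁻ x, ENNReal.ofReal (f x ^ 2) ∂P := by
  have heval : ∀ i : ι, MemLp (fun y : ι → 𝒳 => f (y i)) 2 (Measure.pi fun _ => P) := fun i =>
    hf.comp_measurePreserving (measurePreserving_eval (fun _ : ι => P) i)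
  have hvar : Var[f; P] ≤ ∫ x, f x ^ 2 ∂P := by
    simpa using variance_le_expectation_sq hf.aestronglyMeasurable
  rw [← (memLp_finsetSum' _ fun i _ => heval i).ofReal_variance_eq, variance_sum_pi fun _ => hf,
    ← ofReal_integral_eq_lintegral_ofReal hf.integrable_sq (ae_of_all _ fun x => sq_nonneg (f x)),
    Finset.sum_const, Finset.card_univ, nsmul_eq_mul, ENNReal.ofReal_mul (Nat.cast_nonneg _),
    ENNReal.ofReal_natCast]
  gcongr

theorem lintegral_sq_sum_sub_integral_le {f : 𝒳 → ℝ} (hf : MemLp f 2 P) :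
    ∫⁻ y : ι → 𝒳, ENNReal.ofReal ((∑ i, (f (y i) - ∫ x, f x ∂P)) ^ 2) ∂(Measure.pi fun _ => P) ≤
      Fintype.card ι * ∫⁻ x, ENNReal.ofReal (f x ^ 2) ∂P := by
  have heval : ∀ i : ι, Integrable (fun y : ι → 𝒳 => f (y i)) (Measure.pi fun _ => P) := fun i =>
    integrable_comp_eval (hf.integrable one_le_two)
  have hmean : ∫ y, (∑ i, fun y : ι → 𝒳 => f (y i)) y ∂(Measure.pi fun _ => P) =
      ∑ _ : ι, ∫ x, f x ∂P := by
    simp only [Finset.sum_apply]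
    rw [integral_finsetSum _ fun i _ => heval i]
    exact Finset.sum_congr rfl fun i _ => integral_comp_eval hf.aestronglyMeasurable
  refine le_of_eq_of_le ?_ (evariance_sum_eval_le hf)
  rw [evariance_eq_lintegral_ofReal, hmean]
  simp only [Finset.sum_apply, Finset.sum_sub_distrib]

theorem inv_mul_lintegral_sq_sum_sub_integral_le {f : 𝒳 → ℝ} (hf : Measurable f) {N : ℕ}
    (hN : Fintype.card ι = N) :
    ∫⁻ y : ι → 𝒳, ENNReal.ofReal (((√(N : ℝ))⁻¹ * ∑ i, (f (y i) - ∫ x, f x ∂P)) ^ 2)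
      ∂(Measure.pi fun _ => P) ≤ ∫⁻ x, ENNReal.ofReal (f x ^ 2) ∂P := by
  by_cases hfin : ∫⁻ x, ENNReal.ofReal (f x ^ 2) ∂P = ⊤
  · exact hfin ▸ le_top
  have hsq : Integrable (fun x => f x ^ 2) P := ⟨(hf.pow_const 2).aestronglyMeasurable,
    (hasFiniteIntegral_iff_ofReal (ae_of_all _ fun x => sq_nonneg _)).2 (lt_top_iff_ne_top.2 hfin)⟩
  have hL2 : MemLp f 2 P := (memLp_two_iff_integrable_sq hf.aestronglyMeasurable).2 hsq
  have hinv : ENNReal.ofReal ((√(N : ℝ))⁻¹ ^ 2) ≤ (N : ℝ≥0∞)⁻¹ := by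
    rw [inv_pow, Real.sq_sqrt N.cast_nonneg, ← ENNReal.ofReal_natCast]
    exact ENNReal.ofReal_inv_le
  simp only [mul_pow, ENNReal.ofReal_mul (sq_nonneg (√(N : ℝ))⁻¹)]
  rw [lintegral_const_mul' _ _ ENNReal.ofReal_ne_top]
  calc _ ≤ (N : ℝ≥0∞)⁻¹ * (N * ∫⁻ x, ENNReal.ofReal (f x ^ 2) ∂P) := by
        gcongr
        exact hN ▸ lintegral_sq_sum_sub_integral_le hL2
    _ ≤ _ := by
        rw [← mul_assoc]
        exact mul_le_of_le_one_left zero_le (ENNReal.inv_mul_le_one _)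

end IidSample

section CrossFit

variable {T q K : ℕ} {Ω : Type*} [MeasurableSpace Ω] {Pr : Measure Ω} [IsProbabilityMeasure Pr]
  {P : Measure (Traj T q)} [IsProbabilityMeasure P] {O : ℕ → Ω → Traj T q}
  {fold : ∀ N : ℕ, Ω → Fin (K * N) → Fin K}

/-- A sample restricted to the `k`-th fold of the partition `π`. -/
abbrev Test (T q K N : ℕ) (π : Fin (K * N) → Fin K) (k : Fin K) : Type :=
  {i : Fin (K * N) // π i = k} → Traj T q

/-- The observations in the `k`-th fold. -/
def test (O : ℕ → Ω → Traj T q) (fold : ∀ N : ℕ, Ω → Fin (K * N) → Fin K) (N : ℕ) (k : Fin K)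
    (ω : Ω) : Test T q K N (fold N ω) k := fun i => O i.1 ω

theorem Sampling.map_test_train (hs : Sampling Pr P O fold) (N : ℕ) (π : Fin (K * N) → Fin K)
    (k : Fin K) :
    Pr.map (fun ω => ((fun i => O i.1 ω : Test T q K N π k),
      (fun i => O i.1 ω : Train T q K N π k)))
      = (Measure.pi fun _ => P).prod (Measure.pi fun _ => P) := by
  have hsample : Pr.map (fun ω (i : Fin (K * N)) => O i ω) = Measure.pi fun _ => P := by
    rw [(iIndepFun_iff_map_fun_eq_pi_map (μ := Pr) (f := fun (i : Fin (K * N)) ω => O i ω)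
      fun i => (hs.meas i).aemeasurable).1 (hs.indep.precomp Fin.val_injective)]
    simp only [hs.law]
  have hsplit := measurePreserving_piEquivPiSubtypeProd
    (fun _ : Fin (K * N) => P) (fun i => π i = k)
  rw [← hsplit.map_eq, ← hsample, Measure.map_map hsplit.measurable
    (measurable_pi_lambda _ fun i => hs.meas i)]
  rfl

theorem Sampling.measure_fold_eq_inter_le (hs : Sampling Pr P O fold) {N : ℕ}
    {π : Fin (K * N) → Fin K} {k : Fin K} {A : Set (Test T q K N π k × Train T q K N π k)}
    (hA : MeasurableSet A) {c : ℝ≥0∞} (h : ∀ z, Measure.pi (fun _ => P) {y | (y, z) ∈ A} ≤ c) :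
    Pr (fold N ⁻¹' {π} ∩ {ω | (fun i => O i.1 ω, fun i => O i.1 ω) ∈ A}) ≤
      Pr (fold N ⁻¹' {π}) * c := by
  let split : (ℕ → Traj T q) → Test T q K N π k × Train T q K N π k :=
    fun x => (fun i => x i.1, fun i => x i.1)
  have hsplit : Measurable split := (measurable_pi_lambda _ fun i => measurable_pi_apply _).prodMk
    (measurable_pi_lambda _ fun i => measurable_pi_apply _)
  have hle : Pr ((fun ω i => O i ω) ⁻¹' (split ⁻¹' A)) ≤ c := by
    have hmap := hs.map_test_train N π k
    calc _ = Pr.map (fun ω => split fun i => O i ω) A :=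
          (Measure.map_apply (hsplit.comp (measurable_pi_lambda _ hs.meas)) hA).symm
      _ = ∫⁻ z, Measure.pi (fun _ => P) {y | (y, z) ∈ A} ∂Measure.pi (fun _ => P) := by
          rw [hmap, Measure.prod_apply_symm hA]; rfl
      _ ≤ ∫⁻ _ : Train T q K N π k, c ∂Measure.pi (fun _ => P) := lintegral_mono h
      _ = c := by rw [lintegral_const, measure_univ, mul_one]
  calc _ = Pr (fold N ⁻¹' {π}) * Pr ((fun ω i => O i ω) ⁻¹' (split ⁻¹' A)) :=
        (hs.fold_indep N).measure_inter_preimage_eq_mul {π} (split ⁻¹' A)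
          (measurableSet_singleton _) (hsplit hA)
    _ ≤ _ := by gcongr

theorem Sampling.measure_test_train_le (hs : Sampling Pr P O fold) {N : ℕ} {k : Fin K}
    {A : ∀ π, Set (Test T q K N π k × Train T q K N π k)} (hA : ∀ π, MeasurableSet (A π))
    {c : ℝ≥0∞}
    (h : ∀ π z, (Finset.univ.filter fun i => π i = k).card = N →
      Measure.pi (fun _ => P) {y | (y, z) ∈ A π} ≤ c) :
    Pr {ω | (test O fold N k ω, train O fold N k ω) ∈ A (fold N ω)} ≤ c := by
  have hle : ∀ π, Pr (fold N ⁻¹' {π} ∩ {ω | (fun i => O i.1 ω, fun i => O i.1 ω) ∈ A π}) ≤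
      Pr (fold N ⁻¹' {π}) * c := by
    intro π
    by_cases hπ : (Finset.univ.filter fun i => π i = k).card = N
    · exact hs.measure_fold_eq_inter_le (hA π) fun z => h π z hπ
    · have hempty : fold N ⁻¹' {π} = ∅ := Set.eq_empty_of_forall_notMem fun ω hω =>
        hπ ((hω : fold N ω = π) ▸ hs.fold_size N ω k)
      simp only [hempty, Set.empty_inter, measure_empty, zero_le]
  calc _ ≤ Pr (⋃ π, (fold N ⁻¹' {π} ∩ {ω | (fun i => O i.1 ω, fun i => O i.1 ω) ∈ A π})) :=
        measure_mono fun ω hω => Set.mem_iUnion.2 ⟨fold N ω, rfl, hω⟩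
    _ ≤ ∑ π, Pr (fold N ⁻¹' {π}) * c :=
        (measure_iUnion_fintype_le _ _).trans (Finset.sum_le_sum fun π _ => hle π)
    _ = c := by
        rw [← Finset.sum_mul, sum_measure_preimage_singleton _ fun π _ =>
          hs.fold_meas N (measurableSet_singleton π), Finset.coe_univ, Set.preimage_univ,
          measure_univ, one_mul]

-- Conditional Markov inequality: `Q` bounds the conditional mean of `g` given the training sample.
theorem Sampling.tendsto_of_conditional (hs : Sampling Pr P O fold) (k : Fin K)
    {g : ∀ N π, Test T q K N π k × Train T q K N π k → ℝ≥0∞} (hg : ∀ N π, Measurable (g N π))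
    {Q : ∀ N π, Train T q K N π k → ℝ≥0∞} (hQ : ∀ N π, Measurable (Q N π))
    (h : ∀ N π z, (Finset.univ.filter fun i => π i = k).card = N →
      ∫⁻ y, g N π (y, z) ∂(Measure.pi fun _ => P) ≤ Q N π z)
    (hQ0 : Tendsto (fun x : ℕ × Ω => Q x.1 (fold x.1 x.2) (train O fold x.1 k x.2))
      (inProb Pr) (𝓝 0)) :
    Tendsto (fun x : ℕ × Ω =>
      g x.1 (fold x.1 x.2) (test O fold x.1 k x.2, train O fold x.1 k x.2)) (inProb Pr) (𝓝 0) := by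
  refine ENNReal.tendsto_nhds_zero.2 fun ε hε => ?_
  rcases eq_or_ne ε ⊤ with rfl | hε'
  · exact Eventually.of_forall fun _ => le_top
  refine eventually_inProb_iff_le.2 fun η hη => ?_
  have hη2 : 0 < η / 2 := ENNReal.half_pos hη.ne'
  have hsmall := hQ0.eventually_lt_const (ENNReal.mul_pos hε.ne' hη2.ne')
  filter_upwards [eventually_inProb_iff_le.1 hsmall _ hη2] with N hN
  let A : ∀ π, Set (Test T q K N π k × Train T q K N π k) :=
    fun π => {x | ε ≤ g N π x ∧ Q N π x.2 < ε * (η / 2)}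
  have hA : ∀ π, MeasurableSet (A π) := fun π =>
    (measurableSet_le measurable_const (hg N π)).inter
      (measurableSet_lt ((hQ N π).comp measurable_snd) measurable_const)
  have hcond : ∀ π z, (Finset.univ.filter fun i => π i = k).card = N →
      Measure.pi (fun _ => P) {y | (y, z) ∈ A π} ≤ η / 2 := by
    intro π z hπ
    by_cases hz : Q N π z < ε * (η / 2)
    · calc _ ≤ Measure.pi (fun _ => P) {y | ε ≤ g N π (y, z)} := measure_mono fun y hy => hy.1
        _ ≤ (∫⁻ y, g N π (y, z) ∂(Measure.pi fun _ => P)) / ε :=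
            meas_ge_le_lintegral_div ((hg N π).comp measurable_prodMk_right).aemeasurable hε.ne' hε'
        _ ≤ η / 2 := ENNReal.div_le_of_le_mul' ((h N π z hπ).trans hz.le)
    · have hempty : {y | (y, z) ∈ A π} = ∅ := Set.eq_empty_of_forall_notMem fun y hy => hz hy.2
      simp only [hempty, measure_empty, zero_le]
  calc _ ≤ Pr ({ω | ¬ Q N (fold N ω) (train O fold N k ω) < ε * (η / 2)} ∪
        {ω | (test O fold N k ω, train O fold N k ω) ∈ A (fold N ω)}) := measure_mono fun ω hω =>
          (em (Q N (fold N ω) (train O fold N k ω) < ε * (η / 2))).elim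
            (fun hq => Or.inr ⟨(not_le.1 hω).le, hq⟩) Or.inl
    _ ≤ η / 2 + η / 2 :=
        (measure_union_le _ _).trans (add_le_add hN (hs.measure_test_train_le hA hcond))
    _ = η := ENNReal.add_halves η

theorem sum_fold_eq_sum_subtype {N : ℕ} {E : Type*} [AddCommMonoid E] (π : Fin (K * N) → Fin K)
    (k : Fin K) (F : Fin (K * N) → E) :
    ∑ i ∈ Finset.univ.filter (fun i => π i = k), F i = ∑ i : {i // π i = k}, F i.1 :=
  Finset.sum_subtype _ (fun _ => Finset.mem_filter_univ _) F

theorem Sampling.tendsto_fold_lintegral (hs : Sampling Pr P O fold) (k : Fin K)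
    {f : ∀ N π, Train T q K N π k → Traj T q → ℝ≥0∞}
    (hf : ∀ N π, Measurable fun x : Train T q K N π k × Traj T q => f N π x.1 x.2)
    (h : Tendsto (fun x : ℕ × Ω => ∫⁻ o, f x.1 (fold x.1 x.2) (train O fold x.1 k x.2) o ∂P)
      (inProb Pr) (𝓝 0)) :
    Tendsto (fun x : ℕ × Ω => (x.1 : ℝ≥0∞)⁻¹ *
      ∑ i ∈ Finset.univ.filter (fun i => fold x.1 x.2 i = k),
        f x.1 (fold x.1 x.2) (train O fold x.1 k x.2) (O i x.2)) (inProb Pr) (𝓝 0) := by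
  simp only [sum_fold_eq_sum_subtype]
  refine hs.tendsto_of_conditional k
    (g := fun N π x => (N : ℝ≥0∞)⁻¹ * ∑ i, f N π x.2 (x.1 i))
    (Q := fun N π z => ∫⁻ o, f N π z o ∂P) (fun N π => ?_)
    (fun N π => (hf N π).lintegral_prod_right') (fun N π z hπ => ?_) h
  · exact (Finset.measurable_fun_sum _ fun i _ => (hf N π).comp
      (measurable_snd.prodMk ((measurable_pi_apply i).comp measurable_fst))).const_mul _
  · have hfz : Measurable (f N π z) := (hf N π).comp measurable_prodMk_left
    calc _ = (N : ℝ≥0∞)⁻¹ * (N * ∫⁻ o, f N π z o ∂P) := by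
          rw [lintegral_const_mul _ (by fun_prop), lintegral_sum_eval hfz, Fintype.card_subtype, hπ]
      _ ≤ ∫⁻ o, f N π z o ∂P := by
          rw [← mul_assoc]
          exact mul_le_of_le_one_left zero_le (ENNReal.inv_mul_le_one _)

theorem tendsto_zero_of_ofReal_sq {α : Type*} {l : Filter α} {X : α → ℝ}
    (h : Tendsto (fun x => ENNReal.ofReal (X x ^ 2)) l (𝓝 0)) : Tendsto X l (𝓝 0) := by
  have hsq : Tendsto (fun x => X x ^ 2) l (𝓝 0) :=
    ((ENNReal.tendsto_toReal ENNReal.zero_ne_top).comp h).congr fun x =>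
      ENNReal.toReal_ofReal (sq_nonneg _)
  rw [tendsto_zero_iff_abs_tendsto_zero]
  simpa only [Function.comp_def, Real.sqrt_sq_eq_abs, Real.sqrt_zero] using hsq.sqrt

theorem Sampling.tendsto_fold_centered (hs : Sampling Pr P O fold) (k : Fin K)
    {f : ∀ N π, Train T q K N π k → Traj T q → ℝ}
    (hf : ∀ N π, Measurable fun x : Train T q K N π k × Traj T q => f N π x.1 x.2)
    (h : Tendsto (fun x : ℕ × Ω =>
      ∫⁻ o, ENNReal.ofReal (f x.1 (fold x.1 x.2) (train O fold x.1 k x.2) o ^ 2) ∂P)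
      (inProb Pr) (𝓝 0)) :
    Tendsto (fun x : ℕ × Ω => (√(x.1 : ℝ))⁻¹ *
      ∑ i ∈ Finset.univ.filter (fun i => fold x.1 x.2 i = k),
        (f x.1 (fold x.1 x.2) (train O fold x.1 k x.2) (O i x.2) -
          ∫ o, f x.1 (fold x.1 x.2) (train O fold x.1 k x.2) o ∂P)) (inProb Pr) (𝓝 0) := by
  simp only [sum_fold_eq_sum_subtype]
  refine tendsto_zero_of_ofReal_sq <| hs.tendsto_of_conditional k
    (g := fun N π x => ENNReal.ofReal (((√(N : ℝ))⁻¹ *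
      ∑ i, (f N π x.2 (x.1 i) - ∫ o, f N π x.2 o ∂P)) ^ 2))
    (Q := fun N π z => ∫⁻ o, ENNReal.ofReal (f N π z o ^ 2) ∂P) (fun N π => ?_)
    (fun N π => ((hf N π).pow_const 2).ennreal_ofReal.lintegral_prod_right') (fun N π z hπ => ?_) h
  · have hmean : Measurable fun x : Test T q K N π k × Train T q K N π k =>
        ∫ o, f N π x.2 o ∂P :=
      (hf N π).stronglyMeasurable.integral_prod_right'.measurable.comp measurable_snd
    exact (((Finset.measurable_fun_sum _ fun i _ => ((hf N π).comp (measurable_snd.prodMk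
      ((measurable_pi_apply i).comp measurable_fst))).sub hmean).const_mul _).pow_const 2
      ).ennreal_ofReal
  · exact inv_mul_lintegral_sq_sum_sub_integral_le ((hf N π).comp measurable_prodMk_left)
      (by rw [Fintype.card_subtype, hπ])

end CrossFit

/-! ### The multivariate central limit theorem -/

section CLT

open scoped RealInnerProductSpace

theorem charFun_map_inner {Ω E : Type*} [MeasurableSpace Ω] [NormedAddCommGroup E]
    [InnerProductSpace ℝ E] [MeasurableSpace E] [BorelSpace E] [SecondCountableTopology E]
    {μ : Measure Ω} {X : Ω → E} (hX : AEMeasurable X μ) (t : E) (s : ℝ) :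
    charFun (μ.map fun ω => ⟪X ω, t⟫) s = charFun (μ.map X) (s • t) := by
  rw [charFun_apply, charFun_apply, integral_map hX (by fun_prop),
    integral_map hX.inner_const (by fun_prop)]
  simp only [real_inner_smul_right, RCLike.inner_apply, conj_trivial]

/-- The Cramér–Wold device. -/
theorem tendstoInDistribution_of_forall_inner {Ω Ω' E : Type*} [MeasurableSpace Ω]
    [MeasurableSpace Ω'] [NormedAddCommGroup E] [InnerProductSpace ℝ E] [FiniteDimensional ℝ E]
    [MeasurableSpace E] [BorelSpace E] {μ : Measure Ω} [IsProbabilityMeasure μ] {ν : Measure Ω'}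
    [IsProbabilityMeasure ν] {X : ℕ → Ω → E} {Z : Ω' → E}
    (hX : ∀ i, AEMeasurable (X i) μ) (hZ : AEMeasurable Z ν)
    (h : ∀ t, TendstoInDistribution (fun i ω => ⟪X i ω, t⟫) atTop (fun ω => ⟪Z ω, t⟫)
      (fun _ => μ) ν) :
    TendstoInDistribution X atTop Z (fun _ => μ) ν := by
  refine ⟨hX, hZ, ProbabilityMeasure.tendsto_iff_tendsto_charFun.2 fun t => ?_⟩
  have hcf := ProbabilityMeasure.tendsto_iff_tendsto_charFun.1 (h t).tendsto 1
  simpa only [ProbabilityMeasure.coe_mk, charFun_map_inner (hX _), charFun_map_inner hZ,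
    one_smul] using hcf

variable {ι 𝒳 : Type*} [MeasurableSpace 𝒳] {P : Measure 𝒳}
  {Ψ : 𝒳 → EuclideanSpace ℝ ι}

/-- The matrix `E[Ψ Ψᵀ]` of second moments of a random vector. -/
noncomputable def secondMoment (P : Measure 𝒳) (Ψ : 𝒳 → EuclideanSpace ℝ ι) : Matrix ι ι ℝ :=
  Matrix.of fun i j => ∫ x, Ψ x i * Ψ x j ∂P

theorem dotProduct_secondMoment_mulVec [Fintype ι] (hΨ : ∀ i, MemLp (fun x => Ψ x i) 2 P)
    (t : EuclideanSpace ℝ ι) :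
    t.ofLp ⬝ᵥ secondMoment P Ψ *ᵥ t.ofLp = ∫ x, ⟪Ψ x, t⟫ ^ 2 ∂P := by
  have hint : ∀ i j, Integrable (fun x => Ψ x i * Ψ x j) P := fun i j =>
    (hΨ i).integrable_mul (hΨ j)
  have hsq : ∀ x, ⟪Ψ x, t⟫ ^ 2 = ∑ i, ∑ j, t i * t j * (Ψ x i * Ψ x j) := fun x => by
    simp only [PiLp.inner_apply, sq, Finset.sum_mul_sum, RCLike.inner_apply, conj_trivial]
    exact Finset.sum_congr rfl fun i _ => Finset.sum_congr rfl fun j _ => by ring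
  simp only [hsq]
  rw [integral_finsetSum _ fun i _ => integrable_finsetSum _ fun j _ => (hint i j).const_mul _]
  refine Finset.sum_congr rfl fun i _ => ?_
  rw [integral_finsetSum _ fun j _ => (hint i j).const_mul _]
  simp only [Matrix.mulVec, dotProduct, Finset.mul_sum, secondMoment, Matrix.of_apply,
    integral_const_mul]
  exact Finset.sum_congr rfl fun j _ => by ring

theorem posSemidef_secondMoment [Finite ι] (hΨ : ∀ i, MemLp (fun x => Ψ x i) 2 P) :
    (secondMoment P Ψ).PosSemidef := by
  have := Fintype.ofFinite ι
  refine Matrix.PosSemidef.of_dotProduct_mulVec_nonneg ?_ fun t => ?_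
  · ext i j
    simp [secondMoment, mul_comm]
  · rw [star_trivial, ← WithLp.ofLp_toLp 2 t, dotProduct_secondMoment_mulVec hΨ]
    exact integral_nonneg fun x => sq_nonneg _

theorem hasLaw_inner_multivariateGaussian [Fintype ι] [DecidableEq ι] {S : Matrix ι ι ℝ}
    (hS : S.PosSemidef) (t : EuclideanSpace ℝ ι) :
    HasLaw (fun x => ⟪x, t⟫) (gaussianReal 0 (t.ofLp ⬝ᵥ S *ᵥ t.ofLp).toNNReal)
      (multivariateGaussian 0 S) := by
  refine ⟨by fun_prop, Measure.ext_of_charFun (funext fun s => ?_)⟩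
  have hnonneg : 0 ≤ t.ofLp ⬝ᵥ S *ᵥ t.ofLp := by
    simpa only [star_trivial] using hS.dotProduct_mulVec_nonneg t.ofLp
  rw [charFun_map_inner (X := fun x => x) aemeasurable_id, Measure.map_id',
    charFun_multivariateGaussian hS, charFun_gaussianReal, Real.coe_toNNReal _ hnonneg]
  simp only [inner_zero_right, WithLp.ofLp_smul, Matrix.mulVec_smul, dotProduct_smul,
    smul_dotProduct, smul_eq_mul]
  push_cast
  ring_nf

theorem memLp_inner [Fintype ι] (hΨ : ∀ i, MemLp (fun x => Ψ x i) 2 P) (t : EuclideanSpace ℝ ι) :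
    MemLp (fun x => ⟪Ψ x, t⟫) 2 P := by
  simp only [PiLp.inner_apply, RCLike.inner_apply, conj_trivial]
  exact memLp_finsetSum _ fun i _ => (hΨ i).const_mul _

theorem integral_inner_eq_zero [Fintype ι] (hΨ : ∀ i, Integrable (fun x => Ψ x i) P)
    (h0 : ∀ i, ∫ x, Ψ x i ∂P = 0) (t : EuclideanSpace ℝ ι) : ∫ x, ⟪Ψ x, t⟫ ∂P = 0 := by
  simp only [PiLp.inner_apply, RCLike.inner_apply, conj_trivial]
  rw [integral_finsetSum _ fun i _ => (hΨ i).const_mul _]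
  simp only [integral_const_mul, h0, mul_zero, Finset.sum_const_zero]

variable {Ω : Type*} [MeasurableSpace Ω] {Pr : Measure Ω} [IsProbabilityMeasure Pr]
  {O : ℕ → Ω → 𝒳}

theorem tendstoInDistribution_inv_sqrt_mul_sum {Ω' : Type*} [MeasurableSpace Ω'] {ν : Measure Ω'}
    [IsProbabilityMeasure ν] {Y : Ω' → ℝ} (hmeas : ∀ i, Measurable (O i))
    (hlaw : ∀ i, Measure.map (O i) Pr = P) (hind : iIndepFun O Pr) {f : 𝒳 → ℝ}
    (hf : Measurable f) (hL2 : MemLp f 2 P) (h0 : ∫ x, f x ∂P = 0)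
    (hY : HasLaw Y (gaussianReal 0 (∫ x, f x ^ 2 ∂P).toNNReal) ν)
    {u : ℕ → ℕ} (hu : Tendsto u atTop atTop) :
    TendstoInDistribution (fun N ω => (√(u N : ℝ))⁻¹ * ∑ i : Fin (u N), f (O i ω)) atTop Y
      (fun _ => Pr) ν := by
  have hO : MeasurePreserving (O 0) Pr P := ⟨hmeas 0, hlaw 0⟩
  have hident : ∀ i, IdentDistrib (O i) (O 0) Pr Pr := fun i =>
    ⟨(hmeas i).aemeasurable, (hmeas 0).aemeasurable, by rw [hlaw, hlaw]⟩
  have hmean : ∫ ω, f (O 0 ω) ∂Pr = 0 := by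
    rw [← h0, ← hlaw 0, integral_map (hmeas 0).aemeasurable hf.aestronglyMeasurable]
  have hvar : Var[fun ω => f (O 0 ω); Pr] = ∫ x, f x ^ 2 ∂P := by
    rw [variance_of_integral_eq_zero (by fun_prop) hmean, ← hlaw 0,
      integral_map (hmeas 0).aemeasurable (hf.pow_const 2).aestronglyMeasurable]
  have hclt := tendstoInDistribution_inv_sqrt_mul_sum_sub (X := fun i ω => f (O i ω))
    (hvar ▸ hY) (hL2.comp_measurePreserving hO) (hind.comp (fun _ => f) fun _ => hf)
    fun i => (hident i).comp hf
  simp only [hmean, mul_zero, sub_zero, Finset.sum_range] at hclt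
  exact ⟨fun N => hclt.forall_aemeasurable (u N), hclt.aemeasurable_limit, hclt.tendsto.comp hu⟩

theorem tendstoInDistribution_inv_sqrt_smul_sum [Fintype ι] [DecidableEq ι]
    (hmeas : ∀ i, Measurable (O i)) (hlaw : ∀ i, Measure.map (O i) Pr = P) (hind : iIndepFun O Pr)
    (hΨ : Measurable Ψ) (hL2 : ∀ i, MemLp (fun x => Ψ x i) 2 P) (h0 : ∀ i, ∫ x, Ψ x i ∂P = 0)
    {u : ℕ → ℕ} (hu : Tendsto u atTop atTop) :
    TendstoInDistribution (fun N ω => (√(u N : ℝ))⁻¹ • ∑ i : Fin (u N), Ψ (O i ω)) atTop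
      (id : EuclideanSpace ℝ ι → EuclideanSpace ℝ ι) (fun _ => Pr)
      (multivariateGaussian 0 (secondMoment P Ψ)) := by
  have : IsProbabilityMeasure P := by
    rw [← hlaw 0]; exact Measure.isProbabilityMeasure_map (hmeas 0).aemeasurable
  refine tendstoInDistribution_of_forall_inner (fun N => Measurable.aemeasurable ?_)
    aemeasurable_id fun t => ?_
  · have := fun i => hΨ.comp (hmeas i)
    fun_prop
  · have hlim := hasLaw_inner_multivariateGaussian (posSemidef_secondMoment hL2) t
    rw [dotProduct_secondMoment_mulVec hL2] at hlim
    have hclt := tendstoInDistribution_inv_sqrt_mul_sum hmeas hlaw hind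
      (hΨ.inner measurable_const) (memLp_inner hL2 t)
      (integral_inner_eq_zero (fun i => (hL2 i).integrable one_le_two) h0 t) hlim hu
    simpa only [real_inner_smul_left, sum_inner, id] using hclt

end CLT

/-! ### Cross-fitted averages -/

section FoldAvg

variable {K N : ℕ} {E E' : Type*} [AddCommGroup E] [Module ℝ E] [AddCommGroup E'] [Module ℝ E']

theorem map_foldAvg (φ : E →ₗ[ℝ] E') (π : Fin (K * N) → Fin K) (F : Fin K → Fin (K * N) → E) :
    φ (foldAvg π F) = foldAvg π fun k i => φ (F k i) := by
  simp only [foldAvg, avg, map_smul, map_sum]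

theorem foldAvg_sum {J : Type*} (s : Finset J) (π : Fin (K * N) → Fin K)
    (F : J → Fin K → Fin (K * N) → E) :
    (foldAvg π fun k i => ∑ j ∈ s, F j k i) = ∑ j ∈ s, foldAvg π (F j) := by
  simp only [foldAvg, avg, ← Finset.smul_sum, Finset.sum_comm (s := s)]

theorem foldAvg_sub (π : Fin (K * N) → Fin K) (F G : Fin K → Fin (K * N) → E) :
    (foldAvg π fun k i => F k i - G k i) = foldAvg π F - foldAvg π G := by
  simp only [foldAvg, avg, Finset.sum_sub_distrib, smul_sub]

theorem foldAvg_eq {π : Fin (K * N) → Fin K}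
    (h : ∀ k, (Finset.univ.filter fun i => π i = k).card = N) (F : Fin K → Fin (K * N) → E) :
    foldAvg π F =
      (K : ℝ)⁻¹ • ∑ k, (N : ℝ)⁻¹ • ∑ i ∈ Finset.univ.filter (fun i => π i = k), F k i := by
  simp only [foldAvg, avg, h]

theorem foldAvg_const {π : Fin (K * N) → Fin K}
    (h : ∀ k, (Finset.univ.filter fun i => π i = k).card = N) (F : Fin (K * N) → E) :
    (foldAvg π fun _ => F) = ((K * N : ℕ) : ℝ)⁻¹ • ∑ i, F i := by
  rw [foldAvg_eq h, ← Finset.smul_sum, smul_smul, Nat.cast_mul, mul_inv, Finset.sum_fiberwise]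

theorem abs_foldAvg_le (π : Fin (K * N) → Fin K) (F : Fin K → Fin (K * N) → ℝ) :
    |foldAvg π F| ≤ foldAvg π fun k i => |F k i| := by
  simp only [foldAvg, avg, smul_eq_mul]
  rw [abs_mul, abs_of_nonneg (by positivity)]
  gcongr
  refine (Finset.abs_sum_le_sum_abs _ _).trans (Finset.sum_le_sum fun k _ => ?_)
  rw [abs_mul, abs_of_nonneg (by positivity)]
  gcongr
  exact Finset.abs_sum_le_sum_abs _ _

theorem foldAvg_mono (π : Fin (K * N) → Fin K) {F G : Fin K → Fin (K * N) → ℝ}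
    (h : ∀ k i, F k i ≤ G k i) : foldAvg π F ≤ foldAvg π G := by
  simp only [foldAvg, avg, smul_eq_mul]
  gcongr with k _ i _
  exact h k i

theorem abs_foldAvg_mul_sub_average_le {π : Fin (K * N) → Fin K}
    (hπ : ∀ k, (Finset.univ.filter fun i => π i = k).card = N) (F : Fin K → Fin (K * N) → ℝ)
    (g f : Fin (K * N) → ℝ) {C : ℝ} (hf : ∀ i, |f i| ≤ C) :
    |(foldAvg π fun k i => F k i * f i) - ((K * N : ℕ) : ℝ)⁻¹ * ∑ i, g i * f i| ≤
      C * foldAvg π fun k i => |F k i - g i| := by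
  have havg := foldAvg_const hπ fun i => g i * f i
  have hC := map_foldAvg (LinearMap.mulLeft ℝ C) π fun k i => |F k i - g i|
  simp only [LinearMap.mulLeft_apply] at hC
  rw [smul_eq_mul] at havg
  rw [← havg, ← foldAvg_sub, hC]
  refine (abs_foldAvg_le _ _).trans (foldAvg_mono _ fun k i => ?_)
  rw [← sub_mul, abs_mul, mul_comm]
  gcongr
  exact hf i

end FoldAvg

/-! ### Uniform convergence of cross-fitted averages -/

theorem tendstoUniformlyOn_finsetSum {α V J E : Type*} [SeminormedAddCommGroup E] {l : Filter α}
    {B : Set V} (s : Finset J) {F : J → α → V → E} {f : J → V → E}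
    (h : ∀ j ∈ s, TendstoUniformlyOn (F j) (f j) l B) :
    TendstoUniformlyOn (fun x b => ∑ j ∈ s, F j x b) (fun b => ∑ j ∈ s, f j b) l B := by
  classical
  induction s using Finset.induction_on with
  | empty => exact fun u hu => by simp [refl_mem_uniformity hu]
  | insert a s ha ih =>
    simp only [Finset.sum_insert ha]
    exact (h a (Finset.mem_insert_self a s)).add
      (ih fun j hj => h j (Finset.mem_insert_of_mem hj))

section Uniform

variable {T q K : ℕ} {Ω : Type*} [MeasurableSpace Ω] {Pr : Measure Ω}
  {P : Measure (Traj T q)} {O : ℕ → Ω → Traj T q}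
  {fold : ∀ N : ℕ, Ω → Fin (K * N) → Fin K}

theorem Sampling.ae_forall (hs : Sampling Pr P O fold) {E : Traj T q → Prop}
    (h : ∀ᵐ o ∂P, E o) : ∀ᵐ ω ∂Pr, ∀ i, E (O i ω) := by
  refine ae_all_iff.2 fun i => ?_
  rw [← hs.law i] at h
  exact ae_of_ae_map (hs.meas i).aemeasurable h

variable [IsProbabilityMeasure Pr] [IsProbabilityMeasure P]

theorem Sampling.tendsto_foldAvg_abs (hs : Sampling Pr P O fold)
    {h : ∀ N π (k : Fin K), Train T q K N π k → Traj T q → ℝ}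
    (hm : ∀ N π k, Measurable fun x : Train T q K N π k × Traj T q => h N π k x.1 x.2)
    (hconv : ∀ k, Tendsto (fun x : ℕ × Ω =>
      ∫⁻ o, ‖h x.1 (fold x.1 x.2) k (train O fold x.1 k x.2) o‖ₑ ∂P) (inProb Pr) (𝓝 0)) :
    Tendsto (fun x : ℕ × Ω => foldAvg (fold x.1 x.2) fun k i =>
      |h x.1 (fold x.1 x.2) k (train O fold x.1 k x.2) (O i x.2)|) (inProb Pr) (𝓝 0) := by
  have hfold : ∀ k, Tendsto (fun x : ℕ × Ω => (x.1 : ℝ)⁻¹ *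
      ∑ i ∈ Finset.univ.filter (fun i => fold x.1 x.2 i = k),
        |h x.1 (fold x.1 x.2) k (train O fold x.1 k x.2) (O i x.2)|) (inProb Pr) (𝓝 0) := by
    intro k
    have henorm := hs.tendsto_fold_lintegral k
      (f := fun N π z o => ‖h N π k z o‖ₑ) (fun N π => (hm N π k).enorm) (hconv k)
    refine ((ENNReal.tendsto_toReal ENNReal.zero_ne_top).comp henorm).congr fun x => ?_
    simp only [Function.comp_apply, ENNReal.toReal_mul, ENNReal.toReal_inv, ENNReal.toReal_natCast,
      ENNReal.toReal_sum fun _ _ => enorm_ne_top, toReal_enorm, Real.norm_eq_abs]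
  have hsum := (tendsto_finsetSum Finset.univ fun k _ => hfold k).const_mul (K : ℝ)⁻¹
  simp only [Finset.sum_const_zero, mul_zero] at hsum
  refine hsum.congr fun x => ?_
  simp only [foldAvg_eq (hs.fold_size x.1 x.2), smul_eq_mul]

theorem Sampling.tendstoUniformlyOn_foldAvg (hs : Sampling Pr P O fold) (hK : 0 < K)
    {h : ∀ N π (k : Fin K), Train T q K N π k → Traj T q → ℝ}
    (hm : ∀ N π k, Measurable fun x : Train T q K N π k × Traj T q => h N π k x.1 x.2)
    {h' : Traj T q → ℝ} (hm' : Measurable h') (hi' : Integrable h' P)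
    (hconv : ∀ k, Tendsto (fun x : ℕ × Ω =>
      ∫⁻ o, ‖h x.1 (fold x.1 x.2) k (train O fold x.1 k x.2) o - h' o‖ₑ ∂P) (inProb Pr) (𝓝 0))
    {V : Type*} [MetricSpace V] {f : V → Traj T q → ℝ} {B : Set V} (hB : IsCompact B)
    (hf : ∀ b, Measurable (f b)) (hcont : ∀ o, Continuous fun b => f b o) {C : ℝ}
    (hbd : ∀ᵐ o ∂P, ∀ b ∈ B, |f b o| ≤ C) :
    TendstoUniformlyOn (fun (x : ℕ × Ω) b => foldAvg (fold x.1 x.2) fun k i =>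
        h x.1 (fold x.1 x.2) k (train O fold x.1 k x.2) (O i x.2) * f b (O i x.2))
      (fun b => ∫ o, h' o * f b o ∂P) (inProb Pr) B := by
  have hlimit := tendstoUniformlyOn_average hs.meas hs.law hs.indep
    (f := fun b o => h' o * f b o) hB (fun b => hm'.mul (hf b))
    (fun o => continuous_const.mul (hcont o)) (H := fun o => |h' o| * C) (hi'.abs.mul_const C)
    (by
      filter_upwards [hbd] with o ho b hb
      rw [abs_mul]
      gcongr
      exact ho b hb) (u := fun N => K * N) (tendsto_id.const_mul_atTop' hK)
  have herror := (hs.tendsto_foldAvg_abs (h := fun N π k z o => h N π k z o - h' o)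
    (fun N π k => (hm N π k).sub (hm'.comp measurable_snd)) hconv).const_mul C
  rw [mul_zero] at herror
  rw [Metric.tendstoUniformlyOn_iff] at hlimit ⊢
  intro ε hε
  filter_upwards [hlimit (ε / 2) (half_pos hε), herror.eventually_lt_const (half_pos hε),
    eventually_inProb_of_ae (fun _ => hs.ae_forall hbd)] with x hxlimit hxerror hxbd b hb
  have hclose := (abs_foldAvg_mul_sub_average_le (hs.fold_size x.1 x.2)
    (fun k i => h x.1 (fold x.1 x.2) k (train O fold x.1 k x.2) (O i x.2))
    (fun i => h' (O i x.2)) (fun i => f b (O i x.2)) fun i => hxbd i b hb).trans_lt hxerror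
  rw [← Real.dist_eq, dist_comm] at hclose
  calc _ ≤ _ := dist_triangle _ _ _
    _ < ε / 2 + ε / 2 := add_lt_add (hxlimit b hb) hclose
    _ = ε := add_halves ε

theorem Sampling.tendstoUniformlyOn_foldAvg_sum (hs : Sampling Pr P O fold) (hK : 0 < K)
    {A : Type*} [Fintype A] {h : A → ∀ N π (k : Fin K), Train T q K N π k → Traj T q → ℝ}
    (hm : ∀ a N π k, Measurable fun x : Train T q K N π k × Traj T q => h a N π k x.1 x.2)
    {h' : A → Traj T q → ℝ} (hm' : ∀ a, Measurable (h' a)) (hi' : ∀ a, Integrable (h' a) P)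
    (hconv : ∀ a k, Tendsto (fun x : ℕ × Ω =>
      ∫⁻ o, ‖h a x.1 (fold x.1 x.2) k (train O fold x.1 k x.2) o - h' a o‖ₑ ∂P) (inProb Pr) (𝓝 0))
    {V : Type*} [MetricSpace V] {f : A → V → Traj T q → ℝ} {B : Set V} (hB : IsCompact B)
    (hf : ∀ a b, Measurable (f a b)) (hcont : ∀ a o, Continuous fun b => f a b o) {C : ℝ}
    (hbd : ∀ᵐ o ∂P, ∀ a, ∀ b ∈ B, |f a b o| ≤ C) :
    TendstoUniformlyOn (fun (x : ℕ × Ω) b => foldAvg (fold x.1 x.2) fun k i =>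
        ∑ a, h a x.1 (fold x.1 x.2) k (train O fold x.1 k x.2) (O i x.2) * f a b (O i x.2))
      (fun b => ∫ o, ∑ a, h' a o * f a b o ∂P) (inProb Pr) B := by
  have hsum := tendstoUniformlyOn_finsetSum Finset.univ fun a _ =>
    hs.tendstoUniformlyOn_foldAvg hK (hm a) (hm' a) (hi' a) (hconv a) hB (hf a) (hcont a)
      (hbd.mono fun o ho => ho a)
  refine (hsum.congr (Eventually.of_forall fun x b _ => (foldAvg_sum _ _ _).symm)).congr_right
    fun b hb => (integral_finsetSum _ fun a _ => ?_).symm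
  exact (hi' a).mul_bdd (hf a b).aestronglyMeasurable (hbd.mono fun o ho => ho a b hb)

theorem tendsto_prod_of_tendstoUniformlyOn {α V E : Type*} [TopologicalSpace V] [UniformSpace E]
    {l : Filter α} {F : α → V → E} {f : V → E} {B : Set V} {b : V}
    (h : TendstoUniformlyOn F f l B) (hB : B ∈ 𝓝 b) (hf : ContinuousAt f b) :
    Tendsto (fun y : α × V => F y.1 y.2) (l ×ˢ 𝓝 b) (𝓝 (f b)) :=
  tendsto_comp_of_locally_uniform_limit (F := fun y : α × V => F y.1) hf tendsto_snd
    fun u hu => ⟨B, hB, tendsto_fst.eventually (h u hu)⟩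

end Uniform

section LTwo

variable {α 𝒳 : Type*} [MeasurableSpace 𝒳] {μ : Measure 𝒳}

theorem eLpNorm_two_eq (f : 𝒳 → ℝ) :
    eLpNorm f 2 μ = (∫⁻ o, ENNReal.ofReal (f o ^ 2) ∂μ) ^ (1 / 2 : ℝ) := by
  rw [eLpNorm_eq_lintegral_rpow_enorm_toReal two_ne_zero ENNReal.ofNat_ne_top]
  simp [Real.enorm_eq_ofReal_abs, ← ENNReal.ofReal_pow]

theorem tendsto_eLpNorm_two {l : Filter α} {F : α → 𝒳 → ℝ}
    (h : Tendsto (fun x => ∫⁻ o, ENNReal.ofReal (F x o ^ 2) ∂μ) l (𝓝 0)) :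
    Tendsto (fun x => eLpNorm (F x) 2 μ) l (𝓝 0) := by
  simp only [eLpNorm_two_eq]
  simpa [Function.comp_def] using
    ((ENNReal.continuous_rpow_const (y := (1 / 2 : ℝ))).tendsto 0).comp h

theorem memLp_two_of_lintegral_ne_top {f : 𝒳 → ℝ} (hf : AEStronglyMeasurable f μ)
    (h : ∫⁻ o, ENNReal.ofReal (f o ^ 2) ∂μ ≠ ⊤) : MemLp f 2 μ := by
  refine ⟨hf, ?_⟩
  rw [eLpNorm_two_eq]
  exact ENNReal.rpow_lt_top_of_nonneg (by norm_num) h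

theorem tendsto_eLpNorm_mul_sub_mul {p q r : ℝ≥0∞} [ENNReal.HolderTriple p q r] (hr : 1 ≤ r)
    {l : Filter α} {F G : α → 𝒳 → ℝ} {f g : 𝒳 → ℝ} (hF : ∀ x, AEStronglyMeasurable (F x) μ)
    (hG : ∀ x, AEStronglyMeasurable (G x) μ) (hf : MemLp f p μ) (hg : MemLp g q μ)
    (hFf : Tendsto (fun x => eLpNorm (F x - f) p μ) l (𝓝 0))
    (hGg : Tendsto (fun x => eLpNorm (G x - g) q μ) l (𝓝 0)) :
    Tendsto (fun x => eLpNorm (F x * G x - f * g) r μ) l (𝓝 0) := by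
  have hbound : Tendsto (fun x => eLpNorm (F x - f) p μ * eLpNorm (G x - g) q μ +
      eLpNorm f p μ * eLpNorm (G x - g) q μ + eLpNorm (F x - f) p μ * eLpNorm g q μ) l (𝓝 0) := by
    simpa using ((ENNReal.Tendsto.mul hFf (Or.inr ENNReal.zero_ne_top) hGg
      (Or.inr ENNReal.zero_ne_top)).add
        (ENNReal.Tendsto.const_mul hGg (Or.inr hf.eLpNorm_ne_top))).add
      (ENNReal.Tendsto.mul_const hFf (Or.inr hg.eLpNorm_ne_top))
  refine tendsto_of_tendsto_of_tendsto_of_le_of_le tendsto_const_nhds hbound (fun _ => zero_le)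
    fun x => ?_
  have hFx := (hF x).sub hf.1
  have hGx := (hG x).sub hg.1
  have hsplit : F x * G x - f * g =
      (F x - f) • (G x - g) + f • (G x - g) + (F x - f) • g := by
    simp only [smul_eq_mul]; ring
  rw [hsplit]
  refine (eLpNorm_add_le ((hFx.smul hGx).add (hf.1.smul hGx)) (hFx.smul hg.1) hr).trans ?_
  refine add_le_add ((eLpNorm_add_le (hFx.smul hGx) (hf.1.smul hGx) hr).trans ?_) ?_
  · exact add_le_add (eLpNorm_smul_le_mul_eLpNorm hGx hFx) (eLpNorm_smul_le_mul_eLpNorm hGx hf.1)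
  · exact eLpNorm_smul_le_mul_eLpNorm hg.1 hFx

theorem tendsto_lintegral_mul_sub_mul {l : Filter α} {F G : α → 𝒳 → ℝ} {f g : 𝒳 → ℝ}
    (hF : ∀ x, AEStronglyMeasurable (F x) μ) (hG : ∀ x, AEStronglyMeasurable (G x) μ)
    (hf : MemLp f 2 μ) (hg : MemLp g 2 μ)
    (hFf : Tendsto (fun x => ∫⁻ o, ENNReal.ofReal ((F x o - f o) ^ 2) ∂μ) l (𝓝 0))
    (hGg : Tendsto (fun x => ∫⁻ o, ENNReal.ofReal ((G x o - g o) ^ 2) ∂μ) l (𝓝 0)) :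
    Tendsto (fun x => ∫⁻ o, ‖F x o * G x o - f o * g o‖ₑ ∂μ) l (𝓝 0) := by
  have h := tendsto_eLpNorm_mul_sub_mul (p := 2) (q := 2) le_rfl hF hG hf hg
    (tendsto_eLpNorm_two hFf) (tendsto_eLpNorm_two hGg)
  simpa only [eLpNorm_one_eq_lintegral_enorm, Pi.sub_apply, Pi.mul_apply] using h

end LTwo

theorem measurable_fderiv_apply {V 𝒳 : Type*} [NormedAddCommGroup V] [NormedSpace ℝ V]
    [MeasurableSpace 𝒳] {f : V → 𝒳 → ℝ} (hm : ∀ b, Measurable (f b))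
    (hd : ∀ x, Differentiable ℝ fun b => f b x) (b v : V) :
    Measurable fun x => fderiv ℝ (fun b' => f b' x) b v := by
  refine measurable_of_tendsto_metrizable
    (f := fun (n : ℕ) x => (n : ℝ) • (f (b + (n : ℝ)⁻¹ • v) x - f b x)) (fun n => ?_) ?_
  · exact ((hm _).sub (hm b)).const_smul (n : ℝ)
  · rw [tendsto_pi_nhds]
    intro x
    refine (hd x b).hasFDerivAt.lim v ?_
    simpa only [norm_natCast] using tendsto_natCast_atTop_atTop (R := ℝ)

/-! ### Estimating functions that are linear in fitted features -/

/-- An estimating function `∑ⱼ ηⱼ(o) cⱼ(b, o)` with known coefficients `cⱼ` and with features `ηⱼ`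
that are fitted outside a fold and have limits. -/
structure Features (T q p K : ℕ) (J : Type*) where
  coef : J → Vec p → Traj T q → ℝ
  fit : ∀ (N : ℕ) (π : Fin (K * N) → Fin K) (k : Fin K), Train T q K N π k →
    J → Fin p → Traj T q → ℝ
  lim : J → Fin p → Traj T q → ℝ

namespace Features

noncomputable section

variable {T q p K : ℕ} {J : Type*} (F : Features T q p K J) {Ω : Type*}
  (O : ℕ → Ω → Traj T q) (fold : ∀ N : ℕ, Ω → Fin (K * N) → Fin K)

/-- The features fitted outside the `k`-th fold. -/
def fitAt (x : ℕ × Ω) (k : Fin K) : J → Fin p → Traj T q → ℝ :=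
  F.fit x.1 (fold x.1 x.2) k (train O fold x.1 k x.2)

section Score

variable [Fintype J]

/-- The estimating function with features `η`. -/
def score (η : J → Fin p → Traj T q → ℝ) (b : Vec p) (o : Traj T q) : Vec p :=
  WithLp.toLp 2 fun i => ∑ j, η j i o * F.coef j b o

/-- The Jacobian matrix of the estimating function. -/
def jac (η : J → Fin p → Traj T q → ℝ) (b : Vec p) (o : Traj T q) : Matrix (Fin p) (Fin p) ℝ :=
  Matrix.of fun i l =>
    ∑ j, η j i o * fderiv ℝ (fun b' => F.coef j b' o) b (EuclideanSpace.single l 1)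

/-- The cross-fitted estimating function. -/
def scoreAvg (x : ℕ × Ω) (b : Vec p) : Vec p :=
  foldAvg (fold x.1 x.2) fun k i => F.score (F.fitAt O fold x k) b (O i x.2)

/-- The cross-fitted Jacobian matrix. -/
def jacAvg (x : ℕ × Ω) (b : Vec p) : Matrix (Fin p) (Fin p) ℝ :=
  foldAvg (fold x.1 x.2) fun k i => F.jac (F.fitAt O fold x k) b (O i x.2)

/-- The cross-fitted matrix of second moments of the estimating function. -/
def sqAvg (x : ℕ × Ω) (b : Vec p) : Matrix (Fin p) (Fin p) ℝ :=
  foldAvg (fold x.1 x.2) fun k i =>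
    Matrix.vecMulVec (WithLp.ofLp (F.score (F.fitAt O fold x k) b (O i x.2)))
      (WithLp.ofLp (F.score (F.fitAt O fold x k) b (O i x.2)))

/-- The population Jacobian matrix. -/
def jacMean (P : Measure (Traj T q)) (b : Vec p) : Matrix (Fin p) (Fin p) ℝ :=
  Matrix.of fun i l => ∫ o, F.jac F.lim b o i l ∂P

theorem score_mul_score (η : J → Fin p → Traj T q → ℝ) (b : Vec p) (o : Traj T q) (i l : Fin p) :
    F.score η b o i * F.score η b o l =
      ∑ a : J × J, η a.1 i o * η a.2 l o * (F.coef a.1 b o * F.coef a.2 b o) := by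
  simp only [score, Finset.sum_mul_sum, Fintype.sum_prod_type, mul_mul_mul_comm]

theorem scoreAvg_apply (x : ℕ × Ω) (b : Vec p) (i : Fin p) :
    F.scoreAvg O fold x b i = foldAvg (fold x.1 x.2) fun k m =>
      ∑ j, F.fitAt O fold x k j i (O m x.2) * F.coef j b (O m x.2) :=
  map_foldAvg (EuclideanSpace.proj i : Vec p →L[ℝ] ℝ).toLinearMap _ _

theorem jacAvg_apply (x : ℕ × Ω) (b : Vec p) (i l : Fin p) :
    F.jacAvg O fold x b i l = foldAvg (fold x.1 x.2) fun k m =>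
      F.jac (F.fitAt O fold x k) b (O m x.2) i l :=
  map_foldAvg (Matrix.entryLinearMap ℝ ℝ i l) _ _

theorem sqAvg_apply (x : ℕ × Ω) (b : Vec p) (i l : Fin p) :
    F.sqAvg O fold x b i l = foldAvg (fold x.1 x.2) fun k m =>
      F.score (F.fitAt O fold x k) b (O m x.2) i * F.score (F.fitAt O fold x k) b (O m x.2) l :=
  map_foldAvg (Matrix.entryLinearMap ℝ ℝ i l) _ _

end Score

/-- Smoothness and boundedness of the coefficients, and `L₂`-consistency of the features. -/
structure Regular {Ω : Type*} [MeasurableSpace Ω] (Pr : Measure Ω) (P : Measure (Traj T q))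
    (O : ℕ → Ω → Traj T q) (fold : ∀ N : ℕ, Ω → Fin (K * N) → Fin K) : Prop where
  coef_meas : ∀ j b, Measurable (F.coef j b)
  coef_diff : ∀ j o, ContDiff ℝ 1 fun b => F.coef j b o
  coef_bdd : ∀ R : ℝ, ∃ C : ℝ, ∀ j, ∀ᵐ o ∂P, ∀ b, ‖b‖ ≤ R →
    |F.coef j b o| ≤ C ∧ ‖fderiv ℝ (fun b' => F.coef j b' o) b‖ ≤ C
  fit_meas : ∀ N π k j i, Measurable fun x : Train T q K N π k × Traj T q =>
    F.fit N π k x.1 j i x.2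
  lim_meas : ∀ j i, Measurable (F.lim j i)
  lim_memLp : ∀ j i, MemLp (F.lim j i) 2 P
  conv : ∀ j i k, Tendsto (fun x : ℕ × Ω =>
    ∫⁻ o, ENNReal.ofReal ((F.fitAt O fold x k j i o - F.lim j i o) ^ 2) ∂P) (inProb Pr) (𝓝 0)

variable [MeasurableSpace Ω] {Pr : Measure Ω} {P : Measure (Traj T q)} {F O fold}

namespace Regular

theorem fitAt_meas (hF : F.Regular Pr P O fold) (x : ℕ × Ω) (k : Fin K) (j : J) (i : Fin p) :
    Measurable (F.fitAt O fold x k j i) :=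
  (hF.fit_meas _ _ _ j i).comp measurable_prodMk_left

theorem tendsto_lintegral_fit_mul_fit (hF : F.Regular Pr P O fold) (j j' : J)
    (i i' : Fin p) (k : Fin K) :
    Tendsto (fun x : ℕ × Ω => ∫⁻ o, ‖F.fitAt O fold x k j i o * F.fitAt O fold x k j' i' o
      - F.lim j i o * F.lim j' i' o‖ₑ ∂P) (inProb Pr) (𝓝 0) :=
  tendsto_lintegral_mul_sub_mul (fun x => (hF.fitAt_meas x k j i).aestronglyMeasurable)
    (fun x => (hF.fitAt_meas x k j' i').aestronglyMeasurable) (hF.lim_memLp j i)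
    (hF.lim_memLp j' i') (hF.conv j i k) (hF.conv j' i' k)

theorem coef_continuous (hF : F.Regular Pr P O fold) (j : J) (o : Traj T q) :
    Continuous fun b => F.coef j b o :=
  (hF.coef_diff j o).continuous

theorem coef_differentiable (hF : F.Regular Pr P O fold) (j : J) (o : Traj T q) :
    Differentiable ℝ fun b => F.coef j b o :=
  (hF.coef_diff j o).differentiable one_ne_zero

theorem dcoef_continuous (hF : F.Regular Pr P O fold) (j : J) (o : Traj T q) (v : Vec p) :
    Continuous fun b => fderiv ℝ (fun b' => F.coef j b' o) b v :=
  ((hF.coef_diff j o).continuous_fderiv one_ne_zero).clm_apply continuous_const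

theorem dcoef_meas (hF : F.Regular Pr P O fold) (j : J) (b v : Vec p) :
    Measurable fun o => fderiv ℝ (fun b' => F.coef j b' o) b v :=
  measurable_fderiv_apply (hF.coef_meas j) (hF.coef_differentiable j) b v

theorem exists_coef_bound [Countable J] (hF : F.Regular Pr P O fold) (R : ℝ) :
    ∃ C : ℝ, 0 ≤ C ∧ ∀ᵐ o ∂P, ∀ j, ∀ b ∈ Metric.closedBall 0 R,
      |F.coef j b o| ≤ C ∧
        ∀ l, |fderiv ℝ (fun b' => F.coef j b' o) b (EuclideanSpace.single l 1)| ≤ C := by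
  obtain ⟨C, hC⟩ := hF.coef_bdd R
  refine ⟨max C 0, le_max_right _ _, ?_⟩
  filter_upwards [ae_all_iff.2 hC] with o ho j b hb
  have hb' : ‖b‖ ≤ R := mem_closedBall_zero_iff.1 hb
  refine ⟨(ho j b hb').1.trans (le_max_left _ _), fun l => ?_⟩
  calc |fderiv ℝ (fun b' => F.coef j b' o) b (EuclideanSpace.single l 1)|
      ≤ ‖fderiv ℝ (fun b' => F.coef j b' o) b‖ * ‖EuclideanSpace.single l (1 : ℝ)‖ :=
        (fderiv ℝ (fun b' => F.coef j b' o) b).le_opNorm _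
    _ ≤ max C 0 := by
        rw [PiLp.norm_single, norm_one, mul_one]
        exact (ho j b hb').2.trans (le_max_left _ _)

theorem score_meas [Fintype J] (hF : F.Regular Pr P O fold) (b : Vec p) (i : Fin p) :
    Measurable fun o => F.score F.lim b o i :=
  Finset.measurable_fun_sum _ fun j _ => (hF.lim_meas j i).mul (hF.coef_meas j b)

theorem score_memLp [Fintype J] (hF : F.Regular Pr P O fold) (b : Vec p) (i : Fin p) :
    MemLp (fun o => F.score F.lim b o i) 2 P := by
  refine memLp_finsetSum _ fun j _ => ?_
  obtain ⟨C, -, hC⟩ := hF.exists_coef_bound ‖b‖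
  refine MemLp.of_le_mul (c := C) (hF.lim_memLp j i)
    ((hF.lim_meas j i).mul (hF.coef_meas j b)).aestronglyMeasurable ?_
  filter_upwards [hC] with o ho
  rw [norm_mul, mul_comm]
  gcongr
  exact (ho j b (by simp)).1

section Averages

variable [IsProbabilityMeasure P]

theorem lim_integrable (hF : F.Regular Pr P O fold) (j : J) (i : Fin p) :
    Integrable (F.lim j i) P :=
  (hF.lim_memLp j i).integrable one_le_two

theorem tendsto_lintegral_fit (hF : F.Regular Pr P O fold) (j : J) (i : Fin p) (k : Fin K) :
    Tendsto (fun x : ℕ × Ω => ∫⁻ o, ‖F.fitAt O fold x k j i o - F.lim j i o‖ₑ ∂P)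
      (inProb Pr) (𝓝 0) := by
  simpa only [mul_one] using tendsto_lintegral_mul_sub_mul (G := fun _ _ => 1)
    (fun x => (hF.fitAt_meas x k j i).aestronglyMeasurable) (fun _ => aestronglyMeasurable_const)
    (hF.lim_memLp j i) (memLp_const 1) (hF.conv j i k) (by simp [tendsto_const_nhds])

variable [Fintype J] [IsProbabilityMeasure Pr]

theorem tendstoUniformlyOn_scoreAvg (hF : F.Regular Pr P O fold) (hs : Sampling Pr P O fold)
    (hK : 0 < K) (R : ℝ) (i : Fin p) :
    TendstoUniformlyOn (fun (x : ℕ × Ω) b => F.scoreAvg O fold x b i)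
      (fun b => ∫ o, F.score F.lim b o i ∂P) (inProb Pr) (Metric.closedBall 0 R) := by
  obtain ⟨C, -, hC⟩ := hF.exists_coef_bound R
  simp only [scoreAvg_apply]
  exact hs.tendstoUniformlyOn_foldAvg_sum hK (h := fun j N π k z => F.fit N π k z j i)
    (fun j N π k => hF.fit_meas N π k j i) (fun j => hF.lim_meas j i)
    (fun j => hF.lim_integrable j i) (fun j => hF.tendsto_lintegral_fit j i)
    (isCompact_closedBall 0 R) hF.coef_meas hF.coef_continuous
    (hC.mono fun o ho j b hb => (ho j b hb).1)

theorem tendstoUniformlyOn_jacAvg (hF : F.Regular Pr P O fold) (hs : Sampling Pr P O fold)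
    (hK : 0 < K) (R : ℝ) (i l : Fin p) :
    TendstoUniformlyOn (fun (x : ℕ × Ω) b => F.jacAvg O fold x b i l)
      (fun b => F.jacMean P b i l) (inProb Pr) (Metric.closedBall 0 R) := by
  obtain ⟨C, -, hC⟩ := hF.exists_coef_bound R
  simp only [jacAvg_apply, jacMean, jac, Matrix.of_apply]
  exact hs.tendstoUniformlyOn_foldAvg_sum hK
    (f := fun j b o => fderiv ℝ (fun b' => F.coef j b' o) b (EuclideanSpace.single l 1))
    (h := fun j N π k z => F.fit N π k z j i)
    (fun j N π k => hF.fit_meas N π k j i) (fun j => hF.lim_meas j i)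
    (fun j => hF.lim_integrable j i) (fun j => hF.tendsto_lintegral_fit j i)
    (isCompact_closedBall 0 R) (fun j b => hF.dcoef_meas j b (EuclideanSpace.single l 1))
    (fun j o => hF.dcoef_continuous j o (EuclideanSpace.single l 1))
    (hC.mono fun o ho j b hb => (ho j b hb).2 l)

theorem tendstoUniformlyOn_sqAvg (hF : F.Regular Pr P O fold) (hs : Sampling Pr P O fold)
    (hK : 0 < K) (R : ℝ) (i l : Fin p) :
    TendstoUniformlyOn (fun (x : ℕ × Ω) b => F.sqAvg O fold x b i l)
      (fun b => secondMoment P (F.score F.lim b) i l) (inProb Pr) (Metric.closedBall 0 R) := by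
  obtain ⟨C, hC0, hC⟩ := hF.exists_coef_bound R
  simp only [sqAvg_apply, secondMoment, Matrix.of_apply, score_mul_score]
  exact hs.tendstoUniformlyOn_foldAvg_sum hK
    (f := fun a b o => F.coef a.1 b o * F.coef a.2 b o)
    (h' := fun a o => F.lim a.1 i o * F.lim a.2 l o)
    (h := fun (a : J × J) N π k z o => F.fit N π k z a.1 i o * F.fit N π k z a.2 l o)
    (fun a N π k => (hF.fit_meas N π k a.1 i).mul (hF.fit_meas N π k a.2 l))
    (fun a => (hF.lim_meas a.1 i).mul (hF.lim_meas a.2 l))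
    (fun a => (hF.lim_memLp a.1 i).integrable_mul (hF.lim_memLp a.2 l))
    (fun a => hF.tendsto_lintegral_fit_mul_fit a.1 a.2 i l) (isCompact_closedBall 0 R)
    (fun a b => (hF.coef_meas a.1 b).mul (hF.coef_meas a.2 b))
    (fun a o => (hF.coef_continuous a.1 o).mul (hF.coef_continuous a.2 o)) (C := C * C)
    (hC.mono fun o ho a b hb => by
      rw [abs_mul]
      exact mul_le_mul (ho a.1 b hb).1 (ho a.2 b hb).1 (abs_nonneg _) hC0)

end Averages

end Regular

end

end Features

section Matrix

open Matrix

variable {ι : Type*}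

theorem tendsto_euclideanSpace {α : Type*} {l : Filter α} {f : α → EuclideanSpace ℝ ι}
    {v : EuclideanSpace ℝ ι} (h : ∀ i, Tendsto (fun x => f x i) l (𝓝 (v i))) : Tendsto f l (𝓝 v) :=
  ((PiLp.continuous_toLp 2 fun _ : ι => ℝ).tendsto (WithLp.ofLp v)).comp (tendsto_pi_nhds.2 h)

theorem tendsto_matrix_of_tendstoUniformlyOn {α V : Type*} [SeminormedAddCommGroup V]
    {l : Filter α} [NeBot l] {A : α → V → Matrix ι ι ℝ} {D : V → Matrix ι ι ℝ}
    (h : ∀ R i j, TendstoUniformlyOn (fun x b => A x b i j) (fun b => D b i j) l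
      (Metric.closedBall 0 R))
    (hA : ∀ x i j, Continuous fun b => A x b i j) (b : V) :
    Tendsto (fun y : α × V => A y.1 y.2) (l ×ˢ 𝓝 b) (𝓝 (D b)) := by
  refine tendsto_pi_nhds.2 fun i => tendsto_pi_nhds.2 fun j => ?_
  have hnhds : Metric.closedBall (0 : V) (‖b‖ + 1) ∈ 𝓝 b :=
    Metric.closedBall_mem_nhds_of_mem (by simp)
  have hU := h (‖b‖ + 1) i j
  exact tendsto_prod_of_tendstoUniformlyOn hU hnhds ((hU.continuousOn
    (Frequently.of_forall fun x => (hA x i j).continuousOn)).continuousAt hnhds)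

variable [Fintype ι] [DecidableEq ι]

theorem tendsto_matrix_inv {α R : Type*} [Field R] [TopologicalSpace R] [IsTopologicalRing R]
    [ContinuousInv₀ R] {l : Filter α} {B : α → Matrix ι ι R} {D : Matrix ι ι R}
    (h : Tendsto B l (𝓝 D)) (hD : IsUnit D) : Tendsto (fun x => (B x)⁻¹) l (𝓝 D⁻¹) := by
  simp only [Matrix.inv_def, Ring.inverse_eq_inv']
  have hdet : D.det ≠ 0 := ((Matrix.isUnit_iff_isUnit_det D).1 hD).ne_zero
  exact ((continuous_id.matrix_det.tendsto D |>.comp h).inv₀ hdet).smul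
    (continuous_id.matrix_adjugate.tendsto D |>.comp h)

theorem clm_apply_eq_sum (L : EuclideanSpace ℝ ι →L[ℝ] ℝ) (v : EuclideanSpace ℝ ι) :
    L v = ∑ l, L (EuclideanSpace.single l 1) * v l := by
  have hv := (EuclideanSpace.basisFun ι ℝ).sum_repr v
  simp only [EuclideanSpace.basisFun_repr, EuclideanSpace.basisFun_apply] at hv
  conv_lhs => rw [← hv, map_sum]
  simp only [map_smul, smul_eq_mul, mul_comm]

theorem continuous_toEuclideanCLM :
    Continuous fun A : Matrix ι ι ℝ => Matrix.toEuclideanCLM (𝕜 := ℝ) A :=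
  LinearMap.continuous_of_finiteDimensional
    (Matrix.toEuclideanCLM (n := ι) (𝕜 := ℝ)).toAlgEquiv.toLinearMap

theorem toEuclideanCLM_inv_apply {D : Matrix ι ι ℝ} (hD : IsUnit D) (v : EuclideanSpace ℝ ι) :
    Matrix.toEuclideanCLM (𝕜 := ℝ) D⁻¹ (Matrix.toEuclideanCLM (𝕜 := ℝ) D v) = v := by
  rw [← mul_apply_eq_comp, ← map_mul,
    Matrix.nonsing_inv_mul _ ((Matrix.isUnit_iff_isUnit_det _).1 hD), map_one,
    one_apply_eq_self]

variable {𝒳 : Type*} [MeasurableSpace 𝒳] {P : Measure 𝒳} {Ψ : 𝒳 → EuclideanSpace ℝ ι}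

theorem memLp_toEuclideanCLM {r : ℝ≥0∞} (hΨ : ∀ i, MemLp (fun x => Ψ x i) r P)
    (A : Matrix ι ι ℝ) (i : ι) :
    MemLp (fun x => Matrix.toEuclideanCLM (𝕜 := ℝ) A (Ψ x) i) r P := by
  simp only [Matrix.ofLp_toEuclideanCLM, Matrix.mulVec, dotProduct]
  exact memLp_finsetSum _ fun l _ => (hΨ l).const_mul _

theorem integral_toEuclideanCLM_eq_zero (hΨ : ∀ i, Integrable (fun x => Ψ x i) P)
    (h0 : ∀ i, ∫ x, Ψ x i ∂P = 0) (A : Matrix ι ι ℝ) (i : ι) :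
    ∫ x, Matrix.toEuclideanCLM (𝕜 := ℝ) A (Ψ x) i ∂P = 0 := by
  simp only [Matrix.ofLp_toEuclideanCLM, Matrix.mulVec, dotProduct]
  rw [integral_finsetSum _ fun l _ => (hΨ l).const_mul _]
  simp only [integral_const_mul, h0, mul_zero, Finset.sum_const_zero]

theorem secondMoment_toEuclideanCLM (hΨ : ∀ i, MemLp (fun x => Ψ x i) 2 P) (A : Matrix ι ι ℝ) :
    secondMoment P (fun x => Matrix.toEuclideanCLM (𝕜 := ℝ) A (Ψ x)) =
      A * secondMoment P Ψ * Aᵀ := by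
  have hint : ∀ i j, Integrable (fun x => Ψ x i * Ψ x j) P := fun i j =>
    (hΨ i).integrable_mul (hΨ j)
  ext i j
  have hprod : ∀ x, Matrix.toEuclideanCLM (𝕜 := ℝ) A (Ψ x) i *
      Matrix.toEuclideanCLM (𝕜 := ℝ) A (Ψ x) j =
        ∑ l, ∑ m, A i m * A j l * (Ψ x m * Ψ x l) := fun x => by
    simp only [Matrix.ofLp_toEuclideanCLM, Matrix.mulVec, dotProduct]
    rw [Finset.sum_mul_sum, Finset.sum_comm]
    simp only [mul_mul_mul_comm]
  simp only [secondMoment, Matrix.of_apply, hprod, Matrix.mul_apply, Matrix.transpose_apply]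
  rw [integral_finsetSum _ fun l _ => integrable_finsetSum _ fun m _ => (hint m l).const_mul _]
  refine Finset.sum_congr rfl fun l _ => ?_
  rw [integral_finsetSum _ fun m _ => (hint m l).const_mul _, Finset.sum_mul]
  simp only [integral_const_mul, mul_right_comm]

end Matrix

section BddInProb

variable {Ω : Type*} [MeasurableSpace Ω] {Pr : Measure Ω} {E : Type*} [NormedAddCommGroup E]

theorem BddInProb.tendsto_zero_of_isLittleO {X : ℕ × Ω → ℝ} (hX : BddInProb Pr X)
    {f : ℕ × Ω → E} (h : f =o[inProb Pr] fun x => X x + 1) : Tendsto f (inProb Pr) (𝓝 0) := by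
  obtain ⟨e, he, hfe⟩ := h.norm_left.exists_eq_mul
  have hsum := (hX.tendsto_mul_zero he).add he
  rw [add_zero] at hsum
  refine tendsto_zero_iff_norm_tendsto_zero.2 (hsum.congr' (hfe.mono fun x hx => ?_))
  rw [hx, Pi.mul_apply, mul_add_one]

open Asymptotics in
theorem tendsto_smul_add_of_isLittleO [NormedSpace ℝ E] {D A : E →L[ℝ] E}
    (hAD : ∀ v, A (D v) = v) {Δ S X : ℕ × Ω → E} {r : ℕ × Ω → ℝ}
    (hexp : (fun x => S x + D (Δ x)) =o[inProb Pr] Δ)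
    (hX : BddInProb Pr fun x => ‖X x‖)
    (hS : Tendsto (fun x => r x • S x - X x) (inProb Pr) (𝓝 0)) :
    Tendsto (fun x => r x • Δ x + A (X x)) (inProb Pr) (𝓝 0) := by
  have hlin : (fun x => Δ x + A (S x)) =o[inProb Pr] fun x => A (S x) := by
    have hequiv : (fun x => -A (S x)) ~[inProb Pr] Δ := by
      refine ((A.isBigO_comp _ _).trans_isLittleO hexp).neg_left.congr_left fun x => ?_
      simp only [map_add, hAD, Pi.sub_apply, neg_add']
    simpa only [Pi.sub_def, sub_neg_eq_add] using isLittleO_neg_right.1 hequiv.symm.isLittleO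
  have hbig : (fun x => r x • S x) =O[inProb Pr] fun x => ‖X x‖ + 1 := by
    have hone : (fun _ => (1 : ℝ)) =O[inProb Pr] fun x => ‖X x‖ + 1 :=
      IsBigO.of_norm_le fun x => by simp
    have hXO : X =O[inProb Pr] fun x => ‖X x‖ + 1 :=
      IsBigO.of_norm_le fun x => le_add_of_nonneg_right zero_le_one
    exact ((((isLittleO_one_iff ℝ).2 hS).isBigO.trans hone).add hXO).congr_left
      fun x => sub_add_cancel _ _
  have hrem : Tendsto (fun x => r x • (Δ x + A (S x))) (inProb Pr) (𝓝 0) := by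
    refine hX.tendsto_zero_of_isLittleO (((isBigO_refl r _).smul_isLittleO hlin).trans_isBigO ?_)
    exact ((A.isBigO_comp _ _).trans hbig).congr_left fun x => map_smul A _ _
  have hsub := hrem.sub ((A.continuous.tendsto 0).comp hS)
  simp only [map_zero, sub_zero] at hsub
  refine hsub.congr fun x => ?_
  simp only [Function.comp_apply, map_sub, map_smul, smul_add]
  abel

end BddInProb

section FoldAvg

variable {K N : ℕ}

theorem hasFDerivAt_foldAvg {V W : Type*} [NormedAddCommGroup V] [NormedSpace ℝ V]
    [NormedAddCommGroup W] [NormedSpace ℝ W] (π : Fin (K * N) → Fin K)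
    {G : Fin K → Fin (K * N) → V → W} {G' : Fin K → Fin (K * N) → V →L[ℝ] W} {b : V}
    (h : ∀ k i, HasFDerivAt (G k i) (G' k i) b) :
    HasFDerivAt (fun b => foldAvg π fun k i => G k i b) (foldAvg π G') b := by
  simp only [foldAvg, avg]
  refine HasFDerivAt.fun_const_smul (HasFDerivAt.fun_sum fun k _ => ?_) _
  exact HasFDerivAt.fun_const_smul (HasFDerivAt.fun_sum fun i _ => h k i) _

theorem continuous_foldAvg {V : Type*} [TopologicalSpace V] (π : Fin (K * N) → Fin K)
    {G : Fin K → Fin (K * N) → V → ℝ} (h : ∀ k i, Continuous (G k i)) :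
    Continuous fun b => foldAvg π fun k i => G k i b := by
  simp only [foldAvg, avg]
  fun_prop

theorem sqrt_mul_foldAvg_sub {π : Fin (K * N) → Fin K}
    (hπ : ∀ k, (Finset.univ.filter fun i => π i = k).card = N)
    (F : Fin K → Fin (K * N) → ℝ) (g : Fin (K * N) → ℝ) :
    √((K * N : ℕ) : ℝ) * foldAvg π F - (√((K * N : ℕ) : ℝ))⁻¹ * ∑ i, g i =
      √(K : ℝ) * (K : ℝ)⁻¹ * ∑ k, (√(N : ℝ))⁻¹ *
        ∑ i ∈ Finset.univ.filter (fun i => π i = k), (F k i - g i) := by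
  have hsqrt : ∀ n : ℕ, (√(n : ℝ))⁻¹ = √(n : ℝ) * (n : ℝ)⁻¹ := fun n => by
    rw [← div_eq_mul_inv, Real.sqrt_div_self', one_div]
  rw [hsqrt, mul_assoc, ← smul_eq_mul (a := ((K * N : ℕ) : ℝ)⁻¹), ← foldAvg_const hπ, ← mul_sub,
    ← foldAvg_sub, foldAvg_eq hπ, hsqrt, Nat.cast_mul, Real.sqrt_mul (Nat.cast_nonneg K)]
  simp only [smul_eq_mul, ← Finset.mul_sum]
  ring

end FoldAvg

namespace Features

/-! ### Solutions of cross-fitted estimating equations -/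

variable {T q p K : ℕ} {J : Type*} [Fintype J] {F : Features T q p K J}
  {Ω : Type*} [MeasurableSpace Ω] {Pr : Measure Ω}
  {P : Measure (Traj T q)} {O : ℕ → Ω → Traj T q}
  {fold : ∀ N : ℕ, Ω → Fin (K * N) → Fin K} {b : Vec p}

namespace Regular

theorem scoreAvg_continuous (hF : F.Regular Pr P O fold) (x : ℕ × Ω) (i : Fin p) :
    Continuous fun b => F.scoreAvg O fold x b i := by
  simp only [scoreAvg_apply]
  exact continuous_foldAvg _ fun k m => continuous_finsetSum _ fun j _ =>
    (hF.coef_continuous j _).const_mul _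

theorem jacAvg_continuous (hF : F.Regular Pr P O fold) (x : ℕ × Ω) (i l : Fin p) :
    Continuous fun b => F.jacAvg O fold x b i l := by
  simp only [jacAvg_apply]
  exact continuous_foldAvg _ fun k m => continuous_finsetSum _ fun j _ =>
    (hF.dcoef_continuous j _ _).const_mul _

theorem sqAvg_continuous (hF : F.Regular Pr P O fold) (x : ℕ × Ω) (i l : Fin p) :
    Continuous fun b => F.sqAvg O fold x b i l := by
  simp only [sqAvg_apply, score_mul_score]
  exact continuous_foldAvg _ fun k m => continuous_finsetSum _ fun a _ =>
    ((hF.coef_continuous a.1 _).mul (hF.coef_continuous a.2 _)).const_mul _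

theorem hasFDerivAt_score (hF : F.Regular Pr P O fold) (η : J → Fin p → Traj T q → ℝ) (b : Vec p)
    (o : Traj T q) :
    HasFDerivAt (fun b => F.score η b o) (Matrix.toEuclideanCLM (𝕜 := ℝ) (F.jac η b o)) b := by
  rw [← hasFDerivWithinAt_univ, hasFDerivWithinAt_euclidean]
  intro i
  rw [hasFDerivWithinAt_univ]
  have hsum : HasFDerivAt (fun b => ∑ j, η j i o * F.coef j b o)
      (∑ j, η j i o • fderiv ℝ (fun b' => F.coef j b' o) b) b :=
    HasFDerivAt.fun_sum fun j _ => (hF.coef_differentiable j o b).hasFDerivAt.const_mul (η j i o)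
  refine hsum.congr_fderiv (ContinuousLinearMap.ext fun v => ?_)
  simp only [ContinuousLinearMap.comp_apply, PiLp.proj_apply, Matrix.ofLp_toEuclideanCLM,
    Matrix.mulVec, dotProduct, jac, Matrix.of_apply, sum_apply, smul_apply, smul_eq_mul]
  simp_rw [clm_apply_eq_sum _ v, Finset.sum_mul, Finset.mul_sum, mul_assoc]
  exact Finset.sum_comm

theorem hasFDerivAt_scoreAvg (hF : F.Regular Pr P O fold) (x : ℕ × Ω) (b : Vec p) :
    HasFDerivAt (F.scoreAvg O fold x)
      (Matrix.toEuclideanCLM (𝕜 := ℝ) (F.jacAvg O fold x b)) b := by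
  have hjac := map_foldAvg (Matrix.toEuclideanCLM (n := Fin p) (𝕜 := ℝ)).toAlgEquiv.toLinearMap
    (fold x.1 x.2) fun k i => F.jac (F.fitAt O fold x k) b (O i x.2)
  exact (hasFDerivAt_foldAvg _ fun k i =>
    hF.hasFDerivAt_score (F.fitAt O fold x k) b (O i x.2)).congr_fderiv hjac.symm

theorem lintegral_sq_score_sub_le (hF : F.Regular Pr P O fold) (b : Vec p) :
    ∃ c : ℝ, ∀ (x : ℕ × Ω) (k : Fin K) (i : Fin p),
      ∫⁻ o, ENNReal.ofReal ((F.score (F.fitAt O fold x k) b o i - F.score F.lim b o i) ^ 2) ∂P ≤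
        ENNReal.ofReal c *
          ∑ j, ∫⁻ o, ENNReal.ofReal ((F.fitAt O fold x k j i o - F.lim j i o) ^ 2) ∂P := by
  obtain ⟨C, -, hC⟩ := hF.exists_coef_bound ‖b‖
  refine ⟨Fintype.card J * C ^ 2, fun x k i => ?_⟩
  have hmeas : ∀ j, Measurable fun o =>
      ENNReal.ofReal ((F.fitAt O fold x k j i o - F.lim j i o) ^ 2) := fun j =>
    (((hF.fitAt_meas x k j i).sub (hF.lim_meas j i)).pow_const 2).ennreal_ofReal
  rw [← lintegral_finsetSum _ fun j _ => hmeas j,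
    ← lintegral_const_mul _ (Finset.measurable_fun_sum _ fun j _ => hmeas j)]
  refine lintegral_mono_ae (hC.mono fun o ho => ?_)
  rw [← ENNReal.ofReal_sum_of_nonneg fun j _ => sq_nonneg _,
    ← ENNReal.ofReal_mul (by positivity)]
  refine ENNReal.ofReal_le_ofReal ?_
  have hcoef : ∑ j, F.coef j b o ^ 2 ≤ Fintype.card J * C ^ 2 := by
    rw [← nsmul_eq_mul]
    exact Finset.sum_le_card_nsmul _ _ _ fun j _ =>
      sq_le_sq.2 ((ho j b (by simp)).1.trans (le_abs_self C))
  calc (F.score (F.fitAt O fold x k) b o i - F.score F.lim b o i) ^ 2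
      = (∑ j, (F.fitAt O fold x k j i o - F.lim j i o) * F.coef j b o) ^ 2 := by
        simp only [score, sub_mul, Finset.sum_sub_distrib]
    _ ≤ (∑ j, (F.fitAt O fold x k j i o - F.lim j i o) ^ 2) * ∑ j, F.coef j b o ^ 2 :=
        Finset.sum_mul_sq_le_sq_mul_sq _ _ _
    _ ≤ Fintype.card J * C ^ 2 * ∑ j, (F.fitAt O fold x k j i o - F.lim j i o) ^ 2 := by
        rw [mul_comm]
        gcongr

theorem tendsto_lintegral_sq_score_sub (hF : F.Regular Pr P O fold) (b : Vec p) (k : Fin K)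
    (i : Fin p) :
    Tendsto (fun x : ℕ × Ω => ∫⁻ o, ENNReal.ofReal
      ((F.score (F.fitAt O fold x k) b o i - F.score F.lim b o i) ^ 2) ∂P) (inProb Pr) (𝓝 0) := by
  obtain ⟨c, hc⟩ := hF.lintegral_sq_score_sub_le b
  have hlim := ENNReal.Tendsto.const_mul (a := ENNReal.ofReal c)
    (tendsto_finsetSum Finset.univ fun j _ => hF.conv j i k) (Or.inr ENNReal.ofReal_ne_top)
  simp only [Finset.sum_const_zero, mul_zero] at hlim
  exact tendsto_of_tendsto_of_tendsto_of_le_of_le tendsto_const_nhds hlim (fun _ => zero_le)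
    fun x => hc x k i

theorem measurable_score (hF : F.Regular Pr P O fold) (b : Vec p) : Measurable (F.score F.lim b) :=
  (PiLp.continuous_toLp 2 fun _ : Fin p => ℝ).measurable.comp
    (measurable_pi_lambda _ fun i => hF.score_meas b i)

variable [IsProbabilityMeasure Pr] [IsProbabilityMeasure P]

theorem tendsto_jacAvg (hF : F.Regular Pr P O fold) (hs : Sampling Pr P O fold) (hK : 0 < K)
    (b : Vec p) :
    Tendsto (fun y : (ℕ × Ω) × Vec p => F.jacAvg O fold y.1 y.2) (inProb Pr ×ˢ 𝓝 b)
      (𝓝 (F.jacMean P b)) :=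
  tendsto_matrix_of_tendstoUniformlyOn (hF.tendstoUniformlyOn_jacAvg hs hK)
    hF.jacAvg_continuous b

theorem tendsto_sqAvg (hF : F.Regular Pr P O fold) (hs : Sampling Pr P O fold) (hK : 0 < K)
    (b : Vec p) :
    Tendsto (fun y : (ℕ × Ω) × Vec p => F.sqAvg O fold y.1 y.2) (inProb Pr ×ˢ 𝓝 b)
      (𝓝 (secondMoment P (F.score F.lim b))) :=
  tendsto_matrix_of_tendstoUniformlyOn (D := fun b => secondMoment P (F.score F.lim b))
    (hF.tendstoUniformlyOn_sqAvg hs hK) hF.sqAvg_continuous b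

theorem tendsto_of_scoreAvg_eq_zero (hF : F.Regular Pr P O fold) (hs : Sampling Pr P O fold)
    (hK : 0 < K) {Θ : Set (Vec p)} (hΘ : IsCompact Θ)
    (huniq : ∀ b' ∈ Θ, (∀ i, ∫ o, F.score F.lim b' o i ∂P = 0) → b' = b)
    {bc : ℕ × Ω → Vec p} (hbc : ∀ᶠ x in inProb Pr, bc x ∈ Θ ∧ F.scoreAvg O fold x (bc x) = 0) :
    Tendsto bc (inProb Pr) (𝓝 b) := by
  obtain ⟨R, hR⟩ := hΘ.isBounded.subset_closedBall 0
  refine hΘ.tendsto_nhds_of_unique_mapClusterPt (hbc.mono fun x hx => hx.1) fun y hy hcl => ?_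
  obtain ⟨U, hU, hUy⟩ := mapClusterPt_iff_ultrafilter.1 hcl
  refine huniq y hy fun i => ?_
  have hunif := hF.tendstoUniformlyOn_scoreAvg hs hK R i
  have hcont : ContinuousOn (fun b => ∫ o, F.score F.lim b o i ∂P) (Metric.closedBall 0 R) :=
    hunif.continuousOn (Frequently.of_forall fun x => (hF.scoreAvg_continuous x i).continuousOn)
  have hlim_y : Tendsto (fun x => ∫ o, F.score F.lim (bc x) o i ∂P) U
      (𝓝 (∫ o, F.score F.lim y o i ∂P)) :=
    (hcont y (hR hy)).tendsto.comp (tendsto_nhdsWithin_iff.2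
      ⟨hUy, (hbc.filter_mono hU).mono fun x hx => hR hx.1⟩)
  have hlim_zero : Tendsto (fun x => ∫ o, F.score F.lim (bc x) o i ∂P) (inProb Pr) (𝓝 0) := by
    refine Metric.tendsto_nhds.2 fun ε hε => ?_
    filter_upwards [Metric.tendstoUniformlyOn_iff.1 hunif ε hε, hbc] with x hdist hx
    simpa only [hx.2, PiLp.zero_apply] using hdist (bc x) (hR hx.1)
  exact tendsto_nhds_unique hlim_y (hlim_zero.mono_left hU)

open Asymptotics in
theorem scoreAvg_add_isLittleO (hF : F.Regular Pr P O fold) (hs : Sampling Pr P O fold)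
    (hK : 0 < K) {bc : ℕ × Ω → Vec p} (hbc : Tendsto bc (inProb Pr) (𝓝 b))
    (hz : ∀ᶠ x in inProb Pr, F.scoreAvg O fold x (bc x) = 0) :
    (fun x => F.scoreAvg O fold x b +
      Matrix.toEuclideanCLM (𝕜 := ℝ) (F.jacMean P b) (bc x - b)) =o[inProb Pr]
        fun x => bc x - b := by
  have hjac := (continuous_toEuclideanCLM.tendsto _).comp (hF.tendsto_jacAvg hs hK b)
  refine isLittleO_iff.2 fun ε hε => ?_
  obtain ⟨pa, hpa, pb, hpb, hab⟩ := eventually_prod_iff.1 (Metric.tendsto_nhds.1 hjac ε hε)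
  obtain ⟨δ, hδ, hball⟩ := Metric.eventually_nhds_iff_ball.1 hpb
  filter_upwards [hpa, hz, hbc.eventually (Metric.ball_mem_nhds b hδ)] with x hx hzx hbx
  have hmvt := Convex.norm_image_sub_le_of_norm_hasFDerivWithin_le' (𝕜 := ℝ)
    (φ := Matrix.toEuclideanCLM (𝕜 := ℝ) (F.jacMean P b))
    (fun b' _ => (hF.hasFDerivAt_scoreAvg x b').hasFDerivWithinAt)
    (fun b' hb' => by rw [← dist_eq_norm]; exact (hab hx (hball b' hb')).le)
    (convex_ball b δ) (Metric.mem_ball_self hδ) hbx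
  rwa [hzx, zero_sub, ← neg_add', norm_neg] at hmvt

/-- Given the data outside a fold, the sum over that fold of the centered error of the fit has
variance at most `N` times its squared `L₂` norm; this replaces a Donsker condition. -/
theorem tendsto_sqrt_scoreAvg_sub (hF : F.Regular Pr P O fold) (hs : Sampling Pr P O fold)
    (h0 : ∀ i k, ∀ᶠ x in inProb Pr,
      ∫ o, (F.score (F.fitAt O fold x k) b o i - F.score F.lim b o i) ∂P = 0) :
    Tendsto (fun x : ℕ × Ω => √((K * x.1 : ℕ) : ℝ) • F.scoreAvg O fold x b -
      (√((K * x.1 : ℕ) : ℝ))⁻¹ • ∑ m : Fin (K * x.1), F.score F.lim b (O m x.2))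
      (inProb Pr) (𝓝 0) := by
  refine tendsto_euclideanSpace fun i => ?_
  have hfold : ∀ k, Tendsto (fun x : ℕ × Ω => (√(x.1 : ℝ))⁻¹ *
      ∑ m ∈ Finset.univ.filter (fun m => fold x.1 x.2 m = k),
        (F.score (F.fitAt O fold x k) b (O m x.2) i - F.score F.lim b (O m x.2) i))
      (inProb Pr) (𝓝 0) := fun k => by
    refine (hs.tendsto_fold_centered k
      (f := fun N π z o => F.score (F.fit N π k z) b o i - F.score F.lim b o i) (fun N π => ?_)
      (hF.tendsto_lintegral_sq_score_sub b k i)).congr' ?_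
    · exact (Finset.measurable_fun_sum _ fun j _ => (hF.fit_meas N π k j i).mul
        ((hF.coef_meas j b).comp measurable_snd)).sub ((hF.score_meas b i).comp measurable_snd)
    · filter_upwards [h0 i k] with x hx
      simp only [fitAt] at hx ⊢
      simp only [hx, sub_zero]
  have hsum := (tendsto_finsetSum Finset.univ fun k _ => hfold k).const_mul (√(K : ℝ) * (K : ℝ)⁻¹)
  simp only [Finset.sum_const_zero, mul_zero] at hsum
  refine hsum.congr fun x => ?_
  rw [← sqrt_mul_foldAvg_sub (hs.fold_size x.1 x.2)]
  simp only [PiLp.sub_apply, PiLp.smul_apply, smul_eq_mul, scoreAvg_apply, WithLp.ofLp_sum,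
    Finset.sum_apply]
  rfl

theorem tendsto_asymptotically_linear (hF : F.Regular Pr P O fold) (hs : Sampling Pr P O fold)
    (hK : 0 < K)
    (h0 : ∀ i k, ∀ᶠ x in inProb Pr,
      ∫ o, (F.score (F.fitAt O fold x k) b o i - F.score F.lim b o i) ∂P = 0)
    (hmean : ∀ i, ∫ o, F.score F.lim b o i ∂P = 0) (hD : IsUnit (F.jacMean P b))
    {bc : ℕ × Ω → Vec p} (hbc : Tendsto bc (inProb Pr) (𝓝 b))
    (hz : ∀ᶠ x in inProb Pr, F.scoreAvg O fold x (bc x) = 0) :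
    Tendsto (fun x : ℕ × Ω => √((K * x.1 : ℕ) : ℝ) • (bc x - b) +
      Matrix.toEuclideanCLM (𝕜 := ℝ) (F.jacMean P b)⁻¹ ((√((K * x.1 : ℕ) : ℝ))⁻¹ •
        ∑ m : Fin (K * x.1), F.score F.lim b (O m x.2))) (inProb Pr) (𝓝 0) :=
  tendsto_smul_add_of_isLittleO (toEuclideanCLM_inv_apply hD)
    (hF.scoreAvg_add_isLittleO hs hK hbc hz)
    (bddInProb_norm_of_tendstoInDistribution (tendstoInDistribution_inv_sqrt_smul_sum hs.meas
      hs.law hs.indep (hF.measurable_score b) (hF.score_memLp b) hmean (u := fun N => K * N)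
      (tendsto_id.const_mul_atTop' hK)))
    (hF.tendsto_sqrt_scoreAvg_sub hs h0)

theorem tendstoInDistribution (hF : F.Regular Pr P O fold) (hs : Sampling Pr P O fold)
    (hK : 0 < K)
    (h0 : ∀ i k, ∀ᶠ x in inProb Pr,
      ∫ o, (F.score (F.fitAt O fold x k) b o i - F.score F.lim b o i) ∂P = 0)
    (hmean : ∀ i, ∫ o, F.score F.lim b o i ∂P = 0) (hD : IsUnit (F.jacMean P b))
    {bc : ℕ → Ω → Vec p} (hbcm : ∀ N, Measurable (bc N))
    (hbc : Tendsto (fun x : ℕ × Ω => bc x.1 x.2) (inProb Pr) (𝓝 b))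
    (hz : ∀ᶠ x in inProb Pr, F.scoreAvg O fold x (bc x.1 x.2) = 0) :
    TendstoInDistribution (fun N ω => √((K * N : ℕ) : ℝ) • (bc N ω - b)) atTop
      (id : Vec p → Vec p) (fun _ => Pr) (multivariateGaussian 0
        ((F.jacMean P b)⁻¹ * secondMoment P (F.score F.lim b) * ((F.jacMean P b)⁻¹)ᵀ)) := by
  set A := Matrix.toEuclideanCLM (𝕜 := ℝ) (-(F.jacMean P b)⁻¹) with hA
  have hvar : (F.jacMean P b)⁻¹ * secondMoment P (F.score F.lim b) * ((F.jacMean P b)⁻¹)ᵀ =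
      secondMoment P (fun o => A (F.score F.lim b o)) := by
    rw [hA, secondMoment_toEuclideanCLM (hF.score_memLp b), Matrix.transpose_neg,
      Matrix.neg_mul, Matrix.mul_neg, Matrix.neg_mul, neg_neg]
  have hclt := tendstoInDistribution_inv_sqrt_smul_sum hs.meas hs.law hs.indep
    (A.continuous.measurable.comp (hF.measurable_score b))
    (memLp_toEuclideanCLM (hF.score_memLp b) _)
    (integral_toEuclideanCLM_eq_zero (fun i => (hF.score_memLp b i).integrable one_le_two) hmean _)
    (u := fun N => K * N) (tendsto_id.const_mul_atTop' hK)
  rw [hvar]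
  refine tendstoInDistribution_of_tendstoInMeasure_sub _ _ hclt
    (tendstoInMeasure_iff_inProb.2 ?_)
    fun N => (((hbcm N).sub_const b).const_smul (√((K * N : ℕ) : ℝ))).aemeasurable
  refine (hF.tendsto_asymptotically_linear hs hK h0 hmean hD hbc hz).congr fun x => ?_
  simp only [Pi.sub_apply, Function.comp_apply, hA, map_neg, map_smul, map_sum, neg_apply,
    Finset.sum_neg_distrib, smul_neg, sub_neg_eq_add]

theorem tendsto_sandwich (hF : F.Regular Pr P O fold) (hs : Sampling Pr P O fold)
    (hK : 0 < K) (hD : IsUnit (F.jacMean P b)) {bc : ℕ × Ω → Vec p}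
    (hbc : Tendsto bc (inProb Pr) (𝓝 b)) :
    Tendsto (fun x => (F.jacAvg O fold x (bc x))⁻¹ * F.sqAvg O fold x (bc x) *
        ((F.jacAvg O fold x (bc x))⁻¹)ᵀ) (inProb Pr)
      (𝓝 ((F.jacMean P b)⁻¹ * secondMoment P (F.score F.lim b) * ((F.jacMean P b)⁻¹)ᵀ)) := by
  have hinv := tendsto_matrix_inv ((hF.tendsto_jacAvg hs hK b).comp (tendsto_id.prodMk hbc)) hD
  have hsq := (hF.tendsto_sqAvg hs hK b).comp (tendsto_id.prodMk hbc)
  exact (hinv.mul hsq).mul ((continuous_id.matrix_transpose.tendsto _).comp hinv)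

end Regular

end Features

section CondExp

variable {Ω : Type*} {m m0 : MeasurableSpace Ω} {μ : Measure[m0] Ω} [IsFiniteMeasure μ]
  {f g : Ω → ℝ} {s : Set Ω}

theorem integral_mul_condExp (hm : m ≤ m0) (hf : StronglyMeasurable[m] f)
    (hfg : Integrable (fun x => f x * g x) μ) (hg : Integrable g μ) :
    ∫ x, f x * g x ∂μ = ∫ x, f x * (μ[g|m]) x ∂μ := by
  rw [← integral_condExp hm (f := fun x => f x * g x)]
  exact integral_congr_ae (condExp_mul_of_stronglyMeasurable_left hf hfg hg)

theorem setIntegral_mul_condExp_cond (hm : m ≤ m0) (hf : StronglyMeasurable[m] f)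
    (hfg : IntegrableOn (fun x => f x * g x) s μ) (hg : IntegrableOn g s μ) :
    ∫ x in s, f x * g x ∂μ = ∫ x in s, f x * ((ProbabilityTheory.cond μ s)[g|m]) x ∂μ := by
  rcases eq_or_ne (μ s) 0 with h0 | h0
  · simp [Measure.restrict_eq_zero.2 h0]
  have := cond_isProbabilityMeasure h0
  have hc : (μ s)⁻¹ ≠ ⊤ := ENNReal.inv_ne_top.2 h0
  have hcond := integral_mul_condExp (μ := ProbabilityTheory.cond μ s) hm hf
    (Integrable.smul_measure hfg hc) (Integrable.smul_measure hg hc)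
  have hne : ((μ s)⁻¹).toReal ≠ 0 :=
    ENNReal.toReal_ne_zero.2 ⟨ENNReal.inv_ne_zero.2 (measure_ne_top _ _), hc⟩
  simp only [ProbabilityTheory.cond, integral_smul_measure] at hcond
  exact smul_right_injective ℝ hne hcond

theorem ae_cond_iff {μ : Measure[m0] Ω} [IsFiniteMeasure μ] (hs : MeasurableSet[m0] s)
    {E : Ω → Prop} :
    (∀ᵐ x ∂(ProbabilityTheory.cond μ s), E x) ↔ ∀ᵐ x ∂μ, x ∈ s → E x := by
  rw [ProbabilityTheory.cond, Measure.ae_ennreal_smul_measure_iff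
    (ENNReal.inv_ne_zero.2 (measure_ne_top _ _)), ae_restrict_iff' hs]

end CondExp

theorem integrableOn_mul_of_bdd {Ω : Type*} [MeasurableSpace Ω] {μ : Measure Ω} {s : Set Ω}
    (hs : MeasurableSet s) {f g : Ω → ℝ} (hf : IntegrableOn f s μ) (hg : Measurable g) {C : ℝ}
    (hbd : ∀ᵐ x ∂μ, x ∈ s → |g x| ≤ C) : IntegrableOn (fun x => f x * g x) s μ :=
  Integrable.mul_bdd (c := C) hf hg.aestronglyMeasurable ((ae_restrict_iff' hs).2 hbd)

variable {T q r p : ℕ}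

theorem measurable_avail (t : Fin T) : Measurable (avail (q := q) t) :=
  measurable_fst.comp (measurable_fst.comp (measurable_pi_apply t))

theorem measurable_trt (t : Fin T) : Measurable (trt (q := q) t) :=
  measurable_fst.comp (measurable_snd.comp (measurable_pi_apply t))

theorem measurable_outc (t : Fin T) : Measurable (outc (q := q) t) :=
  measurable_snd.comp (measurable_snd.comp (measurable_pi_apply t))

theorem measurable_hist (t : Fin T) : Measurable (hist (q := q) t) :=
  (measurable_pi_lambda _ fun _ => measurable_pi_apply _).prodMk
    (measurable_fst.comp (measurable_pi_apply t))

theorem measurable_bit : Measurable bit := measurable_from_top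

theorem Spec.measurable_S (M : Spec T q r p) (t : Fin T) : Measurable (M.S t) :=
  (M.modr_meas t).comp (measurable_hist t)

theorem comap_hist_le (t : Fin T) :
    MeasurableSpace.comap (hist (q := q) t) inferInstance ≤ MeasurableSpace.pi :=
  (measurable_hist t).comap_le

theorem stronglyMeasurable_hist {t : Fin T} {f : Hist q t → ℝ} (hf : Measurable f) :
    StronglyMeasurable[MeasurableSpace.comap (hist (q := q) t) inferInstance]
      fun o => f (hist t o) :=
  (hf.comp (comap_measurable (hist t))).stronglyMeasurable

theorem measurableSet_avail (t : Fin T) : MeasurableSet {o : Traj T q | avail t o = true} :=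
  measurable_avail t (measurableSet_singleton true)

theorem measurableSet_trt (t : Fin T) (a : Bool) : MeasurableSet {o : Traj T q | trt t o = a} :=
  measurable_trt t (measurableSet_singleton a)

namespace Spec

variable {M : Spec T q r p} {P : Measure (Traj T q)}

/-- The probability `P(A_t = a | H_t = h)` of arm `a`, as specified by the design. -/
noncomputable def armProb (M : Spec T q r p) (t : Fin T) (a : Bool) (h : Hist q t) : ℝ :=
  if a then M.prob t h else 1 - M.prob t h

theorem measurable_armProb (t : Fin T) (a : Bool) : Measurable (M.armProb t a) := by
  cases a
  · exact (M.prob_meas t).const_sub 1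
  · exact M.prob_meas t

/-- Positivity with the constant `τ`, written symmetrically in the two arms. -/
structure Positive (M : Spec T q r p) (P : Measure (Traj T q)) (τ : ℝ) : Prop where
  pos : 0 < τ
  lt_armProb : ∀ t a, ∀ᵐ o ∂P, avail t o = true → τ < M.armProb t a (hist t o)

theorem Design.exists_positive (hd : M.Design P) : ∃ τ, M.Positive P τ := by
  obtain ⟨τ, hτ, h⟩ := hd.positivity
  refine ⟨τ, hτ, fun t a => ?_⟩
  filter_upwards [h t] with o ho hav
  cases a
  · exact lt_sub_comm.1 (ho hav).2
  · exact (ho hav).1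

theorem Positive.prob_mem {τ : ℝ} (hτ : M.Positive P τ) (t : Fin T) : ∀ᵐ o ∂P,
    avail t o = true → 0 < M.prob t (hist t o) ∧ M.prob t (hist t o) < 1 := by
  filter_upwards [hτ.lt_armProb t true, hτ.lt_armProb t false] with o htrue hfalse ho
  exact ⟨hτ.pos.trans (htrue ho), sub_pos.1 (hτ.pos.trans (hfalse ho))⟩

section Randomization

variable [IsProbabilityMeasure P]

theorem Design.condExp_indicator_trt (hd : M.Design P) (t : Fin T) (a : Bool) :
    P[{o | trt t o = a}.indicator fun _ => (1 : ℝ) | MeasurableSpace.comap (hist t) inferInstance]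
      =ᵐ[P] fun o => M.armProb t a (hist t o) := by
  have hbit : {o : Traj T q | trt t o = true}.indicator (fun _ => (1 : ℝ)) =
      fun o => bit (trt t o) := by
    ext o; simp [Set.indicator, bit]
  cases a
  · have hcompl : {o : Traj T q | trt t o = false}.indicator (fun _ => (1 : ℝ)) =
        (fun _ => 1) - {o | trt t o = true}.indicator fun _ => 1 := by
      ext o; cases h : trt t o <;> simp [h]
    rw [hcompl]
    filter_upwards [condExp_sub (integrable_const (1 : ℝ))
      ((integrable_const (1 : ℝ)).indicator (measurableSet_trt t true)) _, hd.randomized t]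
      with o hsub hp
    rw [hsub, Pi.sub_apply, condExp_const (comap_hist_le t), hbit, hp]
    rfl
  · rw [hbit]
    exact hd.randomized t

theorem Design.setIntegral_trt (hd : M.Design P) (t : Fin T) (a : Bool) {f : Traj T q → ℝ}
    (hf : StronglyMeasurable[MeasurableSpace.comap (hist (q := q) t) inferInstance] f)
    (hfi : Integrable f P) :
    ∫ o in {o | trt t o = a}, f o ∂P = ∫ o, f o * M.armProb t a (hist t o) ∂P := by
  have hmul : {o | trt t o = a}.indicator f =
      fun o => f o * {o | trt t o = a}.indicator (fun _ => 1) o := by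
    ext o
    simp [Set.indicator]
  have hint := hfi.indicator (measurableSet_trt t a)
  rw [hmul] at hint
  rw [← integral_indicator (measurableSet_trt t a), hmul, integral_mul_condExp (comap_hist_le t) hf
    hint ((integrable_const 1).indicator (measurableSet_trt t a))]
  refine integral_congr_ae ?_
  filter_upwards [hd.condExp_indicator_trt t a] with o ho
  rw [ho]

theorem Design.mul_measure_avail_le (hd : M.Design P) {τ : ℝ} (hτ : M.Positive P τ) (t : Fin T)
    (a : Bool) {B : Set (Hist q t)} (hB : MeasurableSet B) :
    ENNReal.ofReal τ * P (hist t ⁻¹' B ∩ {o | avail t o = true}) ≤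
      P (hist t ⁻¹' B ∩ {o | trt t o = a}) := by
  set E : Set (Traj T q) := hist t ⁻¹' B ∩ {o | avail t o = true}
  have hE : MeasurableSet[MeasurableSpace.comap (hist t) inferInstance] E :=
    ⟨B ∩ {h | h.2.1 = true},
      hB.inter ((measurable_fst.comp measurable_snd) (measurableSet_singleton true)), rfl⟩
  have hEm : MeasurableSet E := comap_hist_le t E hE
  have hreal : τ * P.real E ≤ P.real (E ∩ {o | trt t o = a}) :=
    calc τ * P.real E = ∫ _ in E, τ ∂P := by simp [mul_comm]
      _ ≤ ∫ o in E, M.armProb t a (hist t o) ∂P :=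
        setIntegral_mono_on_ae (integrable_const τ)
          (integrable_condExp.congr (hd.condExp_indicator_trt t a)).integrableOn hEm
          ((hτ.lt_armProb t a).mono fun o ho hoE => (ho hoE.2).le)
      _ = ∫ o in E, {o | trt t o = a}.indicator (fun _ => (1 : ℝ)) o ∂P := by
        rw [← setIntegral_condExp (comap_hist_le t)
          ((integrable_const (1 : ℝ)).indicator (measurableSet_trt t a)) hE]
        exact setIntegral_congr_ae hEm ((hd.condExp_indicator_trt t a).mono fun o ho _ => ho.symm)
      _ = P.real (E ∩ {o | trt t o = a}) := by
        rw [setIntegral_indicator (measurableSet_trt t a)]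
        simp
  calc ENNReal.ofReal τ * P E ≤ P (E ∩ {o | trt t o = a}) := by
        rw [← ofReal_measureReal, ← ofReal_measureReal, ← ENNReal.ofReal_mul hτ.pos.le]
        exact ENNReal.ofReal_le_ofReal hreal
    _ ≤ _ := measure_mono (Set.inter_subset_inter_left _ Set.inter_subset_left)

theorem Design.lintegral_avail_le (hd : M.Design P) {τ : ℝ} (hτ : M.Positive P τ) (t : Fin T)
    (a : Bool) {f : Hist q t → ℝ≥0∞} (hf : Measurable f) :
    ENNReal.ofReal τ * ∫⁻ o in {o | avail t o = true}, f (hist t o) ∂P ≤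
      ∫⁻ o in {o | trt t o = a}, f (hist t o) ∂P := by
  have hle : ENNReal.ofReal τ • (P.restrict {o | avail t o = true}).map (hist t) ≤
      (P.restrict {o | trt t o = a}).map (hist t) := by
    refine Measure.le_iff.2 fun B hB => ?_
    have hBm := measurable_hist t hB
    rw [Measure.smul_apply, Measure.map_apply (measurable_hist t) hB,
      Measure.map_apply (measurable_hist t) hB, Measure.restrict_apply hBm,
      Measure.restrict_apply hBm]
    exact hd.mul_measure_avail_le hτ t a hB
  calc _ = ∫⁻ h, f h ∂(ENNReal.ofReal τ • (P.restrict {o | avail t o = true}).map (hist t)) := by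
        rw [lintegral_smul_measure, lintegral_map hf (measurable_hist t), smul_eq_mul]
    _ ≤ ∫⁻ h, f h ∂((P.restrict {o | trt t o = a}).map (hist t)) := lintegral_mono' hle le_rfl
    _ = _ := lintegral_map hf (measurable_hist t)

theorem Design.ae_avail (hd : M.Design P) (t : Fin T) (a : Bool) {E : Set (Hist q t)}
    (hE : MeasurableSet E) (h : ∀ᵐ o ∂P, trt t o = a → hist t o ∈ E) :
    ∀ᵐ o ∂P, avail t o = true → hist t o ∈ E := by
  obtain ⟨τ, hτ⟩ := hd.exists_positive
  have hle := hd.mul_measure_avail_le hτ t a hE.compl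
  have hnull : P (hist t ⁻¹' Eᶜ ∩ {o | trt t o = a}) = 0 :=
    measure_mono_null (t := {o | ¬(trt t o = a → hist t o ∈ E)})
      (fun _ ho hoE => ho.1 (hoE ho.2)) (ae_iff.1 h)
  rw [hnull, nonpos_iff_eq_zero, mul_eq_zero, ENNReal.ofReal_eq_zero] at hle
  refine ae_iff.2 (measure_mono_null (fun o ho => ?_) (hle.resolve_left hτ.pos.not_ge))
  exact (Classical.not_imp.1 ho).symm

theorem Design.boundedMu (hd : M.Design P) {t : Fin T} {C : ℝ} {mu : Hist q t → Bool → ℝ}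
    (hm : Measurable fun y : Hist q t × Bool => mu y.1 y.2) (h : BoundedMu P C t mu) (a : Bool) :
    ∀ᵐ o ∂P, avail t o = true → |mu (hist t o) a| ≤ C := by
  refine hd.ae_avail t a (E := {h | |mu h a| ≤ C}) (measurableSet_le
    (measurable_norm.comp (hm.comp measurable_prodMk_right)) measurable_const) ?_
  filter_upwards [h] with o ho hoa
  rw [hoa] at ho
  exact ho

theorem Design.lintegral_sub_mu_le (hd : M.Design P) {τ : ℝ} (hτ : M.Positive P τ) {t : Fin T}
    {mu mu' : Hist q t → Bool → ℝ} (hm : Measurable fun y : Hist q t × Bool => mu y.1 y.2)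
    (hm' : Measurable fun y : Hist q t × Bool => mu' y.1 y.2) (a : Bool) :
    ENNReal.ofReal τ * ∫⁻ o in {o | avail t o = true},
        ENNReal.ofReal ((mu (hist t o) a - mu' (hist t o) a) ^ 2) ∂P ≤ sqDistMu P t mu mu' := by
  refine (hd.lintegral_avail_le hτ t a (f := fun h => ENNReal.ofReal ((mu h a - mu' h a) ^ 2))
    ((((hm.comp measurable_prodMk_right).sub
      (hm'.comp measurable_prodMk_right)).pow_const 2).ennreal_ofReal)).trans ?_
  calc _ = ∫⁻ o in {o | trt t o = a},
        ENNReal.ofReal ((mu (hist t o) (trt t o) - mu' (hist t o) (trt t o)) ^ 2) ∂P :=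
        setLIntegral_congr_fun (measurableSet_trt t a) fun o (ho : trt t o = a) => by
          simp only [ho]
    _ ≤ _ := setLIntegral_le_lintegral _ _

end Randomization

end Spec

namespace Spec

variable {M : Spec T q r p} {P : Measure (Traj T q)}

theorem stronglyMeasurable_meanGivenHist (t : Fin T) (a : Bool) :
    StronglyMeasurable[MeasurableSpace.comap (hist (q := q) t) inferInstance]
      (meanGivenHist P t a) := stronglyMeasurable_condExp

theorem measurable_meanGivenHist (t : Fin T) (a : Bool) : Measurable (meanGivenHist P t a) :=
  ((stronglyMeasurable_meanGivenHist t a).mono (comap_hist_le t)).measurable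

theorem measurable_meanGivenMod (t : Fin T) (a : Bool) : Measurable (M.meanGivenMod P t a) :=
  (stronglyMeasurable_condExp.mono (M.measurable_S t).comap_le).measurable

/-- The inverse probability weight `I_t / P(A_t = a | H_t)` of arm `a`. -/
noncomputable def ipw (M : Spec T q r p) (t : Fin T) (a : Bool) (o : Traj T q) : ℝ :=
  bit (avail t o) * (M.armProb t a (hist t o))⁻¹

theorem stronglyMeasurable_ipw (t : Fin T) (a : Bool) :
    StronglyMeasurable[MeasurableSpace.comap (hist (q := q) t) inferInstance] (M.ipw t a) :=
  stronglyMeasurable_hist (f := fun h => bit h.2.1 * (M.armProb t a h)⁻¹)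
    ((measurable_bit.comp (measurable_fst.comp measurable_snd)).mul (M.measurable_armProb t a).inv)

theorem measurable_ipw (t : Fin T) (a : Bool) : Measurable (M.ipw t a) :=
  ((stronglyMeasurable_ipw t a).mono (comap_hist_le t)).measurable

theorem Positive.abs_ipw_le {τ : ℝ} (hτ : M.Positive P τ) (t : Fin T) (a : Bool) :
    ∀ᵐ o ∂P, |M.ipw t a o| ≤ τ⁻¹ := by
  filter_upwards [hτ.lt_armProb t a] with o ho
  cases h : avail t o
  · simpa [ipw, bit, h] using hτ.pos.le
  · have hlt := ho h
    simp only [ipw, bit, h, if_true, one_mul, abs_inv, abs_of_pos (hτ.pos.trans hlt)]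
    exact inv_anti₀ hτ.pos hlt.le

theorem Positive.integrable_ipw_mul {τ : ℝ} (hτ : M.Positive P τ) (t : Fin T) (a : Bool)
    {f : Traj T q → ℝ} (hfi : IntegrableOn f {o | avail t o = true} P) :
    Integrable (fun o => M.ipw t a o * f o) P := by
  refine ((hfi.integrable_indicator (measurableSet_avail t)).bdd_mul
    (measurable_ipw (M := M) t a).aestronglyMeasurable (hτ.abs_ipw_le t a)).congr
    (ae_of_all _ fun o => ?_)
  cases h : avail t o <;> simp [h, ipw, bit, Set.indicator]

variable {R : ℝ} {t : Fin T}

theorem Positive.integrable_arm {τ : ℝ} (hτ : M.Positive P τ) (hR : ∀ᵐ o ∂P, |outc t o| ≤ R)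
    (a : Bool) {ρ : Vec r → ℝ}
    (hρi : IntegrableOn (fun o => ρ (M.S t o)) {o | avail t o = true} P)
    {f : Hist q t → ℝ} (hfi : IntegrableOn (fun o => f (hist t o)) {o | avail t o = true} P) :
    Integrable (fun o => M.ipw t a o * (ρ (M.S t o) * outc t o - f (hist t o))) P :=
  hτ.integrable_ipw_mul t a
    ((integrableOn_mul_of_bdd (measurableSet_avail t) hρi (measurable_outc t)
      (hR.mono fun _ ho _ => ho)).sub hfi)

/-- The difference of the two inverse probability weighted arms, with outcomes scaled by `ρ` and
centered by `f`. -/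
noncomputable def contrast (M : Spec T q r p) (t : Fin T) (ρ : Bool → Vec r → ℝ)
    (f : Bool → Hist q t → ℝ) (o : Traj T q) : ℝ :=
  (if trt t o then 1 else -1) *
    (M.ipw t (trt t o) o * (ρ (trt t o) (M.S t o) * outc t o - f (trt t o) (hist t o)))

theorem contrast_eq_indicator_sub (ρ : Bool → Vec r → ℝ) (f : Bool → Hist q t → ℝ)
    (o : Traj T q) :
    M.contrast t ρ f o =
      {o | trt t o = true}.indicator
          (fun o => M.ipw t true o * (ρ true (M.S t o) * outc t o - f true (hist t o))) o -
        {o | trt t o = false}.indicator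
          (fun o => M.ipw t false o * (ρ false (M.S t o) * outc t o - f false (hist t o))) o := by
  cases h : trt t o <;> simp [contrast, h]

theorem Positive.integrable_contrast {τ : ℝ} (hτ : M.Positive P τ)
    (hR : ∀ᵐ o ∂P, |outc t o| ≤ R) {ρ : Bool → Vec r → ℝ}
    (hρi : ∀ a, IntegrableOn (fun o => ρ a (M.S t o)) {o | avail t o = true} P)
    {f : Bool → Hist q t → ℝ}
    (hfi : ∀ a, IntegrableOn (fun o => f a (hist t o)) {o | avail t o = true} P) :
    Integrable (M.contrast t ρ f) P :=
  (((hτ.integrable_arm hR true (hρi true) (hfi true)).indicator (measurableSet_trt t true)).sub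
    ((hτ.integrable_arm hR false (hρi false) (hfi false)).indicator
      (measurableSet_trt t false))).congr
    (ae_of_all _ fun o => (contrast_eq_indicator_sub ρ f o).symm)

variable [IsProbabilityMeasure P]

theorem Design.abs_meanGivenHist_le (hd : M.Design P) (hR : ∀ᵐ o ∂P, |outc t o| ≤ R) (a : Bool) :
    ∀ᵐ o ∂P, avail t o = true → |meanGivenHist P t a o| ≤ R := by
  have harm : ∀ᵐ o ∂P, trt t o = a → |meanGivenHist P t a o| ≤ R :=
    (ae_cond_iff (measurableSet_trt t a)).1 (ae_bdd_abs_condExp_of_ae_bdd_abs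
      ((ae_cond_iff (measurableSet_trt t a)).2 (hR.mono fun _ ho _ => ho)))
  obtain ⟨E, hE, hEeq⟩ : MeasurableSet[MeasurableSpace.comap (hist (q := q) t) inferInstance]
      {o | |meanGivenHist P t a o| ≤ R} :=
    measurableSet_le (measurable_norm.comp (stronglyMeasurable_meanGivenHist t a).measurable)
      measurable_const
  have hmem : ∀ o, hist t o ∈ E ↔ |meanGivenHist P t a o| ≤ R := Set.ext_iff.1 hEeq
  simp only [← hmem] at harm ⊢
  exact hd.ae_avail t a hE harm

theorem Design.abs_meanGivenMod_le (hd : M.Design P) (hR : ∀ᵐ o ∂P, |outc t o| ≤ R) (a : Bool) :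
    ∀ᵐ o ∂P, avail t o = true → |M.meanGivenMod P t a o| ≤ R :=
  (ae_cond_iff (measurableSet_avail t)).1 (ae_bdd_abs_condExp_of_ae_bdd_abs
    ((ae_cond_iff (measurableSet_avail t)).2 (hd.abs_meanGivenHist_le hR a)))

theorem Design.setIntegral_ipw (hd : M.Design P) (t : Fin T) (a : Bool) {f : Traj T q → ℝ}
    (hf : StronglyMeasurable[MeasurableSpace.comap (hist (q := q) t) inferInstance] f)
    (hfi : IntegrableOn f {o | avail t o = true} P) :
    ∫ o in {o | trt t o = a}, M.ipw t a o * f o ∂P = ∫ o in {o | avail t o = true}, f o ∂P := by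
  obtain ⟨τ, hτ⟩ := hd.exists_positive
  rw [hd.setIntegral_trt t a (f := fun o => M.ipw t a o * f o)
      ((stronglyMeasurable_ipw t a).mul hf) (hτ.integrable_ipw_mul t a hfi),
    ← integral_indicator (measurableSet_avail t)]
  refine integral_congr_ae ?_
  filter_upwards [hτ.lt_armProb t a] with o ho
  cases h : avail t o
  · simp [ipw, bit, h, Set.indicator]
  · have hne := (hτ.pos.trans (ho h)).ne'
    simp only [ipw, bit, h, if_true, one_mul, Set.indicator, Set.mem_ofPred_eq]
    field_simp

theorem Design.setIntegral_ipw_mul_outc (hd : M.Design P) (hR : ∀ᵐ o ∂P, |outc t o| ≤ R) (a : Bool)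
    {f : Traj T q → ℝ}
    (hf : StronglyMeasurable[MeasurableSpace.comap (hist (q := q) t) inferInstance] f)
    (hfi : IntegrableOn f {o | avail t o = true} P) :
    ∫ o in {o | trt t o = a}, M.ipw t a o * f o * outc t o ∂P =
      ∫ o in {o | avail t o = true}, f o * meanGivenHist P t a o ∂P := by
  obtain ⟨τ, hτ⟩ := hd.exists_positive
  have hY : Integrable (outc (q := q) t) P :=
    Integrable.of_bound (measurable_outc t).aestronglyMeasurable R hR
  calc _ = ∫ o in {o | trt t o = a}, M.ipw t a o * f o * meanGivenHist P t a o ∂P :=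
        setIntegral_mul_condExp_cond (comap_hist_le t) ((stronglyMeasurable_ipw t a).mul hf)
          ((hτ.integrable_ipw_mul t a hfi).mul_bdd (c := R)
            (measurable_outc t).aestronglyMeasurable hR).integrableOn hY.integrableOn
    _ = ∫ o in {o | trt t o = a}, M.ipw t a o * (f o * meanGivenHist P t a o) ∂P := by
        simp only [mul_assoc]
    _ = _ := hd.setIntegral_ipw t a (hf.mul (stronglyMeasurable_meanGivenHist t a))
        (integrableOn_mul_of_bdd (measurableSet_avail t) hfi (measurable_meanGivenHist t a)
          (hd.abs_meanGivenHist_le hR a))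

theorem Design.setIntegral_mul_meanGivenHist (hd : M.Design P) (hR : ∀ᵐ o ∂P, |outc t o| ≤ R)
    (a : Bool) {ρ : Vec r → ℝ} (hρ : Measurable ρ)
    (hρi : IntegrableOn (fun o => ρ (M.S t o)) {o | avail t o = true} P) :
    ∫ o in {o | avail t o = true}, ρ (M.S t o) * meanGivenHist P t a o ∂P =
      ∫ o in {o | avail t o = true}, ρ (M.S t o) * M.meanGivenMod P t a o ∂P := by
  have hbdd := hd.abs_meanGivenHist_le hR a
  refine setIntegral_mul_condExp_cond (M.measurable_S t).comap_le
    (hρ.comp (comap_measurable (M.S t))).stronglyMeasurable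
    (integrableOn_mul_of_bdd (measurableSet_avail t) hρi (measurable_meanGivenHist t a) hbdd) ?_
  exact Measure.integrableOn_of_bounded (measure_ne_top _ _)
    (measurable_meanGivenHist t a).aestronglyMeasurable
    ((ae_restrict_iff' (measurableSet_avail t)).2 hbdd)

theorem Design.integrableOn_mul_meanGivenMod_sub (hd : M.Design P)
    (hR : ∀ᵐ o ∂P, |outc t o| ≤ R) (a : Bool) {ρ : Vec r → ℝ}
    (hρi : IntegrableOn (fun o => ρ (M.S t o)) {o | avail t o = true} P)
    {f : Hist q t → ℝ} (hfi : IntegrableOn (fun o => f (hist t o)) {o | avail t o = true} P) :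
    IntegrableOn (fun o => ρ (M.S t o) * M.meanGivenMod P t a o - f (hist t o))
      {o | avail t o = true} P :=
  (integrableOn_mul_of_bdd (measurableSet_avail t) hρi (measurable_meanGivenMod t a)
    (hd.abs_meanGivenMod_le hR a)).sub hfi

theorem Design.setIntegral_arm (hd : M.Design P) (hR : ∀ᵐ o ∂P, |outc t o| ≤ R) (a : Bool)
    {ρ : Vec r → ℝ} (hρ : Measurable ρ)
    (hρi : IntegrableOn (fun o => ρ (M.S t o)) {o | avail t o = true} P)
    {f : Hist q t → ℝ} (hf : Measurable f)
    (hfi : IntegrableOn (fun o => f (hist t o)) {o | avail t o = true} P) :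
    ∫ o in {o | trt t o = a}, M.ipw t a o * (ρ (M.S t o) * outc t o - f (hist t o)) ∂P =
      ∫ o in {o | avail t o = true},
        (ρ (M.S t o) * M.meanGivenMod P t a o - f (hist t o)) ∂P := by
  obtain ⟨τ, hτ⟩ := hd.exists_positive
  calc _ = ∫ o in {o | trt t o = a}, (M.ipw t a o * ρ (M.S t o) * outc t o -
          M.ipw t a o * f (hist t o)) ∂P := by simp only [mul_sub, mul_assoc]
    _ = ∫ o in {o | trt t o = a}, M.ipw t a o * ρ (M.S t o) * outc t o ∂P -
          ∫ o in {o | trt t o = a}, M.ipw t a o * f (hist t o) ∂P :=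
        integral_sub ((hτ.integrable_ipw_mul t a hρi).mul_bdd (c := R)
            (measurable_outc t).aestronglyMeasurable hR).integrableOn
          (hτ.integrable_ipw_mul t a hfi).integrableOn
    _ = ∫ o in {o | avail t o = true}, ρ (M.S t o) * M.meanGivenMod P t a o ∂P -
          ∫ o in {o | avail t o = true}, f (hist t o) ∂P := by
        rw [← hd.setIntegral_mul_meanGivenHist hR a hρ hρi,
          ← hd.setIntegral_ipw t a (stronglyMeasurable_hist hf) hfi]
        exact congrArg (· - _) (hd.setIntegral_ipw_mul_outc hR a
          (stronglyMeasurable_hist (hρ.comp (M.modr_meas t))) hρi)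
    _ = _ := (integral_sub (integrableOn_mul_of_bdd (measurableSet_avail t) hρi
        (measurable_meanGivenMod t a) (hd.abs_meanGivenMod_le hR a)) hfi).symm

theorem Design.integral_contrast (hd : M.Design P) (hR : ∀ᵐ o ∂P, |outc t o| ≤ R)
    {ρ : Bool → Vec r → ℝ} (hρ : ∀ a, Measurable (ρ a))
    (hρi : ∀ a, IntegrableOn (fun o => ρ a (M.S t o)) {o | avail t o = true} P)
    {f : Bool → Hist q t → ℝ} (hf : ∀ a, Measurable (f a))
    (hfi : ∀ a, IntegrableOn (fun o => f a (hist t o)) {o | avail t o = true} P)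
    (hbal : ∀ᵐ o ∂P, avail t o = true →
      ρ true (M.S t o) * M.meanGivenMod P t true o -
          ρ false (M.S t o) * M.meanGivenMod P t false o =
        f true (hist t o) - f false (hist t o)) :
    ∫ o, M.contrast t ρ f o ∂P = 0 := by
  obtain ⟨τ, hτ⟩ := hd.exists_positive
  have hi := fun a => (hτ.integrable_arm hR a (hρi a) (hfi a)).indicator (measurableSet_trt t a)
  simp only [contrast_eq_indicator_sub]
  rw [integral_sub (hi true) (hi false),
    integral_indicator (measurableSet_trt t true), integral_indicator (measurableSet_trt t false),
    hd.setIntegral_arm hR true (hρ true) (hρi true) (hf true) (hfi true),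
    hd.setIntegral_arm hR false (hρ false) (hρi false) (hf false) (hfi false),
    ← integral_sub (hd.integrableOn_mul_meanGivenMod_sub hR true (hρi true) (hfi true))
      (hd.integrableOn_mul_meanGivenMod_sub hR false (hρi false) (hfi false))]
  refine integral_eq_zero_of_ae ((ae_restrict_iff' (measurableSet_avail t)).2 ?_)
  filter_upwards [hbal] with o ho hoa
  simp only [Pi.zero_apply]
  linarith [ho hoa]

end Spec

theorem abs_bit_le (a : Bool) : |bit a| ≤ 1 := by cases a <;> simp [bit]

namespace Link

/-- The factor `1` or `e^{-a g}` of an arm-`a` outcome in the residual, for an effect of size `g`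
on the scale of the link. -/
noncomputable def ratio : Link → Bool → ℝ → ℝ
  | identity, _, _ => 1
  | log, a, g => Real.exp (-bit a * g)

/-- The term `(a + π - 1) g` subtracted from the outcome in the residual for the identity link,
where `π` is the randomization probability; there is no such term for the log link. -/
noncomputable def offset : Link → Bool → ℝ → ℝ → ℝ
  | identity, a, π, g => (bit a + π - 1) * g
  | log, _, _, _ => 0

variable (l : Link) (a : Bool) {π g c : ℝ}

theorem contDiff_ratio {n : WithTop ℕ∞} : ContDiff ℝ n (l.ratio a) := by
  cases l
  · exact contDiff_const
  · exact (contDiff_const.mul contDiff_id).exp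

theorem contDiff_offset {n : WithTop ℕ∞} (π : ℝ) : ContDiff ℝ n (l.offset a π) := by
  cases l
  · exact contDiff_const.mul contDiff_id
  · exact contDiff_const

theorem abs_ratio_le (hg : |g| ≤ c) : |l.ratio a g| ≤ Real.exp c := by
  have hc : 0 ≤ c := (abs_nonneg _).trans hg
  cases l
  · simpa [ratio] using hc
  · refine (Real.abs_exp _).trans_le (Real.exp_le_exp.2 ?_)
    cases a
    · simpa [bit] using hc
    · simpa [bit] using (neg_le_abs _).trans hg

theorem abs_deriv_ratio_le (hg : |g| ≤ c) : |deriv (l.ratio a) g| ≤ Real.exp c := by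
  have hratio := l.abs_ratio_le a hg
  cases l
  · exact (congrArg abs (deriv_const g (1 : ℝ))).trans_le (abs_zero.trans_le (Real.exp_nonneg c))
  · have hderiv : HasDerivAt (log.ratio a) (log.ratio a g * (-bit a * 1)) g :=
      ((hasDerivAt_id g).const_mul (-bit a)).exp
    rw [hderiv.deriv, mul_one, abs_mul, abs_neg]
    exact (mul_le_of_le_one_right (abs_nonneg _) (abs_bit_le a)).trans hratio

theorem abs_bit_add_sub_one_le (hπ : π ∈ Set.Icc 0 1) : |bit a + π - 1| ≤ 1 := by
  rw [abs_le]
  cases a <;> simp only [bit, if_true, Bool.false_eq_true, if_false] <;>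
    constructor <;> linarith [hπ.1, hπ.2]

theorem abs_offset_le (hπ : π ∈ Set.Icc 0 1) (hg : |g| ≤ c) : |l.offset a π g| ≤ c := by
  cases l
  · refine (abs_mul _ _).trans_le ?_
    exact (mul_le_of_le_one_left (abs_nonneg _) (abs_bit_add_sub_one_le a hπ)).trans hg
  · exact abs_zero.trans_le ((abs_nonneg _).trans hg)

theorem abs_deriv_offset_le (hπ : π ∈ Set.Icc 0 1) : |deriv (l.offset a π) g| ≤ 1 := by
  cases l
  · have hderiv : HasDerivAt (identity.offset a π) ((bit a + π - 1) * 1) g :=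
      (hasDerivAt_id g).const_mul _
    rw [hderiv.deriv, mul_one]
    exact abs_bit_add_sub_one_le a hπ
  · exact (congrArg abs (deriv_const g (0 : ℝ))).trans_le (abs_zero.trans_le zero_le_one)

theorem ratio_mul_sub_ratio_mul {l : Link} {m₁ m₀ : ℝ} (hpos : l = log → 0 < m₁ ∧ 0 < m₀)
    (heq : l.fn m₁ - l.fn m₀ = g) (π : ℝ) :
    l.ratio true g * m₁ - l.ratio false g * m₀ = l.offset true π g - l.offset false π g := by
  subst heq
  cases l
  · simp only [ratio, offset, fn, bit, if_true, Bool.false_eq_true, if_false]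
    ring
  · obtain ⟨h₁, h₀⟩ := hpos rfl
    simp only [ratio, offset, fn, bit, if_true, Bool.false_eq_true, if_false, neg_zero, zero_mul,
      Real.exp_zero, sub_self, one_mul, neg_sub, neg_mul, Real.exp_sub, Real.exp_log h₁,
      Real.exp_log h₀]
    field_simp
    ring

section Measurability

variable {α : Type*} [MeasurableSpace α] {a : α → Bool} {π g : α → ℝ}

theorem measurable_ratio (ha : Measurable a) (hg : Measurable g) :
    Measurable fun x => l.ratio (a x) (g x) := by
  cases l
  · exact measurable_const
  · exact ((measurable_bit.comp ha).neg.mul hg).exp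

theorem measurable_offset (ha : Measurable a) (hπ : Measurable π) (hg : Measurable g) :
    Measurable fun x => l.offset (a x) (π x) (g x) := by
  cases l
  · exact (((measurable_bit.comp ha).add hπ).sub_const 1).mul hg
  · exact measurable_const

end Measurability

end Link

namespace Spec

variable {M : Spec T q r p} {P : Measure (Traj T q)}

theorem BoundedSupport.exists_bound (h : M.BoundedSupport P) (R : ℝ) : ∃ c : ℝ, 0 ≤ c ∧
    ∀ t, ∀ᵐ o ∂P, |outc t o| ≤ c ∧ ∀ b, ‖b‖ ≤ R → |M.gam t (M.S t o) b| ≤ c ∧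
      ‖fderiv ℝ (M.gam t (M.S t o)) b‖ ≤ c ∧
      ‖fderiv ℝ (fderiv ℝ (M.gam t (M.S t o))) b‖ ≤ c := by
  obtain ⟨R₀, h⟩ := h
  choose c hc using fun t => M.gam_bdd t (max R₀ R)
  have hct (t) : c t ≤ ∑ t, |c t| :=
    (le_abs_self _).trans (Finset.single_le_sum (f := fun t => |c t|) (fun _ _ => abs_nonneg _)
      (Finset.mem_univ t))
  have hsum : 0 ≤ ∑ t, |c t| := Finset.sum_nonneg fun _ _ => abs_nonneg _
  refine ⟨max R₀ 0 + ∑ t, |c t|, by positivity, fun t => ?_⟩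
  have hle : c t ≤ max R₀ 0 + ∑ t, |c t| :=
    (hct t).trans (le_add_of_nonneg_left (le_max_right _ _))
  filter_upwards [h t] with o ⟨_, hY, hS⟩
  refine ⟨hY.trans ((le_max_left _ _).trans (le_add_of_nonneg_right hsum)), fun b hb => ?_⟩
  obtain ⟨hgam, hgam₁, hgam₂⟩ := hc t (M.S t o) b (hS.trans (le_max_left _ _))
    (hb.trans (le_max_right _ _))
  exact ⟨hgam.trans hle, hgam₁.trans hle, hgam₂.trans hle⟩

/-- The part of the residual that is subtracted from the scaled outcome, in arm `a`. -/
noncomputable def center (M : Spec T q r p) (t : Fin T) (b : Vec p) (mu : Hist q t → Bool → ℝ)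
    (a : Bool) (h : Hist q t) : ℝ :=
  M.link.offset a (M.prob t h) (M.gam t (M.modr t h) b) +
    (1 - M.prob t h) * M.link.ratio true (M.gam t (M.modr t h) b) * mu h true +
    M.prob t h * M.link.ratio false (M.gam t (M.modr t h) b) * mu h false

theorem resid_eq (t : Fin T) (b : Vec p) (mu : Hist q t → Bool → ℝ) (o : Traj T q) :
    M.resid t b mu o = M.link.ratio (trt t o) (M.gam t (M.S t o) b) * outc t o -
      M.center t b mu (trt t o) (hist t o) := by
  simp only [resid, center, S]
  cases M.link
  · simp only [Link.ratio, Link.offset]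
    ring
  · simp only [Link.ratio, Link.offset, bit, if_true, Bool.false_eq_true, if_false, neg_zero,
      zero_mul, Real.exp_zero, neg_one_mul]
    ring

theorem measurable_center (t : Fin T) (b : Vec p) {mu : Hist q t → Bool → ℝ}
    (hm : Measurable fun y : Hist q t × Bool => mu y.1 y.2) (a : Bool) :
    Measurable (M.center t b mu a) := by
  have hp := M.prob_meas t
  have hg : Measurable fun h => M.gam t (M.modr t h) b := (M.gam_meas t b).comp (M.modr_meas t)
  have hr (a : Bool) := M.link.measurable_ratio (measurable_const (a := a)) hg
  exact ((M.link.measurable_offset measurable_const hp hg).add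
    (((hp.const_sub 1).mul (hr true)).mul (hm.comp measurable_prodMk_right))).add
    ((hp.mul (hr false)).mul (hm.comp measurable_prodMk_right))

theorem abs_center_le {t : Fin T} {b : Vec p} {mu : Hist q t → Bool → ℝ} {h : Hist q t} {c C : ℝ}
    (hg : |M.gam t (M.modr t h) b| ≤ c) (hmu : ∀ a, |mu h a| ≤ C)
    (hp : M.prob t h ∈ Set.Icc 0 1) (a : Bool) :
    |M.center t b mu a h| ≤ c + Real.exp c * C + Real.exp c * C := by
  have hterm {x : ℝ} (hx : |x| ≤ 1) (a : Bool) :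
      |x * M.link.ratio a (M.gam t (M.modr t h) b) * mu h a| ≤ Real.exp c * C := by
    rw [abs_mul, abs_mul]
    exact mul_le_mul ((mul_le_of_le_one_left (abs_nonneg _) hx).trans (M.link.abs_ratio_le a hg))
      (hmu a) (abs_nonneg _) (Real.exp_nonneg _)
  refine (abs_add_three _ _ _).trans (add_le_add_three (M.link.abs_offset_le a hp hg)
    (hterm (x := 1 - M.prob t h) ?_ true) (hterm (x := M.prob t h) ?_ false)) <;>
  · rw [abs_le]
    constructor <;> linarith [hp.1, hp.2]

/-- The coordinate `∂_{β_k} γ_t(s; β)` of the gradient. -/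
noncomputable def dgam (M : Spec T q r p) (t : Fin T) (k : Fin p) (s : Vec r) (b : Vec p) : ℝ :=
  fderiv ℝ (M.gam t s) b (EuclideanSpace.single k 1)

theorem measurable_dgam (t : Fin T) (k : Fin p) (b : Vec p) :
    Measurable fun s => M.dgam t k s b :=
  measurable_fderiv_apply (f := fun b s => M.gam t s b) (M.gam_meas t)
    (fun s => (M.gam_contDiff t s).differentiable two_ne_zero) b _

theorem abs_dgam_le {t : Fin T} {k : Fin p} {s : Vec r} {b : Vec p} {c : ℝ}
    (h : ‖fderiv ℝ (M.gam t s) b‖ ≤ c) : |M.dgam t k s b| ≤ c := by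
  have hle := (fderiv ℝ (M.gam t s) b).le_opNorm (EuclideanSpace.single k 1)
  rw [PiLp.norm_single, norm_one, mul_one] at hle
  exact hle.trans h

theorem gradient_apply (t : Fin T) (s : Vec r) (b : Vec p) (k : Fin p) :
    gradient (M.gam t s) b k = M.dgam t k s b := by
  have hinner : inner ℝ (gradient (M.gam t s) b) (EuclideanSpace.single k (1 : ℝ)) =
      M.dgam t k s b := InnerProductSpace.toDual_symm_apply
  rw [← hinner, EuclideanSpace.inner_single_right]
  simp

/-- The factor `(A_t - p_t) / {p_t (1 - p_t)} I_t`. -/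
noncomputable def wt (M : Spec T q r p) (t : Fin T) (o : Traj T q) : ℝ :=
  (bit (trt t o) - M.prob t (hist t o)) /
      (M.prob t (hist t o) * (1 - M.prob t (hist t o))) * bit (avail t o)

theorem measurable_wt (t : Fin T) : Measurable (M.wt t) := by
  have hp := (M.prob_meas t).comp (measurable_hist t)
  exact (((measurable_bit.comp (measurable_trt t)).sub hp).div (hp.mul (hp.const_sub 1))).mul
    (measurable_bit.comp (measurable_avail t))

theorem phi_apply (t : Fin T) (b : Vec p) (mu : Hist q t → Bool → ℝ) (o : Traj T q) (k : Fin p) :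
    M.phi t b mu o k = M.wt t o * M.resid t b mu o * M.dgam t k (M.S t o) b := by
  rw [phi, PiLp.smul_apply, smul_eq_mul, gradient_apply]
  rfl

theorem Positive.wt_eq {τ : ℝ} (hτ : M.Positive P τ) (t : Fin T) : ∀ᵐ o ∂P,
    M.wt t o = (if trt t o then 1 else -1) * M.ipw t (trt t o) o := by
  filter_upwards [hτ.prob_mem t] with o hprob
  cases hav : avail t o
  · simp [wt, ipw, bit, hav]
  · obtain ⟨hpos, hlt⟩ := hprob hav
    have hne : M.prob t (hist t o) ≠ 0 := hpos.ne'
    have hne' : 1 - M.prob t (hist t o) ≠ 0 := (sub_pos.2 hlt).ne'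
    cases htrt : trt t o
    · simp only [wt, ipw, armProb, bit, hav, htrt, if_true, Bool.false_eq_true, if_false]
      field_simp
      ring
    · simp only [wt, ipw, armProb, bit, hav, htrt, if_true]
      field_simp

theorem Positive.abs_wt_le {τ : ℝ} (hτ : M.Positive P τ) (t : Fin T) :
    ∀ᵐ o ∂P, |M.wt t o| ≤ τ⁻¹ := by
  filter_upwards [hτ.wt_eq t, hτ.abs_ipw_le t true, hτ.abs_ipw_le t false] with o hwt htrue hfalse
  rw [hwt]
  cases trt t o
  · simpa using hfalse
  · simpa using htrue

theorem EffectModel.balance [IsFiniteMeasure P] {b : Vec p} (h : M.EffectModel P b) (t : Fin T)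
    (mu : Hist q t → Bool → ℝ) : ∀ᵐ o ∂P, avail t o = true →
      M.link.ratio true (M.gam t (M.S t o) b) * M.meanGivenMod P t true o -
        M.link.ratio false (M.gam t (M.S t o) b) * M.meanGivenMod P t false o =
        M.center t b mu true (hist t o) - M.center t b mu false (hist t o) := by
  filter_upwards [(ae_cond_iff (measurableSet_avail t)).1 (h t)] with o ho hoa
  obtain ⟨hpos, heq⟩ := ho hoa
  rw [Link.ratio_mul_sub_ratio_mul hpos heq (M.prob t (hist t o))]
  simp only [center, S]
  ring

variable [IsProbabilityMeasure P]

theorem Design.abs_center_le (hd : M.Design P) {b : Vec p} {t : Fin T} {c C : ℝ}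
    {mu : Hist q t → Bool → ℝ} (hm : Measurable fun y : Hist q t × Bool => mu y.1 y.2)
    (hmu : BoundedMu P C t mu) (hc : ∀ᵐ o ∂P, |M.gam t (M.S t o) b| ≤ c) (a : Bool) :
    ∀ᵐ o ∂P, avail t o = true →
      |M.center t b mu a (hist t o)| ≤ c + Real.exp c * C + Real.exp c * C := by
  obtain ⟨τ, hτ⟩ := hd.exists_positive
  filter_upwards [hc, hd.boundedMu hm hmu true, hd.boundedMu hm hmu false, hτ.prob_mem t]
    with o hg hmu₁ hmu₀ hp hav
  exact Spec.abs_center_le hg (fun a => by cases a; exacts [hmu₀ hav, hmu₁ hav])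
    ⟨(hp hav).1.le, (hp hav).2.le⟩ a

-- `D(S_t) φ_t` is a contrast of the two arms, and the effect model says precisely that the two
-- arms balance, whatever the weight `D` and the outcome model `mu`.
theorem Design.integral_weight_mul_phi (hd : M.Design P) (hbd : M.BoundedSupport P) {b : Vec p}
    (hb : M.EffectModel P b) {t : Fin T} {C : ℝ} {mu : Hist q t → Bool → ℝ}
    (hm : Measurable fun y : Hist q t × Bool => mu y.1 y.2) (hmu : BoundedMu P C t mu)
    {D : Vec r → ℝ} (hD : Measurable D) (hDi : Integrable (fun o => D (M.S t o)) P) (k : Fin p) :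
    Integrable (fun o => D (M.S t o) * M.phi t b mu o k) P ∧
      ∫ o, D (M.S t o) * M.phi t b mu o k ∂P = 0 := by
  obtain ⟨τ, hτ⟩ := hd.exists_positive
  obtain ⟨c, -, hc⟩ := hbd.exists_bound ‖b‖
  have hgam : ∀ᵐ o ∂P, |M.gam t (M.S t o) b| ≤ c := (hc t).mono fun o ho => (ho.2 b le_rfl).1
  have hDg : Measurable fun s => D s * M.dgam t k s b := hD.mul (M.measurable_dgam t k b)
  have hDgi : Integrable (fun o => D (M.S t o) * M.dgam t k (M.S t o) b) P :=
    hDi.mul_bdd (c := c) ((M.measurable_dgam t k b).comp (M.measurable_S t)).aestronglyMeasurable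
      ((hc t).mono fun o ho => abs_dgam_le (ho.2 b le_rfl).2.1)
  let ρ (a : Bool) (s : Vec r) : ℝ := D s * M.dgam t k s b * M.link.ratio a (M.gam t s b)
  let f (a : Bool) (h : Hist q t) : ℝ :=
    D (M.modr t h) * M.dgam t k (M.modr t h) b * M.center t b mu a h
  have hratio (a : Bool) : Measurable fun s => M.link.ratio a (M.gam t s b) :=
    M.link.measurable_ratio measurable_const (M.gam_meas t b)
  have hρ (a : Bool) : Measurable (ρ a) := hDg.mul (hratio a)
  have hρi (a : Bool) : IntegrableOn (fun o => ρ a (M.S t o)) {o | avail t o = true} P :=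
    integrableOn_mul_of_bdd (measurableSet_avail t) hDgi.integrableOn
      ((hratio a).comp (M.measurable_S t))
      (hgam.mono fun o ho _ => M.link.abs_ratio_le a ho)
  have hfi (a : Bool) : IntegrableOn (fun o => f a (hist t o)) {o | avail t o = true} P :=
    integrableOn_mul_of_bdd (measurableSet_avail t) hDgi.integrableOn
      ((measurable_center t b hm a).comp (measurable_hist t)) (hd.abs_center_le hm hmu hgam a)
  have hcontrast : M.contrast t ρ f =ᵐ[P] fun o => D (M.S t o) * M.phi t b mu o k := by
    filter_upwards [hτ.wt_eq t] with o ho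
    simp only [phi_apply, resid_eq, ho, contrast, ρ, f, S]
    ring
  have hR : ∀ᵐ o ∂P, |outc t o| ≤ c := (hc t).mono fun o ho => ho.1
  refine ⟨(hτ.integrable_contrast hR hρi hfi).congr hcontrast,
    (integral_congr_ae hcontrast).symm.trans (hd.integral_contrast hR hρ hρi
      (fun a => (hDg.comp (M.modr_meas t)).mul (measurable_center t b hm a)) hfi ?_)⟩
  filter_upwards [hb.balance t mu] with o ho hav
  have h := ho hav
  simp only [ρ, f, S] at h ⊢
  linear_combination D (M.modr t (hist t o)) * M.dgam t k (M.modr t (hist t o)) b * h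

end Spec

namespace Spec

variable {M : Spec T q r p} {P : Measure (Traj T q)}

/-- The coefficients of `1`, `μ_t(H_t, 1)` and `μ_t(H_t, 0)` in the residual, as functions of the
value `g` of `γ_t`. -/
noncomputable def resCoef (M : Spec T q r p) (t : Fin T) (m : Fin 3) (o : Traj T q) (g : ℝ) : ℝ :=
  ![M.link.ratio (trt t o) g * outc t o - M.link.offset (trt t o) (M.prob t (hist t o)) g,
    -((1 - M.prob t (hist t o)) * M.link.ratio true g),
    -(M.prob t (hist t o) * M.link.ratio false g)] m

/-- The coefficients of the features in the estimating function, which carry its whole dependence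
on `β`; an index `(t, k, m)` stands for a time, a coordinate of `φ_t`, and a term of the
residual. -/
noncomputable def phiCoef (M : Spec T q r p) (j : Fin T × Fin p × Fin 3) (b : Vec p)
    (o : Traj T q) : ℝ :=
  M.wt j.1 o * (M.resCoef j.1 j.2.2 o (M.gam j.1 (M.S j.1 o) b) * M.dgam j.1 j.2.1 (M.S j.1 o) b)

/-- The quantities `1`, `I_t μ_t(H_t, 1)` and `I_t μ_t(H_t, 0)`. The factor `I_t`, which `φ_t`
contains anyway, makes them bounded when `μ_t` is bounded on the available times only. -/
noncomputable def outcomeFeature {t : Fin T} (mu : Hist q t → Bool → ℝ) (m : Fin 3)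
    (o : Traj T q) : ℝ :=
  ![1, bit (avail t o) * mu (hist t o) true, bit (avail t o) * mu (hist t o) false] m

/-- The features, which carry the dependence of the estimating function on the fitted weights and
outcome models: products of entries of `d_t(S_t)` and of `outcomeFeature`. -/
noncomputable def feature (M : Spec T q r p) (d : Fin T → Vec r → Matrix (Fin p) (Fin p) ℝ)
    (mu : ∀ t : Fin T, Hist q t → Bool → ℝ) (j : Fin T × Fin p × Fin 3) (i : Fin p)
    (o : Traj T q) : ℝ :=
  d j.1 (M.S j.1 o) i j.2.1 * outcomeFeature (mu j.1) j.2.2 o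

theorem phi_apply_eq_sum (t : Fin T) (b : Vec p) (mu : Hist q t → Bool → ℝ) (o : Traj T q)
    (k : Fin p) :
    M.phi t b mu o k = ∑ m, outcomeFeature mu m o * M.phiCoef (t, k, m) b o := by
  rw [phi_apply, resid_eq, Fin.sum_univ_three]
  simp only [phiCoef, wt, center, resCoef, outcomeFeature, S, Matrix.cons_val_zero,
    Matrix.cons_val_one, Matrix.cons_val]
  cases avail t o
  · simp only [bit, Bool.false_eq_true, if_false]
    ring
  · simp only [bit, if_true]
    ring

theorem psi_apply (d : Fin T → Vec r → Matrix (Fin p) (Fin p) ℝ)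
    (mu : ∀ t : Fin T, Hist q t → Bool → ℝ) (b : Vec p) (o : Traj T q) (i : Fin p) :
    M.psi d mu b o i = ∑ t, ∑ k, d t (M.S t o) i k * M.phi t b (mu t) o k := by
  simp only [psi, WithLp.ofLp_sum, Finset.sum_apply, Matrix.mulVec, dotProduct]

theorem psi_apply_eq_sum (d : Fin T → Vec r → Matrix (Fin p) (Fin p) ℝ)
    (mu : ∀ t : Fin T, Hist q t → Bool → ℝ) (b : Vec p) (o : Traj T q) (i : Fin p) :
    M.psi d mu b o i = ∑ j, M.feature d mu j i o * M.phiCoef j b o := by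
  simp only [psi_apply, Fintype.sum_prod_type, phi_apply_eq_sum, Finset.mul_sum, feature, mul_assoc]

theorem contDiff_dgam (t : Fin T) (k : Fin p) (s : Vec r) : ContDiff ℝ 1 (M.dgam t k s) :=
  ((M.gam_contDiff t s).fderiv_right (m := 1) (by norm_num)).clm_apply contDiff_const

theorem contDiff_resCoef {n : WithTop ℕ∞} (t : Fin T) (m : Fin 3) (o : Traj T q) :
    ContDiff ℝ n (M.resCoef t m o) := by
  have hratio (a : Bool) : ContDiff ℝ n (M.link.ratio a) := M.link.contDiff_ratio a
  fin_cases m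
  · exact ((hratio _).mul contDiff_const).sub (M.link.contDiff_offset _ _)
  · exact (contDiff_const.mul (hratio _)).neg
  · exact (contDiff_const.mul (hratio _)).neg

theorem contDiff_phiCoef (j : Fin T × Fin p × Fin 3) (o : Traj T q) :
    ContDiff ℝ 1 fun b => M.phiCoef j b o :=
  contDiff_const.mul (((contDiff_resCoef _ _ o).comp
    ((M.gam_contDiff _ _).of_le (by norm_num))).mul (contDiff_dgam _ _ _))

theorem dphi_apply_eq_sum (t : Fin T) (b : Vec p) (mu : Hist q t → Bool → ℝ) (o : Traj T q)
    (k l : Fin p) :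
    M.dphi t b mu o k l = ∑ m, outcomeFeature mu m o *
      fderiv ℝ (fun b' => M.phiCoef (t, k, m) b' o) b (EuclideanSpace.single l 1) := by
  have hcoord (k : Fin p) : HasFDerivAt (fun b' => M.phi t b' mu o k)
      (∑ m, outcomeFeature mu m o • fderiv ℝ (fun b' => M.phiCoef (t, k, m) b' o) b) b := by
    simp only [phi_apply_eq_sum]
    exact HasFDerivAt.fun_sum fun m _ =>
      ((contDiff_phiCoef (t, k, m) o).differentiable one_ne_zero b).hasFDerivAt.const_mul _
  have hdiff : DifferentiableAt ℝ (fun b' => M.phi t b' mu o) b :=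
    differentiableAt_euclidean.2 fun k => (hcoord k).differentiableAt
  have hproj := (EuclideanSpace.proj k : Vec p →L[ℝ] ℝ).hasFDerivAt.comp b hdiff.hasFDerivAt
  simpa [dphi] using DFunLike.congr_fun (hproj.unique (hcoord k)) (EuclideanSpace.single l 1)

theorem dpsi_apply_eq_sum (d : Fin T → Vec r → Matrix (Fin p) (Fin p) ℝ)
    (mu : ∀ t : Fin T, Hist q t → Bool → ℝ) (b : Vec p) (o : Traj T q) (i l : Fin p) :
    M.dpsi d mu b o i l = ∑ j, M.feature d mu j i o *
      fderiv ℝ (fun b' => M.phiCoef j b' o) b (EuclideanSpace.single l 1) := by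
  simp only [dpsi, Matrix.sum_apply, Matrix.mul_apply, Fintype.sum_prod_type, dphi_apply_eq_sum,
    Finset.mul_sum, feature, mul_assoc]

theorem measurable_resCoef (t : Fin T) (m : Fin 3) {g : Traj T q → ℝ} (hg : Measurable g) :
    Measurable fun o => M.resCoef t m o (g o) := by
  have hp : Measurable fun o : Traj T q => M.prob t (hist t o) :=
    (M.prob_meas t).comp (measurable_hist t)
  have hratio (a : Bool) : Measurable fun o => M.link.ratio a (g o) :=
    M.link.measurable_ratio measurable_const hg
  fin_cases m
  · exact ((M.link.measurable_ratio (measurable_trt t) hg).mul (measurable_outc t)).sub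
      (M.link.measurable_offset (measurable_trt t) hp hg)
  · exact ((hp.const_sub 1).mul (hratio true)).neg
  · exact (hp.mul (hratio false)).neg

theorem measurable_phiCoef (j : Fin T × Fin p × Fin 3) (b : Vec p) :
    Measurable (M.phiCoef j b) :=
  (measurable_wt j.1).mul
    ((measurable_resCoef j.1 j.2.2 ((M.gam_meas j.1 b).comp (M.measurable_S j.1))).mul
      ((M.measurable_dgam j.1 j.2.1 b).comp (M.measurable_S j.1)))

section Bounds

variable {t : Fin T} {o : Traj T q} {c g : ℝ}

theorem abs_resCoef_le (hY : |outc t o| ≤ c) (hg : |g| ≤ c)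
    (hp : M.prob t (hist t o) ∈ Set.Icc 0 1) (m : Fin 3) :
    |M.resCoef t m o g| ≤ (c + 1) * (Real.exp c + 1) := by
  have hc : 0 ≤ c := (abs_nonneg _).trans hg
  have hexp := Real.exp_nonneg c
  have hterm {x : ℝ} (hx : |x| ≤ 1) (a : Bool) :
      |-(x * M.link.ratio a g)| ≤ (c + 1) * (Real.exp c + 1) := by
    rw [abs_neg, abs_mul]
    refine ((mul_le_of_le_one_left (abs_nonneg _) hx).trans (M.link.abs_ratio_le a hg)).trans ?_
    nlinarith [mul_nonneg hc hexp]
  fin_cases m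
  · refine (abs_sub _ _).trans ((add_le_add (a := |_ * _|) (b := Real.exp c * c) ?_
      (M.link.abs_offset_le (trt t o) hp hg)).trans (by linarith))
    rw [abs_mul]
    exact mul_le_mul (M.link.abs_ratio_le _ hg) hY (abs_nonneg _) hexp
  · refine hterm (abs_le.2 ⟨?_, ?_⟩) true <;> linarith [hp.1, hp.2]
  · refine hterm (abs_le.2 ⟨?_, ?_⟩) false <;> linarith [hp.1, hp.2]

theorem abs_deriv_resCoef_le (hY : |outc t o| ≤ c) (hg : |g| ≤ c)
    (hp : M.prob t (hist t o) ∈ Set.Icc 0 1) (m : Fin 3) :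
    |deriv (M.resCoef t m o) g| ≤ (c + 1) * (Real.exp c + 1) := by
  have hc : 0 ≤ c := (abs_nonneg _).trans hg
  have hexp := Real.exp_nonneg c
  have hratio (a : Bool) : HasDerivAt (M.link.ratio a) (deriv (M.link.ratio a) g) g :=
    ((M.link.contDiff_ratio a (n := 1)).differentiable one_ne_zero g).hasDerivAt
  have hoffset := ((M.link.contDiff_offset (trt t o) (M.prob t (hist t o)) (n := 1)).differentiable
    one_ne_zero g).hasDerivAt
  have hterm {x : ℝ} (hx : |x| ≤ 1) (a : Bool) :
      |deriv (fun g => -(x * M.link.ratio a g)) g| ≤ (c + 1) * (Real.exp c + 1) := by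
    refine (congrArg abs ((hratio a).const_mul x).neg.deriv).trans_le ?_
    rw [abs_neg, abs_mul]
    refine ((mul_le_of_le_one_left (abs_nonneg _) hx).trans
      (M.link.abs_deriv_ratio_le a hg)).trans ?_
    nlinarith [mul_nonneg hc hexp]
  fin_cases m
  · refine (congrArg abs (((hratio _).mul_const (outc t o)).sub hoffset).deriv).trans_le ?_
    refine (abs_sub _ _).trans ((add_le_add (a := |_ * _|) (b := Real.exp c * c) ?_
      (M.link.abs_deriv_offset_le (trt t o) hp)).trans (by linarith))
    rw [abs_mul]
    exact mul_le_mul (M.link.abs_deriv_ratio_le _ hg) hY (abs_nonneg _) hexp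
  · refine hterm (abs_le.2 ⟨?_, ?_⟩) true <;> linarith [hp.1, hp.2]
  · refine hterm (abs_le.2 ⟨?_, ?_⟩) false <;> linarith [hp.1, hp.2]

theorem norm_fderiv_dgam_le (t : Fin T) (k : Fin p) (s : Vec r) (b : Vec p) :
    ‖fderiv ℝ (M.dgam t k s) b‖ ≤ ‖fderiv ℝ (fderiv ℝ (M.gam t s)) b‖ := by
  have hdiff : DifferentiableAt ℝ (fderiv ℝ (M.gam t s)) b :=
    ((M.gam_contDiff t s).fderiv_right (m := 1) (by norm_num)).differentiable one_ne_zero b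
  refine ContinuousLinearMap.opNorm_le_bound _
    (norm_nonneg (fderiv ℝ (fderiv ℝ (M.gam t s)) b)) fun w => ?_
  have heq : fderiv ℝ (M.dgam t k s) b w =
      fderiv ℝ (fderiv ℝ (M.gam t s)) b w (EuclideanSpace.single k 1) := by
    change fderiv ℝ (fun y => fderiv ℝ (M.gam t s) y (EuclideanSpace.single k 1)) b w = _
    simpa using DFunLike.congr_fun (hdiff.hasFDerivAt.clm_apply
      (hasFDerivAt_const (EuclideanSpace.single k (1 : ℝ)) b)).fderiv w
  have hle := (fderiv ℝ (fderiv ℝ (M.gam t s)) b).le_opNorm₂ w (EuclideanSpace.single k (1 : ℝ))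
  rwa [PiLp.norm_single, norm_one, mul_one, ← heq] at hle

theorem norm_fderiv_phiCoef_le (j : Fin T × Fin p × Fin 3) (b : Vec p) {w B : ℝ}
    (hw : |M.wt j.1 o| ≤ w)
    (hres : |M.resCoef j.1 j.2.2 o (M.gam j.1 (M.S j.1 o) b)| ≤ B)
    (hres' : |deriv (M.resCoef j.1 j.2.2 o) (M.gam j.1 (M.S j.1 o) b)| ≤ B)
    (hg : ‖fderiv ℝ (M.gam j.1 (M.S j.1 o)) b‖ ≤ c)
    (hg' : ‖fderiv ℝ (fderiv ℝ (M.gam j.1 (M.S j.1 o))) b‖ ≤ c) :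
    ‖fderiv ℝ (fun b' => M.phiCoef j b' o) b‖ ≤ w * (B * c + c * (B * c)) := by
  obtain ⟨t, k, m⟩ := j
  have hB : 0 ≤ B := (abs_nonneg _).trans hres
  have hc : 0 ≤ c := (norm_nonneg _).trans hg
  have hgam := ((M.gam_contDiff t (M.S t o)).differentiable two_ne_zero b).hasFDerivAt
  have hresCoef := ((contDiff_resCoef (M := M) (n := 1) t m o).differentiable one_ne_zero
    (M.gam t (M.S t o) b)).hasDerivAt
  have hdgam := ((contDiff_dgam (M := M) t k (M.S t o)).differentiable one_ne_zero b).hasFDerivAt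
  have hfderiv := (((hresCoef.comp_hasFDerivAt b hgam).mul hdgam).const_mul (M.wt t o)).fderiv
  refine (congrArg norm hfderiv).trans_le ?_
  rw [norm_smul, Real.norm_eq_abs]
  refine mul_le_mul hw ((norm_add_le _ _).trans (add_le_add ?_ ?_)) (norm_nonneg _)
    ((abs_nonneg _).trans hw)
  · rw [norm_smul]
    exact mul_le_mul hres ((norm_fderiv_dgam_le t k _ b).trans hg') (norm_nonneg _) hB
  · rw [norm_smul, norm_smul]
    exact mul_le_mul (abs_dgam_le hg) (mul_le_mul hres' hg (norm_nonneg _) hB) (by positivity) hc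

end Bounds

theorem Design.phiCoef_bdd [IsProbabilityMeasure P] (hd : M.Design P) (hbd : M.BoundedSupport P)
    (R : ℝ) : ∃ C : ℝ, ∀ j, ∀ᵐ o ∂P, ∀ b, ‖b‖ ≤ R →
      |M.phiCoef j b o| ≤ C ∧ ‖fderiv ℝ (fun b' => M.phiCoef j b' o) b‖ ≤ C := by
  obtain ⟨τ, hτ⟩ := hd.exists_positive
  obtain ⟨c, hc0, hc⟩ := hbd.exists_bound R
  have hτ0 : 0 ≤ τ⁻¹ := (inv_pos.2 hτ.pos).le
  set B : ℝ := (c + 1) * (Real.exp c + 1)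
  have hB0 : 0 ≤ B := by positivity
  refine ⟨τ⁻¹ * (B * c + c * (B * c)), fun ⟨t, k, m⟩ => ?_⟩
  filter_upwards [hc t, hτ.prob_mem t, hτ.abs_wt_le t] with o ho hp hw b hb
  cases hav : avail t o
  · have hzero (b : Vec p) : M.phiCoef (t, k, m) b o = 0 := by simp [phiCoef, wt, bit, hav]
    simp only [hzero, abs_zero, fderiv_const_apply, norm_zero, and_self]
    positivity
  · obtain ⟨hg, hg₁, hg₂⟩ := ho.2 b hb
    have hp' : M.prob t (hist t o) ∈ Set.Icc 0 1 := ⟨(hp hav).1.le, (hp hav).2.le⟩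
    have hres := abs_resCoef_le ho.1 hg hp' m
    refine ⟨?_, norm_fderiv_phiCoef_le (t, k, m) b hw hres (abs_deriv_resCoef_le ho.1 hg hp' m)
      hg₁ hg₂⟩
    rw [phiCoef, abs_mul, abs_mul]
    refine mul_le_mul hw ((mul_le_mul hres (abs_dgam_le hg₁) (abs_nonneg _) hB0).trans ?_)
      (by positivity) hτ0
    exact le_add_of_nonneg_right (by positivity)

end Spec

/-! ### Products of bounded and square integrable functions -/

section Products

variable {ι 𝒳 : Type*} [MeasurableSpace 𝒳] {μ : Measure 𝒳} {l : Filter ι}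

theorem tendsto_lintegral_tsub_natCast {g : 𝒳 → ℝ≥0∞} (hg : Measurable g)
    (hgi : ∫⁻ o, g o ∂μ ≠ ⊤) : Tendsto (fun n : ℕ => ∫⁻ o, (g o - n) ∂μ) atTop (𝓝 0) := by
  rw [← lintegral_zero (μ := μ)]
  refine tendsto_lintegral_of_dominated_convergence g (fun n => hg.sub_const _)
    (fun n => ae_of_all _ fun o => tsub_le_self) hgi ?_
  filter_upwards [ae_lt_top hg hgi] with o ho
  obtain ⟨m, hm⟩ := ENNReal.exists_nat_gt ho.ne
  refine tendsto_const_nhds.congr' ((eventually_ge_atTop m).mono fun n hn => ?_)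
  exact (tsub_eq_zero_of_le (hm.le.trans (Nat.cast_le.2 hn))).symm

theorem tendsto_lintegral_mul_of_bdd {g : 𝒳 → ℝ≥0∞} (hg : Measurable g)
    (hgi : ∫⁻ o, g o ∂μ ≠ ⊤) {V : ι → 𝒳 → ℝ≥0∞} {c : ℝ≥0∞} (hc : c ≠ ⊤)
    (hV : ∀ᶠ x in l, ∀ᵐ o ∂μ, V x o ≤ c) (h0 : Tendsto (fun x => ∫⁻ o, V x o ∂μ) l (𝓝 0)) :
    Tendsto (fun x => ∫⁻ o, g o * V x o ∂μ) l (𝓝 0) := by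
  have htail : Tendsto (fun n : ℕ => c * ∫⁻ o, (g o - n) ∂μ) atTop (𝓝 0) := by
    simpa using ENNReal.Tendsto.const_mul (tendsto_lintegral_tsub_natCast hg hgi) (Or.inr hc)
  refine ENNReal.tendsto_nhds_zero.2 fun ε hε => ?_
  have hε2 : 0 < ε / 2 := ENNReal.half_pos hε.ne'
  obtain ⟨n, hn⟩ := (ENNReal.tendsto_nhds_zero.1 htail _ hε2).exists
  have hmain : Tendsto (fun x => (n : ℝ≥0∞) * ∫⁻ o, V x o ∂μ) l (𝓝 0) := by
    simpa using ENNReal.Tendsto.const_mul h0 (Or.inr (ENNReal.natCast_ne_top n))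
  filter_upwards [hV, ENNReal.tendsto_nhds_zero.1 hmain _ hε2] with x hx hx0
  calc ∫⁻ o, g o * V x o ∂μ ≤ ∫⁻ o, (c * (g o - n) + n * V x o) ∂μ := by
        refine lintegral_mono_ae (hx.mono fun o ho => ?_)
        calc g o * V x o ≤ (n + (g o - n)) * V x o := by gcongr; exact le_add_tsub
          _ = (g o - n) * V x o + n * V x o := by ring
          _ ≤ c * (g o - n) + n * V x o := by rw [mul_comm c]; gcongr
    _ = c * ∫⁻ o, (g o - n) ∂μ + n * ∫⁻ o, V x o ∂μ := by
        rw [lintegral_add_left ((hg.sub_const _).const_mul _), lintegral_const_mul' _ _ hc,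
          lintegral_const_mul' _ _ (ENNReal.natCast_ne_top n)]
    _ ≤ ε / 2 + ε / 2 := add_le_add hn hx0
    _ = ε := ENNReal.add_halves ε

theorem ofReal_sq_mul_sub_mul_le {F f U u c : ℝ} (hU : |U| ≤ c) :
    ENNReal.ofReal ((F * U - f * u) ^ 2) ≤
      ENNReal.ofReal (2 * c ^ 2) * ENNReal.ofReal ((F - f) ^ 2) +
        ENNReal.ofReal 2 * (ENNReal.ofReal (f ^ 2) * ENNReal.ofReal ((U - u) ^ 2)) := by
  rw [← ENNReal.ofReal_mul (sq_nonneg _), ← ENNReal.ofReal_mul (by positivity),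
    ← ENNReal.ofReal_mul two_pos.le, ← ENNReal.ofReal_add (by positivity) (by positivity)]
  refine ENNReal.ofReal_le_ofReal ?_
  have hsq : U ^ 2 ≤ c ^ 2 := sq_le_sq.2 (hU.trans (le_abs_self c))
  calc (F * U - f * u) ^ 2 = ((F - f) * U + f * (U - u)) ^ 2 := by ring
    _ ≤ 2 * (((F - f) * U) ^ 2 + (f * (U - u)) ^ 2) := add_sq_le
    _ = 2 * U ^ 2 * (F - f) ^ 2 + 2 * (f ^ 2 * (U - u) ^ 2) := by ring
    _ ≤ 2 * c ^ 2 * (F - f) ^ 2 + 2 * (f ^ 2 * (U - u) ^ 2) := by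
        rel [hsq]

-- The bound on `U` is needed on top of its `L₂` limit, as a product of two `L₂` functions need not
-- be in `L₂`.
theorem tendsto_lintegral_sq_mul_sub_mul {F U : ι → 𝒳 → ℝ} {f u : 𝒳 → ℝ}
    (hF : ∀ x, Measurable (F x)) (hf : Measurable f)
    (hfi : ∫⁻ o, ENNReal.ofReal (f o ^ 2) ∂μ ≠ ⊤) {c : ℝ}
    (hU : ∀ᶠ x in l, ∀ᵐ o ∂μ, |U x o| ≤ c) (hu : ∀ᵐ o ∂μ, |u o| ≤ c)
    (hFf : Tendsto (fun x => ∫⁻ o, ENNReal.ofReal ((F x o - f o) ^ 2) ∂μ) l (𝓝 0))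
    (hUu : Tendsto (fun x => ∫⁻ o, ENNReal.ofReal ((U x o - u o) ^ 2) ∂μ) l (𝓝 0)) :
    Tendsto (fun x => ∫⁻ o, ENNReal.ofReal ((F x o * U x o - f o * u o) ^ 2) ∂μ) l (𝓝 0) := by
  have hbdd : ∀ᶠ x in l, ∀ᵐ o ∂μ,
      ENNReal.ofReal ((U x o - u o) ^ 2) ≤ ENNReal.ofReal ((c + c) ^ 2) := by
    filter_upwards [hU] with x hx
    filter_upwards [hx, hu] with o hUo huo
    refine ENNReal.ofReal_le_ofReal (sq_le_sq.2 ?_)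
    exact (abs_sub _ _).trans ((add_le_add hUo huo).trans (le_abs_self _))
  have hfU := tendsto_lintegral_mul_of_bdd (hf.pow_const 2).ennreal_ofReal hfi
    ENNReal.ofReal_ne_top hbdd hUu
  have hsum := (ENNReal.Tendsto.const_mul hFf
    (Or.inr (ENNReal.ofReal_ne_top (r := 2 * c ^ 2)))).add
    (ENNReal.Tendsto.const_mul hfU (Or.inr (ENNReal.ofReal_ne_top (r := 2))))
  simp only [mul_zero, add_zero] at hsum
  refine tendsto_of_tendsto_of_tendsto_of_le_of_le' tendsto_const_nhds hsum
    (Eventually.of_forall fun _ => zero_le) (hU.mono fun x hx => ?_)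
  have hmeas : Measurable fun o =>
      ENNReal.ofReal (2 * c ^ 2) * ENNReal.ofReal ((F x o - f o) ^ 2) :=
    (((hF x).sub hf).pow_const 2).ennreal_ofReal.const_mul _
  rw [← lintegral_const_mul' _ _ ENNReal.ofReal_ne_top,
    ← lintegral_const_mul' _ _ ENNReal.ofReal_ne_top, ← lintegral_add_left hmeas]
  exact lintegral_mono_ae (hx.mono fun o ho => ofReal_sq_mul_sub_mul_le ho)

end Products

namespace Spec

variable {M : Spec T q r p} {P : Measure (Traj T q)}

/-! ### Convergence of the fitted features -/

section Weights

variable {t : Fin T} {d d₁ d₂ d₃ : Vec r → Matrix (Fin p) (Fin p) ℝ}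

theorem lintegral_entry_le_sqDistD (i k : Fin p) :
    ∫⁻ o, ENNReal.ofReal ((d₁ (M.S t o) i k - d₂ (M.S t o) i k) ^ 2) ∂P ≤ M.sqDistD P t d₁ d₂ := by
  refine lintegral_mono fun o => ENNReal.ofReal_le_ofReal ?_
  exact (Finset.single_le_sum (f := fun k => (d₁ (M.S t o) i k - d₂ (M.S t o) i k) ^ 2)
    (fun _ _ => sq_nonneg _) (Finset.mem_univ k)).trans
    (Finset.single_le_sum (f := fun i => ∑ k, (d₁ (M.S t o) i k - d₂ (M.S t o) i k) ^ 2)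
      (fun _ _ => Finset.sum_nonneg fun _ _ => sq_nonneg _) (Finset.mem_univ i))

theorem lintegral_entry_ne_top (h : M.sqDistD P t d 0 < ⊤) (i k : Fin p) :
    ∫⁻ o, ENNReal.ofReal (d (M.S t o) i k ^ 2) ∂P ≠ ⊤ := by
  simpa using ((lintegral_entry_le_sqDistD i k).trans_lt h).ne

theorem memLp_entry (hd : ∀ i k, Measurable fun s => d s i k) (h : M.sqDistD P t d 0 < ⊤)
    (i k : Fin p) : MemLp (fun o => d (M.S t o) i k) 2 P :=
  memLp_two_of_lintegral_ne_top ((hd i k).comp (M.measurable_S t)).aestronglyMeasurable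
    (lintegral_entry_ne_top h i k)

theorem sqDistD_le (h₁ : ∀ i k, Measurable fun s => d₁ s i k)
    (h₂ : ∀ i k, Measurable fun s => d₂ s i k) :
    M.sqDistD P t d₁ d₃ ≤ 2 * M.sqDistD P t d₁ d₂ + 2 * M.sqDistD P t d₂ d₃ := by
  have hmeas : Measurable fun o => ENNReal.ofReal
      (∑ i, ∑ k, (d₁ (M.S t o) i k - d₂ (M.S t o) i k) ^ 2) :=
    (Finset.measurable_fun_sum _ fun i _ => Finset.measurable_fun_sum _ fun k _ =>
      ((((h₁ i k).sub (h₂ i k)).comp (M.measurable_S t)).pow_const 2)).ennreal_ofReal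
  unfold sqDistD
  rw [← lintegral_const_mul' _ _ ENNReal.ofNat_ne_top,
    ← lintegral_const_mul' _ _ ENNReal.ofNat_ne_top, ← lintegral_add_left (hmeas.const_mul _)]
  refine lintegral_mono fun o => ?_
  have htwo : (2 : ℝ≥0∞) = ENNReal.ofReal 2 := by simp
  rw [htwo, ← ENNReal.ofReal_mul two_pos.le, ← ENNReal.ofReal_mul two_pos.le,
    ← ENNReal.ofReal_add (by positivity) (by positivity)]
  refine ENNReal.ofReal_le_ofReal ?_
  simp only [Finset.mul_sum, ← Finset.sum_add_distrib, ← mul_add]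
  refine Finset.sum_le_sum fun i _ => Finset.sum_le_sum fun k _ => ?_
  rw [← sub_add_sub_cancel (d₁ (M.S t o) i k) (d₂ (M.S t o) i k)]
  exact add_sq_le

end Weights

section OutcomeModels

variable {t : Fin T} {C : ℝ} {mu mu' : Hist q t → Bool → ℝ}

theorem measurable_outcomeFeature {α : Type*} [MeasurableSpace α] {mu : α → Hist q t → Bool → ℝ}
    (hm : Measurable fun y : α × Hist q t × Bool => mu y.1 y.2.1 y.2.2) (m : Fin 3) :
    Measurable fun x : α × Traj T q => outcomeFeature (mu x.1) m x.2 := by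
  have havail : Measurable fun x : α × Traj T q => bit (avail t x.2) :=
    measurable_bit.comp ((measurable_avail t).comp measurable_snd)
  have harm (a : Bool) : Measurable fun x : α × Traj T q => mu x.1 (hist t x.2) a :=
    hm.comp (measurable_fst.prodMk
      (((measurable_hist t).comp measurable_snd).prodMk measurable_const))
  fin_cases m
  exacts [measurable_const, havail.mul (harm true), havail.mul (harm false)]

theorem measurable_feature {α : Type*} [MeasurableSpace α]
    {d : α → Fin T → Vec r → Matrix (Fin p) (Fin p) ℝ}
    {mu : α → ∀ t : Fin T, Hist q t → Bool → ℝ}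
    (hd : ∀ t i k, Measurable fun y : α × Vec r => d y.1 t y.2 i k)
    (hm : ∀ t : Fin T, Measurable fun y : α × Hist q t × Bool => mu y.1 t y.2.1 y.2.2)
    (j : Fin T × Fin p × Fin 3) (i : Fin p) :
    Measurable fun x : α × Traj T q => M.feature (d x.1) (mu x.1) j i x.2 :=
  ((hd j.1 i j.2.1).comp
    (measurable_fst.prodMk ((M.measurable_S j.1).comp measurable_snd))).mul
    (measurable_outcomeFeature (mu := fun x => mu x j.1) (hm j.1) j.2.2)

variable [IsProbabilityMeasure P]

theorem Design.abs_outcomeFeature_le (hd : M.Design P)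
    (hm : Measurable fun y : Hist q t × Bool => mu y.1 y.2) (h : BoundedMu P C t mu) (m : Fin 3) :
    ∀ᵐ o ∂P, |outcomeFeature mu m o| ≤ max C 1 := by
  filter_upwards [hd.boundedMu hm h true, hd.boundedMu hm h false] with o htrue hfalse
  cases hav : avail t o
  · fin_cases m <;> simp [outcomeFeature, bit, hav]
  · fin_cases m <;> simp [outcomeFeature, bit, hav, htrue hav, hfalse hav]

theorem Design.lintegral_outcomeFeature_sub_le (hd : M.Design P) {τ : ℝ} (hτ : M.Positive P τ)
    (hm : Measurable fun y : Hist q t × Bool => mu y.1 y.2)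
    (hm' : Measurable fun y : Hist q t × Bool => mu' y.1 y.2) (m : Fin 3) :
    ENNReal.ofReal τ *
      ∫⁻ o, ENNReal.ofReal ((outcomeFeature mu m o - outcomeFeature mu' m o) ^ 2) ∂P ≤
        sqDistMu P t mu mu' := by
  have harm (a : Bool) : ENNReal.ofReal τ * ∫⁻ o, ENNReal.ofReal
      ((bit (avail t o) * mu (hist t o) a - bit (avail t o) * mu' (hist t o) a) ^ 2) ∂P ≤
        sqDistMu P t mu mu' := by
    refine le_trans (le_of_eq ?_) (hd.lintegral_sub_mu_le hτ hm hm' a)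
    rw [← lintegral_indicator (measurableSet_avail t)]
    congr 1
    refine lintegral_congr fun o => ?_
    cases hav : avail t o <;> simp [bit, hav, Set.indicator]
  fin_cases m
  · simp [outcomeFeature]
  · exact harm true
  · exact harm false

theorem Design.tendsto_lintegral_outcomeFeature {ι : Type*} {l : Filter ι} (hd : M.Design P)
    {mu : ι → Hist q t → Bool → ℝ}
    (hm : ∀ x, Measurable fun y : Hist q t × Bool => mu x y.1 y.2)
    (hm' : Measurable fun y : Hist q t × Bool => mu' y.1 y.2)
    (h : Tendsto (fun x => sqDistMu P t (mu x) mu') l (𝓝 0)) (m : Fin 3) :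
    Tendsto (fun x => ∫⁻ o, ENNReal.ofReal
      ((outcomeFeature (mu x) m o - outcomeFeature mu' m o) ^ 2) ∂P) l (𝓝 0) := by
  obtain ⟨τ, hτ⟩ := hd.exists_positive
  have hτ0 : ENNReal.ofReal τ ≠ 0 := (ENNReal.ofReal_pos.2 hτ.pos).ne'
  have hlim := ENNReal.Tendsto.const_mul h (Or.inr (ENNReal.inv_ne_top.2 hτ0))
  rw [mul_zero] at hlim
  exact tendsto_of_tendsto_of_tendsto_of_le_of_le tendsto_const_nhds hlim (fun _ => zero_le)
    fun x => (ENNReal.mul_le_iff_le_inv hτ0 ENNReal.ofReal_ne_top).1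
      (hd.lintegral_outcomeFeature_sub_le hτ (hm x) hm' m)

end OutcomeModels

section Limit

variable [IsProbabilityMeasure P] {C : ℝ} {d' : Fin T → Vec r → Matrix (Fin p) (Fin p) ℝ}
  {mu' : ∀ t : Fin T, Hist q t → Bool → ℝ}

theorem Design.memLp_feature (hd : M.Design P)
    (hm : ∀ t : Fin T, Measurable fun y : Hist q t × Bool => mu' t y.1 y.2)
    (hmu : ∀ t, BoundedMu P C t (mu' t)) (hdm : ∀ t i k, Measurable fun s => d' t s i k)
    (hd2 : ∀ t, M.sqDistD P t (d' t) 0 < ⊤) (j : Fin T × Fin p × Fin 3) (i : Fin p) :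
    MemLp (M.feature d' mu' j i) 2 P := by
  have hmeas : Measurable (outcomeFeature (mu' j.1) j.2.2) :=
    (measurable_outcomeFeature (α := Unit) (mu := fun _ => mu' j.1)
      ((hm j.1).comp measurable_snd) j.2.2).comp (measurable_prodMk_left (x := ()))
  exact (memLp_top_of_bound hmeas.aestronglyMeasurable _
    (hd.abs_outcomeFeature_le (hm j.1) (hmu j.1) j.2.2)).mul (memLp_entry (hdm j.1) (hd2 j.1) i _)

theorem Design.tendsto_lintegral_feature {ι : Type*} {l : Filter ι} (hd : M.Design P)
    {d : ι → Fin T → Vec r → Matrix (Fin p) (Fin p) ℝ}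
    {mu : ι → ∀ t : Fin T, Hist q t → Bool → ℝ}
    (hm : ∀ x (t : Fin T), Measurable fun y : Hist q t × Bool => mu x t y.1 y.2)
    (hm' : ∀ t : Fin T, Measurable fun y : Hist q t × Bool => mu' t y.1 y.2)
    (hmu : ∀ t, ∀ᶠ x in l, BoundedMu P C t (mu x t)) (hmu' : ∀ t, BoundedMu P C t (mu' t))
    (hdm : ∀ x t i k, Measurable fun s => d x t s i k)
    (hdm' : ∀ t i k, Measurable fun s => d' t s i k) (hd2 : ∀ t, M.sqDistD P t (d' t) 0 < ⊤)
    (hdist : ∀ t, Tendsto (fun x => M.sqDistD P t (d x t) (d' t)) l (𝓝 0))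
    (hmudist : ∀ t, Tendsto (fun x => sqDistMu P t (mu x t) (mu' t)) l (𝓝 0))
    (j : Fin T × Fin p × Fin 3) (i : Fin p) :
    Tendsto (fun x => ∫⁻ o, ENNReal.ofReal
      ((M.feature (d x) (mu x) j i o - M.feature d' mu' j i o) ^ 2) ∂P) l (𝓝 0) := by
  obtain ⟨t, k, m⟩ := j
  exact tendsto_lintegral_sq_mul_sub_mul
    (fun x => (hdm x t i k).comp (M.measurable_S t)) ((hdm' t i k).comp (M.measurable_S t))
    (lintegral_entry_ne_top (hd2 t) i k)
    ((hmu t).mono fun x hx => hd.abs_outcomeFeature_le (hm x t) hx m)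
    (hd.abs_outcomeFeature_le (hm' t) (hmu' t) m)
    (tendsto_of_tendsto_of_tendsto_of_le_of_le tendsto_const_nhds (hdist t) (fun _ => zero_le)
      fun x => lintegral_entry_le_sqDistD i k)
    (hd.tendsto_lintegral_outcomeFeature (fun x => hm x t) (hm' t) (hmudist t) m)

theorem Design.integral_psi_apply (hd : M.Design P) (hbd : M.BoundedSupport P) {b : Vec p}
    (hb : M.EffectModel P b)
    (hm : ∀ t : Fin T, Measurable fun y : Hist q t × Bool => mu' t y.1 y.2)
    (hmu : ∀ t, BoundedMu P C t (mu' t)) (hdm : ∀ t i k, Measurable fun s => d' t s i k)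
    (hd2 : ∀ t, M.sqDistD P t (d' t) 0 < ⊤) (i : Fin p) :
    Integrable (fun o => M.psi d' mu' b o i) P ∧ ∫ o, M.psi d' mu' b o i ∂P = 0 := by
  have hterm (t : Fin T) (k : Fin p) := hd.integral_weight_mul_phi hbd hb (hm t) (hmu t)
    (hdm t i k) ((memLp_entry (hdm t) (hd2 t) i k).integrable one_le_two) k
  have hint (t : Fin T) := integrable_finsetSum Finset.univ fun k _ => (hterm t k).1
  simp only [psi_apply]
  refine ⟨integrable_finsetSum _ fun t _ => hint t, ?_⟩
  rw [integral_finsetSum _ fun t _ => hint t]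
  refine Finset.sum_eq_zero fun t _ => ?_
  rw [integral_finsetSum _ fun k _ => (hterm t k).1]
  exact Finset.sum_eq_zero fun k _ => (hterm t k).2

end Limit

end Spec

namespace Spec

/-! ### The cross-fitted estimating function -/

/-- The estimating equation of the estimator: its features are formed with the fitted weights and
outcome models, and have those formed with `d'` and `mu'` as limits. -/
noncomputable def crossFit {K : ℕ} (M : Spec T q r p) (L : Learner T q r p K)
    (d' : Fin T → Vec r → Matrix (Fin p) (Fin p) ℝ) (mu' : ∀ t : Fin T, Hist q t → Bool → ℝ) :
    Features T q p K (Fin T × Fin p × Fin 3) where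
  coef := M.phiCoef
  fit N π k z := M.feature (L.wHat N π k z) (L.muHat N π k z)
  lim := M.feature d' mu'

variable {M : Spec T q r p} {P : Measure (Traj T q)} {Ω : Type*} {K : ℕ} {O : ℕ → Ω → Traj T q}
  {fold : ∀ N : ℕ, Ω → Fin (K * N) → Fin K} {L : Learner T q r p K}
  {d' : Fin T → Vec r → Matrix (Fin p) (Fin p) ℝ} {mu' : ∀ t : Fin T, Hist q t → Bool → ℝ}

section Translation

theorem score_crossFit (d : Fin T → Vec r → Matrix (Fin p) (Fin p) ℝ)
    (mu : ∀ t : Fin T, Hist q t → Bool → ℝ) (b : Vec p) (o : Traj T q) :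
    (M.crossFit L d' mu').score (M.feature d mu) b o = M.psi d mu b o := by
  ext i
  exact (psi_apply_eq_sum d mu b o i).symm

theorem jac_crossFit (d : Fin T → Vec r → Matrix (Fin p) (Fin p) ℝ)
    (mu : ∀ t : Fin T, Hist q t → Bool → ℝ) (b : Vec p) (o : Traj T q) :
    (M.crossFit L d' mu').jac (M.feature d mu) b o = M.dpsi d mu b o := by
  ext i l
  exact (dpsi_apply_eq_sum d mu b o i l).symm

theorem lim_crossFit : (M.crossFit L d' mu').lim = M.feature d' mu' := rfl

theorem fitAt_crossFit (x : ℕ × Ω) (k : Fin K) :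
    (M.crossFit L d' mu').fitAt O fold x k =
      M.feature (wFit O fold L x.1 k x.2) (muFit O fold L x.1 k x.2) := rfl

theorem finalEq_iff (x : ℕ × Ω) (b : Vec p) :
    FinalEq O fold M L x.1 x.2 b ↔ (M.crossFit L d' mu').scoreAvg O fold x b = 0 := by
  simp only [FinalEq, Features.scoreAvg, fitAt_crossFit, score_crossFit]

variable (d' mu') in
theorem sandwich_eq (x : ℕ × Ω) (b : Vec p) :
    sandwich O fold M L x.1 x.2 b = ((M.crossFit L d' mu').jacAvg O fold x b)⁻¹ *
      (M.crossFit L d' mu').sqAvg O fold x b * (((M.crossFit L d' mu').jacAvg O fold x b)⁻¹)ᵀ := by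
  simp only [sandwich, Features.jacAvg, Features.sqAvg, fitAt_crossFit, score_crossFit,
    jac_crossFit]

theorem jacMean_crossFit (b : Vec p) :
    (M.crossFit L d' mu').jacMean P b = M.bread P d' mu' b := by
  simp only [Features.jacMean, bread, lim_crossFit, jac_crossFit]

variable (L) in
theorem asympVar_eq (b : Vec p) :
    M.asympVar P d' mu' b = ((M.crossFit L d' mu').jacMean P b)⁻¹ *
      secondMoment P ((M.crossFit L d' mu').score (M.crossFit L d' mu').lim b) *
        (((M.crossFit L d' mu').jacMean P b)⁻¹)ᵀ := by
  have hscore : (M.crossFit L d' mu').score (M.crossFit L d' mu').lim b = M.psi d' mu' b :=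
    funext fun o => score_crossFit d' mu' b o
  rw [asympVar, jacMean_crossFit, hscore]
  rfl

end Translation

theorem measurable_wFit (hL : L.Meas) (N : ℕ) (k : Fin K) (ω : Ω) (t : Fin T) (i j : Fin p) :
    Measurable fun s => wFit O fold L N k ω t s i j :=
  (hL.wHat N (fold N ω) k t i j).comp measurable_prodMk_left

theorem measurable_muFit (hL : L.Meas) (N : ℕ) (k : Fin K) (ω : Ω) (t : Fin T) :
    Measurable fun y : Hist q t × Bool => muFit O fold L N k ω t y.1 y.2 :=
  (hL.muHat N (fold N ω) k t).comp measurable_prodMk_left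

variable [MeasurableSpace Ω] {Pr : Measure Ω} {C : ℝ}

theorem Design.regular_crossFit [IsProbabilityMeasure P] (hd : M.Design P)
    (hbd : M.BoundedSupport P) (hL : L.Meas)
    (hm : ∀ t : Fin T, Measurable fun y : Hist q t × Bool => mu' t y.1 y.2)
    (ha : ∀ t k, LittleOP Pr fun N ω => sqDistMu P t (muFit O fold L N k ω t) (mu' t))
    (hmu : ∀ t, BoundedMu P C t (mu' t))
    (hmuHat : ∀ N k t, ∀ᵐ ω ∂Pr, BoundedMu P C t (muFit O fold L N k ω t))
    (hdm : ∀ t i j, Measurable fun s => d' t s i j) (hd2 : ∀ t, M.sqDistD P t (d' t) 0 < ⊤)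
    (hw : UsedWeightsConverge O fold M L Pr P d') :
    (M.crossFit L d' mu').Regular Pr P O fold where
  coef_meas := measurable_phiCoef
  coef_diff := contDiff_phiCoef
  coef_bdd := hd.phiCoef_bdd hbd
  fit_meas N π k := measurable_feature (hL.wHat N π k) (hL.muHat N π k)
  lim_meas j i := (measurable_feature (α := Unit) (d := fun _ => d') (mu := fun _ => mu')
    (fun t i k => (hdm t i k).comp measurable_snd) (fun t => (hm t).comp measurable_snd) j i).comp
      (measurable_prodMk_left (x := ()))
  lim_memLp := hd.memLp_feature hm hmu hdm hd2
  conv j i k := by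
    have hbound (t : Fin T) := eventually_inProb_of_ae fun N => hmuHat N k t
    have hdist (t : Fin T) := littleOP_iff.1 (hw t k)
    have hmudist (t : Fin T) := littleOP_iff.1 (ha t k)
    exact hd.tendsto_lintegral_feature (d := fun x : ℕ × Ω => wFit O fold L x.1 k x.2)
      (mu := fun x => muFit O fold L x.1 k x.2) (fun x => measurable_muFit hL x.1 k x.2) hm
      hbound hmu (fun x => measurable_wFit hL x.1 k x.2) hdm hd2 hdist hmudist j i

/-! ### Stochastic equicontinuity of the weights -/

section Equicontinuous

variable {Θ : Set (Vec p)} {b : Vec p}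

theorem tendsto_sqDistD_of_equicontinuous (hL : L.Meas)
    (ha : ∀ t k, LittleOP Pr fun N ω => sqDistMu P t (muFit O fold L N k ω t) (mu' t))
    (hmuHat : ∀ N k t, ∀ᵐ ω ∂Pr, BoundedMu P C t (muFit O fold L N k ω t))
    (hΘ : ∀ k, Whp Pr fun N ω => initFit O fold L N k ω ∈ Θ)
    (heq : WeightsEquicontinuous O fold M L Pr P Θ C mu' b)
    (hinit : ∀ k, TendstoInMeasure Pr (fun N ω => initFit O fold L N k ω) atTop fun _ => b)
    (t : Fin T) (k : Fin K) :
    Tendsto (fun x : ℕ × Ω => M.sqDistD P t (wFit O fold L x.1 k x.2 t)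
      (dFit O fold L x.1 k x.2 t (mu' t) b)) (inProb Pr) (𝓝 0) := by
  refine ENNReal.tendsto_nhds_zero.2 fun ε hε => eventually_inProb_iff_le.2 fun η hη => ?_
  have hη2 : 0 < η / 2 := ENNReal.half_pos hη.ne'
  obtain ⟨δ, hδ, hmodulus⟩ := heq t k ε hε (η / 2) hη2
  have hnear : ∀ᶠ x : ℕ × Ω in inProb Pr, BoundedMu P C t (muFit O fold L x.1 k x.2 t) ∧
      initFit O fold L x.1 k x.2 ∈ Θ ∧
      sqDistMu P t (muFit O fold L x.1 k x.2 t) (mu' t) ≤ ENNReal.ofReal δ ∧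
      ‖initFit O fold L x.1 k x.2 - b‖ ≤ δ := by
    filter_upwards [eventually_inProb_of_ae fun N => hmuHat N k t, whp_iff.1 (hΘ k),
      ENNReal.tendsto_nhds_zero.1 (littleOP_iff.1 (ha t k)) _ (ENNReal.ofReal_pos.2 hδ),
      Metric.tendsto_nhds.1 (tendstoInMeasure_iff_inProb.1 (hinit k)) δ hδ]
      with x hbdd hmem hmu hdist
    exact ⟨hbdd, hmem, hmu, by simpa only [dist_eq_norm] using hdist.le⟩
  filter_upwards [hmodulus, eventually_inProb_iff_le.1 hnear _ hη2] with N hfar hnotnear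
  refine (measure_mono fun ω hω => ?_).trans ((measure_union_le _ _).trans
    ((add_le_add hfar hnotnear).trans (ENNReal.add_halves η).le))
  refine or_iff_not_imp_right.2 fun h => ?_
  obtain ⟨hbdd, hmem, hmu, hdist⟩ := not_not.1 h
  exact ⟨muFit O fold L N k ω t, initFit O fold L N k ω, measurable_muFit hL N k ω t, hbdd, hmem,
    hmu, hdist, (not_le.1 hω).le⟩

theorem usedWeightsConverge_of_equicontinuous (hL : L.Meas)
    (hm : ∀ t : Fin T, Measurable fun y : Hist q t × Bool => mu' t y.1 y.2)
    (ha : ∀ t k, LittleOP Pr fun N ω => sqDistMu P t (muFit O fold L N k ω t) (mu' t))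
    (hmuHat : ∀ N k t, ∀ᵐ ω ∂Pr, BoundedMu P C t (muFit O fold L N k ω t))
    (hΘ : ∀ k, Whp Pr fun N ω => initFit O fold L N k ω ∈ Θ)
    (hlim : LimitWeightsConverge O fold M L Pr P d' mu' b)
    (heq : WeightsEquicontinuous O fold M L Pr P Θ C mu' b)
    (hinit : ∀ k, TendstoInMeasure Pr (fun N ω => initFit O fold L N k ω) atTop fun _ => b) :
    UsedWeightsConverge O fold M L Pr P d' := by
  intro t k
  have htwo : (2 : ℝ≥0∞) ≠ ⊤ := ENNReal.ofNat_ne_top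
  have hsum := (ENNReal.Tendsto.const_mul
    (tendsto_sqDistD_of_equicontinuous hL ha hmuHat hΘ heq hinit t k) (Or.inr htwo)).add
      (ENNReal.Tendsto.const_mul (littleOP_iff.1 (hlim t k)) (Or.inr htwo))
  simp only [mul_zero, add_zero] at hsum
  refine littleOP_iff.2 (tendsto_of_tendsto_of_tendsto_of_le_of_le tendsto_const_nhds hsum
    (fun _ => zero_le) fun x => sqDistD_le (measurable_wFit hL x.1 k x.2 t) fun i j => ?_)
  exact (hL.dHat x.1 (fold x.1 x.2) k t (mu' t) b i j (hm t)).comp measurable_prodMk_left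

end Equicontinuous

end Spec

theorem integral_eq_zero_iff_forall_coord {ι 𝒳 : Type*} [Fintype ι] [MeasurableSpace 𝒳]
    {μ : Measure 𝒳} {f : 𝒳 → EuclideanSpace ℝ ι} (hf : ∀ i, Integrable (fun x => f x i) μ) :
    ∫ x, f x ∂μ = 0 ↔ ∀ i, ∫ x, f x i ∂μ = 0 := by
  simp only [← eval_integral_piLp hf]
  exact ⟨fun h i => by rw [h]; rfl, fun h => PiLp.ext h⟩

namespace Spec

variable {M : Spec T q r p} {P : Measure (Traj T q)} {Ω : Type*} [MeasurableSpace Ω]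
  {Pr : Measure Ω} {K : ℕ} {O : ℕ → Ω → Traj T q} {fold : ∀ N : ℕ, Ω → Fin (K * N) → Fin K}
  {L : Learner T q r p K} {d' : Fin T → Vec r → Matrix (Fin p) (Fin p) ℝ}
  {mu' : ∀ t : Fin T, Hist q t → Bool → ℝ} {b : Vec p}

theorem UniqueZero.eq_of_integral_score_eq_zero [IsProbabilityMeasure P] {Θ : Set (Vec p)}
    (hc : M.UniqueZero P Θ d' mu') (hF : (M.crossFit L d' mu').Regular Pr P O fold) (hb : b ∈ Θ)
    (hmean : ∀ i, ∫ o, (M.crossFit L d' mu').score (M.crossFit L d' mu').lim b o i ∂P = 0) :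
    ∀ b' ∈ Θ, (∀ i, ∫ o, (M.crossFit L d' mu').score (M.crossFit L d' mu').lim b' o i ∂P = 0) →
      b' = b := by
  have hzero (b : Vec p) := integral_eq_zero_iff_forall_coord fun i =>
    (hF.score_memLp b i).integrable one_le_two
  simp only [lim_crossFit, score_crossFit] at hzero hmean ⊢
  exact fun b' hb' h => hc.unique ⟨hb', (hzero b').2 h⟩ ⟨hb, (hzero b).2 hmean⟩

theorem Design.integral_score_lim_eq_zero [IsProbabilityMeasure P] {C : ℝ} (hd : M.Design P)
    (hbd : M.BoundedSupport P) (hb : M.EffectModel P b)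
    (hm : ∀ t : Fin T, Measurable fun y : Hist q t × Bool => mu' t y.1 y.2)
    (hmu : ∀ t, BoundedMu P C t (mu' t)) (hdm : ∀ t i j, Measurable fun s => d' t s i j)
    (hd2 : ∀ t, M.sqDistD P t (d' t) 0 < ⊤) (i : Fin p) :
    ∫ o, (M.crossFit L d' mu').score (M.crossFit L d' mu').lim b o i ∂P = 0 := by
  simp only [lim_crossFit, score_crossFit]
  exact (hd.integral_psi_apply hbd hb hm hmu hdm hd2 i).2

-- The effect model makes the estimating function unbiased at the true value for any weights and
-- outcome models, so that the fitted ones cause no bias.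
theorem Design.eventually_integral_score_sub_eq_zero [IsProbabilityMeasure P] {C : ℝ}
    (hd : M.Design P) (hbd : M.BoundedSupport P) (hb : M.EffectModel P b) (hL : L.Meas)
    (hm : ∀ t : Fin T, Measurable fun y : Hist q t × Bool => mu' t y.1 y.2)
    (hmu : ∀ t, BoundedMu P C t (mu' t))
    (hmuHat : ∀ N k t, ∀ᵐ ω ∂Pr, BoundedMu P C t (muFit O fold L N k ω t))
    (hdm : ∀ t i j, Measurable fun s => d' t s i j) (hd2 : ∀ t, M.sqDistD P t (d' t) 0 < ⊤)
    (hw : UsedWeightsConverge O fold M L Pr P d') (i : Fin p) (k : Fin K) :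
    ∀ᶠ x in inProb Pr,
      ∫ o, ((M.crossFit L d' mu').score ((M.crossFit L d' mu').fitAt O fold x k) b o i -
        (M.crossFit L d' mu').score (M.crossFit L d' mu').lim b o i) ∂P = 0 := by
  have hmuFit : ∀ᶠ x in inProb Pr, ∀ t, BoundedMu P C t (muFit O fold L x.1 k x.2 t) :=
    eventually_all.2 fun t => eventually_inProb_of_ae
      (E := fun N ω => BoundedMu P C t (muFit O fold L N k ω t)) fun N => hmuHat N k t
  have hwFit : ∀ᶠ x in inProb Pr, ∀ t, M.sqDistD P t (wFit O fold L x.1 k x.2 t) (d' t) < 1 :=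
    eventually_all.2 fun t => (littleOP_iff.1 (hw t k)).eventually_lt_const one_pos
  filter_upwards [hmuFit, hwFit] with x hmux hwx
  have hfinite (t : Fin T) : M.sqDistD P t (wFit O fold L x.1 k x.2 t) 0 < ⊤ :=
    (sqDistD_le (measurable_wFit hL x.1 k x.2 t) (hdm t)).trans_lt <| ENNReal.add_lt_top.2
      ⟨ENNReal.mul_lt_top ENNReal.ofNat_lt_top ((hwx t).trans ENNReal.one_lt_top),
        ENNReal.mul_lt_top ENNReal.ofNat_lt_top (hd2 t)⟩
  have hfit := hd.integral_psi_apply hbd hb (measurable_muFit hL x.1 k x.2) hmux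
    (measurable_wFit hL x.1 k x.2) hfinite i
  have hlim := hd.integral_psi_apply hbd hb hm hmu hdm hd2 i
  simp only [lim_crossFit, fitAt_crossFit, score_crossFit]
  rw [integral_sub hfit.1 hlim.1, hfit.2, hlim.2, sub_zero]

end Spec

end MRT

open MRT in
theorem theorem4p3_general {T q r p K : ℕ} (hK : 0 < K)
    {Ω : Type*} [MeasurableSpace Ω] (Pr : Measure Ω) [IsProbabilityMeasure Pr]
    (P : Measure (Traj T q)) [IsProbabilityMeasure P]
    (M : Spec T q r p) (hdesign : M.Design P)
    (Θ : Set (Vec p)) (hΘ : IsCompact Θ) (hbdd : M.BoundedSupport P)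
    (bstar : Vec p) (hbstar : bstar ∈ Θ) (hmodel : M.EffectModel P bstar)
    (O : ℕ → Ω → Traj T q) (fold : ∀ N : ℕ, Ω → Fin (K * N) → Fin K)
    (hsample : Sampling Pr P O fold) (L : Learner T q r p K) (hL : L.Meas)
    (bcheck : ℕ → Ω → Vec p) (hbcheck : ∀ N, Measurable (bcheck N))
    (hfinal : Whp Pr fun N ω => bcheck N ω ∈ Θ ∧ FinalEq O fold M L N ω (bcheck N ω))
    (mu' : ∀ t : Fin T, Hist q t → Bool → ℝ)
    (hmu'_meas : ∀ t : Fin T, Measurable fun y : Hist q t × Bool => mu' t y.1 y.2)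
    (ha : ∀ t k, LittleOP Pr fun N ω => sqDistMu P t (muFit O fold L N k ω t) (mu' t))
    (C : ℝ) (hmu'_bdd : ∀ t, BoundedMu P C t (mu' t))
    (hmuHat_bdd : ∀ N k t, ∀ᵐ ω ∂Pr, BoundedMu P C t (muFit O fold L N k ω t))
    (d' : Fin T → Vec r → Matrix (Fin p) (Fin p) ℝ)
    (hd'_meas : ∀ t i j, Measurable fun s => d' t s i j)
    (hd'_L2 : ∀ t, M.sqDistD P t (d' t) 0 < ⊤)
    (hw : UsedWeightsConverge O fold M L Pr P d')
    (hc : M.UniqueZero P Θ d' mu') (hd : IsUnit (M.bread P d' mu' bstar)) :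
    TendstoInDistribution (fun N ω => √((K * N : ℕ) : ℝ) • (bcheck N ω - bstar)) atTop
        (id : Vec p → Vec p) (fun _ => Pr)
        (multivariateGaussian 0 (M.asympVar P d' mu' bstar)) ∧
      ∀ i j, TendstoInMeasure Pr (fun N ω => sandwich O fold M L N ω (bcheck N ω) i j) atTop
        (fun _ => M.asympVar P d' mu' bstar i j) := by
  have hF := hdesign.regular_crossFit hbdd hL hmu'_meas ha hmu'_bdd hmuHat_bdd hd'_meas hd'_L2 hw
  have hmean := hdesign.integral_score_lim_eq_zero (L := L) hbdd hmodel hmu'_meas hmu'_bdd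
    hd'_meas hd'_L2
  have hbias := hdesign.eventually_integral_score_sub_eq_zero hbdd hmodel hL hmu'_meas hmu'_bdd
    hmuHat_bdd hd'_meas hd'_L2 hw
  have hsolves : ∀ᶠ x in inProb Pr, bcheck x.1 x.2 ∈ Θ ∧
      (M.crossFit L d' mu').scoreAvg O fold x (bcheck x.1 x.2) = 0 :=
    (whp_iff.1 hfinal).mono fun x hx => ⟨hx.1, (Spec.finalEq_iff x _).1 hx.2⟩
  have hcons := hF.tendsto_of_scoreAvg_eq_zero hsample hK hΘ
    (hc.eq_of_integral_score_eq_zero hF hbstar hmean) hsolves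
  have hD : IsUnit ((M.crossFit L d' mu').jacMean P bstar) := by rwa [Spec.jacMean_crossFit]
  have hsandwich := hF.tendsto_sandwich hsample hK hD hcons
  simp only [← Spec.sandwich_eq, ← Spec.asympVar_eq] at hsandwich
  refine ⟨?_, fun i j => tendstoInMeasure_iff_inProb.2 ((hsandwich.apply_nhds i).apply_nhds j)⟩
  rw [Spec.asympVar_eq L]
  exact hF.tendstoInDistribution hsample hK hbias hmean hD hbcheck hcons
    (hsolves.mono fun x hx => hx.2)

theorem theorem4p3 {T q r p K : ℕ} (hK : 2 ≤ K)
    {Ω : Type*} [MeasurableSpace Ω] (Pr : MeasureTheory.Measure Ω)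
    [MeasureTheory.IsProbabilityMeasure Pr]
    (P : MeasureTheory.Measure (MRT.Traj T q)) [MeasureTheory.IsProbabilityMeasure P]
    (M : MRT.Spec T q r p) (hdesign : M.Design P)
    -- compact parameter space, bounded observations, and the effect model with true value `bstar`
    (Θ : Set (MRT.Vec p)) (hΘ : IsCompact Θ)
    (hbdd : M.BoundedSupport P)
    (bstar : MRT.Vec p) (hbstar : bstar ∈ Θ) (hmodel : M.EffectModel P bstar)
    -- the sample, the random folds and the fitting procedures
    (O : ℕ → Ω → MRT.Traj T q) (fold : ∀ N : ℕ, Ω → Fin (K * N) → Fin K)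
    (hsample : MRT.Sampling Pr P O fold)
    (L : MRT.Learner T q r p K) (hL : L.Meas)
    -- the preliminary estimators and the final estimator solve their estimating equations
    (hinit : ∀ k, MRT.Whp Pr fun N ω => MRT.initFit O fold L N k ω ∈ Θ ∧
      MRT.InitEq O fold M L N k ω (MRT.initFit O fold L N k ω))
    (bcheck : ℕ → Ω → MRT.Vec p) (hbcheck : ∀ N, Measurable (bcheck N))
    (hfinal : MRT.Whp Pr fun N ω => bcheck N ω ∈ Θ ∧
      MRT.FinalEq O fold M L N ω (bcheck N ω))
    -- the limits of the fitted outcome models, and boundedness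
    (mu' : ∀ t : Fin T, MRT.Hist q t → Bool → ℝ)
    (hmu'_meas : ∀ t : Fin T, Measurable fun y : MRT.Hist q t × Bool => mu' t y.1 y.2)
    (ha : ∀ t k, MRT.LittleOP Pr fun N ω =>
      MRT.sqDistMu P t (MRT.muFit O fold L N k ω t) (mu' t))
    (C : ℝ) (hmu'_bdd : ∀ t, MRT.BoundedMu P C t (mu' t))
    (hmuHat_bdd : ∀ N k t, ∀ᵐ ω ∂Pr, MRT.BoundedMu P C t (MRT.muFit O fold L N k ω t))
    -- the limits of the fitted weights
    (d' : Fin T → MRT.Vec r → Matrix (Fin p) (Fin p) ℝ)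
    (hd'_meas : ∀ t i j, Measurable fun s => d' t s i j)
    (hd'_L2 : ∀ t, M.sqDistD P t (d' t) 0 < ⊤)
    (hb : MRT.UsedWeightsConverge O fold M L Pr P d' ∨
      (MRT.LimitWeightsConverge O fold M L Pr P d' mu' bstar ∧
        MRT.WeightsEquicontinuous O fold M L Pr P Θ C mu' bstar ∧
        ∀ k, MeasureTheory.TendstoInMeasure Pr (fun N ω => MRT.initFit O fold L N k ω)
          Filter.atTop fun _ => bstar))
    -- unique zero and invertibility
    (hc : M.UniqueZero P Θ d' mu')
    (hd : IsUnit (M.bread P d' mu' bstar)) :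
    MeasureTheory.TendstoInDistribution
        (fun N ω => Real.sqrt ((K * N : ℕ) : ℝ) • (bcheck N ω - bstar)) Filter.atTop
        (id : MRT.Vec p → MRT.Vec p) (fun _ => Pr)
        (ProbabilityTheory.multivariateGaussian 0 (M.asympVar P d' mu' bstar)) ∧
      ∀ i j, MeasureTheory.TendstoInMeasure Pr
        (fun N ω => MRT.sandwich O fold M L N ω (bcheck N ω) i j) Filter.atTop
        (fun _ => M.asympVar P d' mu' bstar i j) := by
  have hΘinit (k : Fin K) : MRT.Whp Pr fun N ω => MRT.initFit O fold L N k ω ∈ Θ :=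
    MRT.whp_iff.2 ((MRT.whp_iff.1 (hinit k)).mono fun _ hx => hx.1)
  have hw : MRT.UsedWeightsConverge O fold M L Pr P d' :=
    hb.elim id fun ⟨hlim, hequi, hcons⟩ => MRT.Spec.usedWeightsConverge_of_equicontinuous hL
      hmu'_meas ha hmuHat_bdd hΘinit hlim hequi hcons
  exact theorem4p3_general (zero_lt_two.trans_le hK) Pr P M hdesign Θ hΘ hbdd bstar hbstar hmodel
    O fold hsample L hL bcheck hbcheck hfinal mu' hmu'_meas ha C hmu'_bdd hmuHat_bdd d' hd'_meas
    hd'_L2 hw hc hd
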